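/- A temporal $k$-path graph $\mathcal G$ is a directed temporal multigraph on a finite vertex set $V$ whose multiset of temporal edges is the union of $k$ given temporal base-paths $P_1,\dots,P_k$. A temporal path is a path (no repeated vertex) of consecutive directed edges with strictly increasing integer labels. A vertex $s$ reaches $v$ in $\mathcal G$ if there is a temporal path from $s$ to $v$, and $R^{\mathcal G}(s)$ is the set of vertices reached by $s$ (with $s\in R^{\mathcal G}(s)$ by the empty path). A shifting operation picks an edge $e$ of a base-path $P_i$, with current label $t$, and an integer $\delta$. It replaces the label of $e$ by $t+\delta$, the label $t'$ of the $d$-th edge after $e$ on $P_i$ by $\max(t',t+\delta+d)$, and the label $t'$ of the $d$-th edge before $e$ on $P_i$ by $\min(t',t+\delta-d)$; all other labels stay the same. Its cost is $|\delta|$. It is a delay if $\delta>0$ and an advance if $\delta<0$. The operations of a sequence are applied one after another, and the cost of the sequence is the sum of their costs. Problem MaxReach: given a temporal $k$-path graph $\mathcal G$ (with its base-paths), a budget $b\in\mathbb N=\{0,1,2,\dots\}$ and a source vertex $s$, output a sequence of shifting operations of total cost at most $b$ such that $|R^{\mathcal G'}(s)|$ is maximum, where $\mathcal G'$ results from $\mathcal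 G$ by applying the sequence. There are three variants: only delays are allowed, only advances are allowed, or all shifting operations are allowed. Let $|\mathcal G|$ denote the number of vertices, plus the number of temporal edges, plus the number $k$ of base-paths. Running time is counted on a unit-cost random access machine with integer addition, subtraction and comparison. Theorem. Each of the three variants of MaxReach is fixed-parameter tractable when parameterized by $b+k$; that is, there are a computable function $f$ and a constant $c$ such that it can be solved in time at most $f(b+k)\cdot|\mathcal G|^{c}$. Moreover, each variant can be solved in time $$O\bigl(\max(b,1)^{6k}\cdot k^{2k}\cdot|\mathcal G|^{O(1)}\bigr),$$ that is, there are constants $C,c$ such that one algorithm solves every instance in at most $C\cdot\max(b,1)^{6k}\cdot k^{2k}\cdot|\mathcal G|^{c}$ steps (with $0^0=1$). -/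

import Mathlib

/-! ### Temporal `k`-path graphs -/

/-- A temporal `k`-path graph on the vertex set `Fin n`, given with its `k` temporal base-paths.
Base-path `i` has `len i` edges, visits the pairwise distinct vertices
`vert i 0, …, vert i (len i)`, and its `j`-th edge, from `vert i j` to `vert i (j + 1)`, carries
the label `label i j`; labels are strictly increasing along a base-path.  The edges of the directed
multigraph are the edges of the base-paths, counted with multiplicity. -/
structure KPathGraph (n k : ℕ) where
  len : Fin k → ℕ
  vert : (i : Fin k) → Fin (len i + 1) → Fin n
  vert_injective : ∀ i, Function.Injective (vert i)
  label : (i : Fin k) → Fin (len i) → ℤ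
  label_strictMono : ∀ i, StrictMono (label i)

namespace KPathGraph

/-- The (temporal) edges: the `e.2`-th edge of base-path `e.1`. -/
abbrev Edge {n k : ℕ} (G : KPathGraph n k) : Type := (i : Fin k) × Fin (G.len i)

/-- The tail of an edge. -/
def src {n k : ℕ} (G : KPathGraph n k) (e : G.Edge) : Fin n := G.vert e.1 e.2.castSucc

/-- The head of an edge. -/
def tgt {n k : ℕ} (G : KPathGraph n k) (e : G.Edge) : Fin n := G.vert e.1 e.2.succ

/-- The label of an edge. -/
def time {n k : ℕ} (G : KPathGraph n k) (e : G.Edge) : ℤ := G.label e.1 e.2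

/-- The sequence of edges `es` is a temporal path from `u` to `v`: consecutive edges meet, labels
strictly increase, no vertex is repeated.  The empty sequence is a temporal path from `u` to `u`. -/
def IsTemporalPath {n k : ℕ} (G : KPathGraph n k) (u v : Fin n) (es : List G.Edge) : Prop :=
  es.IsChain (fun e e' => G.tgt e = G.src e' ∧ G.time e < G.time e') ∧
    (∀ e ∈ es.head?, G.src e = u) ∧
    (u :: es.map G.tgt).Nodup ∧
    (u :: es.map G.tgt).getLast? = some v

/-- The set of vertices that `s` reaches. -/
def reach {n k : ℕ} (G : KPathGraph n k) (s : Fin n) : Set (Fin n) :=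
  {v | ∃ es : List G.Edge, G.IsTemporalPath s v es}

/-- The size of a temporal `k`-path graph: the number of vertices, plus the number of temporal
edges, plus the number of base-paths. -/
def size {n k : ℕ} (G : KPathGraph n k) : ℕ := n + (∑ i, G.len i) + k

end KPathGraph

/-! ### Shifting operations -/

/-- A shifting operation on a temporal `k`-path graph whose base-paths have lengths `len`: the label
of the edge number `pos` of base-path `path` is changed by `amount`. -/
structure ShiftOp {k : ℕ} (len : Fin k → ℕ) where
  path : Fin k
  pos : Fin (len path)
  amount : ℤ

/-- The labels after one shifting operation, with its propagation along the base-path. -/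
def shiftLabels {k : ℕ} {len : Fin k → ℕ} (lab : (i : Fin k) → Fin (len i) → ℤ)
    (o : ShiftOp len) : (i : Fin k) → Fin (len i) → ℤ := fun i j =>
  if i = o.path then
    if (j : ℕ) = o.pos then lab o.path o.pos + o.amount
    else if (o.pos : ℕ) < j then
      max (lab i j) (lab o.path o.pos + o.amount + ((j : ℤ) - (o.pos : ℤ)))
    else
      min (lab i j) (lab o.path o.pos + o.amount - ((o.pos : ℤ) - (j : ℤ)))
  else lab i j

theorem shiftLabels_strictMono {k : ℕ} {len : Fin k → ℕ} (lab : (i : Fin k) → Fin (len i) → ℤ)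
    (o : ShiftOp len) (h : ∀ i, StrictMono (lab i)) (i : Fin k) :
    StrictMono (shiftLabels lab o i) := by
  intro a b hab
  have h1 := h i hab
  have h2 : (a : ℕ) < b := hab
  unfold shiftLabels
  split_ifs <;> omega

theorem foldl_shiftLabels_strictMono {k : ℕ} {len : Fin k → ℕ} (ops : List (ShiftOp len))
    (lab : (i : Fin k) → Fin (len i) → ℤ) (h : ∀ i, StrictMono (lab i)) (i : Fin k) :
    StrictMono (ops.foldl shiftLabels lab i) := by
  induction ops generalizing lab with
  | nil => exact h i
  | cons o os ih => exact ih _ (shiftLabels_strictMono lab o h)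

/-- The temporal `k`-path graph obtained by applying a sequence of shifting operations one after
another. -/
def KPathGraph.shiftAll {n k : ℕ} (G : KPathGraph n k) (ops : List (ShiftOp G.len)) :
    KPathGraph n k where
  len := G.len
  vert := G.vert
  vert_injective := G.vert_injective
  label := ops.foldl shiftLabels G.label
  label_strictMono := foldl_shiftLabels_strictMono ops G.label G.label_strictMono

/-- The three variants of the problem. -/
inductive ShiftKind
  | delayOnly
  | advanceOnly
  | anyShift

/-- Which amounts an operation may have in each variant. -/
def ShiftKind.Allows : ShiftKind → ℤ → Prop
  | .delayOnly, d => 0 < d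
  | .advanceOnly, d => d < 0
  | .anyShift, _ => True

/-! ### The problem `MaxReach` -/

/-- An instance of `MaxReach`: a temporal `k`-path graph, a budget and a source vertex. -/
structure MaxReachInstance where
  n : ℕ
  k : ℕ
  graph : KPathGraph n k
  budget : ℕ
  source : Fin n

namespace MaxReachInstance

/-- Only allowed operations are used, and their total cost is within the budget. -/
def IsFeasible (I : MaxReachInstance) (kind : ShiftKind) (ops : List (ShiftOp I.graph.len)) :
    Prop :=
  (∀ o ∈ ops, kind.Allows o.amount) ∧ (ops.map fun o => o.amount.natAbs).sum ≤ I.budget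

/-- The number of vertices that the source reaches after the operations. -/
noncomputable def value (I : MaxReachInstance) (ops : List (ShiftOp I.graph.len)) : ℕ :=
  ((I.graph.shiftAll ops).reach I.source).ncard

/-- A feasible sequence of operations that maximizes the number of reached vertices. -/
def IsOptimal (I : MaxReachInstance) (kind : ShiftKind) (ops : List (ShiftOp I.graph.len)) :
    Prop :=
  I.IsFeasible kind ops ∧ ∀ ops', I.IsFeasible kind ops' → I.value ops' ≤ I.value ops

end MaxReachInstance

/-! ### The machine model: a unit-cost random access machine

A program is a fixed finite object.  It has integer registers and integer memory arrays; the
arithmetic operations are addition and subtraction. -/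

namespace Ram

/-- The contents of registers and arrays. -/
structure Store where
  reg : ℕ → ℤ
  mem : ℕ → ℤ → ℤ

/-- Expressions: constants, registers, array cells `a[i]`, sums and differences. -/
inductive Expr
  | const (z : ℤ)
  | reg (r : ℕ)
  | cell (a : ℕ) (i : Expr)
  | add (e₁ e₂ : Expr)
  | sub (e₁ e₂ : Expr)

/-- The value of an expression. -/
def Expr.eval (σ : Store) : Expr → ℤ
  | .const z => z
  | .reg r => σ.reg r
  | .cell a i => σ.mem a (i.eval σ)
  | .add e₁ e₂ => e₁.eval σ + e₂.eval σ
  | .sub e₁ e₂ => e₁.eval σ - e₂.eval σ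

/-- The number of steps for evaluating an expression: one for every node of its syntax tree. -/
def Expr.cost : Expr → ℕ
  | .const _ => 1
  | .reg _ => 1
  | .cell _ i => i.cost + 1
  | .add e₁ e₂ => e₁.cost + e₂.cost + 1
  | .sub e₁ e₂ => e₁.cost + e₂.cost + 1

/-- Programs: `assign r e` is `r := e`; `write a i e` is `a[i] := e`; `ifLe e₁ e₂ p q` runs `p` if
`e₁ ≤ e₂` and `q` otherwise; `whileLe e₁ e₂ p` repeats `p` as long as `e₁ ≤ e₂`. -/
inductive Prog
  | skip
  | assign (r : ℕ) (e : Expr)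
  | write (a : ℕ) (i e : Expr)
  | seq (p q : Prog)
  | ifLe (e₁ e₂ : Expr) (p q : Prog)
  | whileLe (e₁ e₂ : Expr) (p : Prog)

/-- `σ` with register `r` set to `z`. -/
def Store.setReg (σ : Store) (r : ℕ) (z : ℤ) : Store :=
  { σ with reg := Function.update σ.reg r z }

/-- `σ` with cell `i` of array `a` set to `z`. -/
def Store.setMem (σ : Store) (a : ℕ) (i z : ℤ) : Store :=
  { σ with mem := Function.update σ.mem a (Function.update (σ.mem a) i z) }

/-- `Runs p σ t τ`: program `p`, started in `σ`, halts in `τ` after exactly `t` steps. -/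
inductive Runs : Prog → Store → ℕ → Store → Prop
  | skip (σ : Store) : Runs .skip σ 1 σ
  | assign (r : ℕ) (e : Expr) (σ : Store) :
      Runs (.assign r e) σ (e.cost + 1) (σ.setReg r (e.eval σ))
  | write (a : ℕ) (i e : Expr) (σ : Store) :
      Runs (.write a i e) σ (i.cost + e.cost + 1) (σ.setMem a (i.eval σ) (e.eval σ))
  | seq {p q : Prog} {σ τ υ : Store} {t u : ℕ} :
      Runs p σ t τ → Runs q τ u υ → Runs (.seq p q) σ (t + u) υ
  | ifTrue {e₁ e₂ : Expr} {p q : Prog} {σ τ : Store} {t : ℕ} :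
      e₁.eval σ ≤ e₂.eval σ → Runs p σ t τ →
        Runs (.ifLe e₁ e₂ p q) σ (e₁.cost + e₂.cost + 1 + t) τ
  | ifFalse {e₁ e₂ : Expr} {p q : Prog} {σ τ : Store} {t : ℕ} :
      ¬ e₁.eval σ ≤ e₂.eval σ → Runs q σ t τ →
        Runs (.ifLe e₁ e₂ p q) σ (e₁.cost + e₂.cost + 1 + t) τ
  | whileTrue {e₁ e₂ : Expr} {p : Prog} {σ τ υ : Store} {t u : ℕ} :
      e₁.eval σ ≤ e₂.eval σ → Runs p σ t τ → Runs (.whileLe e₁ e₂ p) τ u υ →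
        Runs (.whileLe e₁ e₂ p) σ (e₁.cost + e₂.cost + 1 + t + u) υ
  | whileFalse {e₁ e₂ : Expr} {p : Prog} {σ : Store} :
      ¬ e₁.eval σ ≤ e₂.eval σ → Runs (.whileLe e₁ e₂ p) σ (e₁.cost + e₂.cost + 1) σ

/-- The initial store: the input word is in cells `0, 1, 2, …` of array `0`, all else is `0`. -/
def Store.init (w : List ℤ) : Store where
  reg := fun _ => 0
  mem := fun a i => if a = 0 ∧ 0 ≤ i then w.getD i.toNat 0 else 0

/-- The store carries the output word `w` in cells `0, 1, 2, …` of array `1`. -/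
def Store.HasOutput (σ : Store) (w : List ℤ) : Prop :=
  ∀ (m : ℕ) (h : m < w.length), σ.mem 1 m = w[m]

end Ram

/-! ### Solving `MaxReach` on the machine -/

/-- The input word of an instance: `n`, `k`, the budget, the source, and then for each base-path
its number of edges, its vertices in order, and its labels in order. -/
def MaxReachInstance.encode (I : MaxReachInstance) : List ℤ :=
  [(I.n : ℤ), (I.k : ℤ), (I.budget : ℤ), ((I.source : ℕ) : ℤ)] ++
    (List.finRange I.k).flatMap fun i =>
      (I.graph.len i : ℤ) ::
        (List.ofFn (fun j => ((I.graph.vert i j : ℕ) : ℤ)) ++ List.ofFn (I.graph.label i))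

/-- The output word of a sequence of operations: their number, and then for each operation the
base-path, the position of the edge on it, and the amount. -/
def encodeOps {k : ℕ} {len : Fin k → ℕ} (ops : List (ShiftOp len)) : List ℤ :=
  (ops.length : ℤ) ::
    ops.flatMap fun o => [((o.path : ℕ) : ℤ), ((o.pos : ℕ) : ℤ), o.amount]

/-- One program solves every instance `I` of the given variant of `MaxReach` within `T I` steps:
it halts with an optimal sequence of operations as its output. -/
def SolvableInTime (kind : ShiftKind) (T : MaxReachInstance → ℕ) : Prop :=
  ∃ p : Ram.Prog, ∀ I : MaxReachInstance, ∃ (t : ℕ) (τ : Ram.Store)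
    (ops : List (ShiftOp I.graph.len)),
    Ram.Runs p (Ram.Store.init I.encode) t τ ∧ t ≤ T I ∧
      τ.HasOutput (encodeOps ops) ∧ I.IsOptimal kind ops

/-- The given variant of `MaxReach` is fixed-parameter tractable by the parameter `κ`. -/
def IsFixedParameterTractable (kind : ShiftKind) (κ : MaxReachInstance → ℕ) : Prop :=
  ∃ f : ℕ → ℕ, Computable f ∧ ∃ c : ℕ,
    SolvableInTime kind fun I => f (κ I) * I.graph.size ^ c

/-! ### Reachability through usable edges -/

/-! Once some edge of a base-path can be used from the source, all later edges of that base-path can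
be used too. The reached set is therefore determined by one boarding position per base-path. A
base-path is boarded either at the source, or from an edge of another base-path, its host, that
enters the boarding vertex with a smaller label. The positions are too many to guess, but the label
changes that matter are bounded by the budget. So the algorithm guesses a `Plan`: for each base-path
another base-path, one of five boarding types and five numbers between 0 and b. It then computes the
positions.

Computing the positions. For a fixed plan the conditions `Consistent` have a least solution if they
have any. Suppose `p` lies below every solution and violates a condition. Then this condition names
one base-path whose position must grow in every solution (`LocalOK.bump`, `LinkOK.bump_leader`,
`LinkOK.bump_member`). Increasing positions from 0 thus ends, after polynomially many checks, in the
least solution or in a proof that there is none. Earlier boarding serves more vertices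
(`served_anti`), so the least solution is the best one for its plan. The argument needs monotone
conditions. For this reason a plan fixes the exact difference between the boarding label and the
label of the entering edge whenever the latter relies on an advance: the position of the entering
edge on the host then grows with the boarding position (`LocalOK.alight_mono`).

A plan is as good as it claims. Delaying each boarding edge by `dl` and advancing the entering edges
of the leaders by `adv` costs at most the sum of these numbers (`planOps_cost`). Boarding edges keep
at least their planned labels, entering edges get smaller ones, and every served vertex is reached
(`served_subset_reach`).

Every sequence of operations is matched by a plan that is no more expensive (`exists_plan`). Delays
are simple: no label on a base-path rises by more than the total delay spent there. For advances,
call label minus index the level of an edge; it is nondecreasing along a base-path. An advance by d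
sweeps at most d levels, so the union of all level intervals swept on a base-path is no larger than
the advance spent there (`card_sweep_le`). The entering edges that had to be advanced on a common
host have intervals with monotone end points. These can be merged into groups whose lengths add up
to at most the size of the union (`exists_leaders`). One advance at the last edge of a group, the
leader, propagates to all its members.

Hence the best served count over all affordable consistent plans is the optimum. There are at most
k^k * 5^k * (b+1)^(5k) plans. With b+1 at most 2 * max(b,1) the constants give 160^k, which is
absorbed by a constant times k^k; the sixth factor max(b,1)^k is slack. The remainder is a program
for the random access machine that runs through the plans as numbers in a mixed radix, with a proof
of its correctness and of its time bound. -/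

namespace KPathGraph

variable {n k : ℕ} (G : KPathGraph n k)

/-- An edge is usable from `s` if some temporal walk that starts in `s` ends with it. -/
inductive Usable (s : Fin n) : G.Edge → Prop
  | start {e : G.Edge} : G.src e = s → Usable s e
  | step {e e' : G.Edge} : Usable s e' → G.tgt e' = G.src e → G.time e' < G.time e → Usable s e

theorem src_ne_tgt (e : G.Edge) : G.src e ≠ G.tgt e := by
  intro h
  have := G.vert_injective e.1 h
  simp [Fin.ext_iff] at this

theorem IsTemporalPath.prefix {u v w : Fin n} {es : List G.Edge} (h : G.IsTemporalPath u v es)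
    (hw : w ∈ u :: es.map G.tgt) : ∃ es', es' <+: es ∧ G.IsTemporalPath u w es' := by
  rcases List.mem_cons.1 hw with rfl | hw
  · exact ⟨[], List.nil_prefix, by simp, by simp, by simp, by simp⟩
  obtain ⟨e, he, rfl⟩ := List.mem_map.1 hw
  obtain ⟨l₁, l₂, rfl⟩ := List.append_of_mem he
  obtain ⟨h1, h2, h3, -⟩ := h
  have hp : l₁ ++ [e] <+: l₁ ++ e :: l₂ := ⟨l₂, by simp⟩
  refine ⟨l₁ ++ [e], hp, h1.prefix hp, ?_, ?_, ?_⟩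
  · cases l₁ <;> simpa using h2
  · refine h3.sublist (List.Sublist.cons_cons _ (hp.sublist.map _))
  · simp [List.getLast?_cons]

theorem IsTemporalPath.concat {u : Fin n} {es : List G.Edge} {e : G.Edge}
    (h : G.IsTemporalPath u (G.src e) es) (ht : ∀ e' ∈ es, G.time e' < G.time e)
    (hn : G.tgt e ∉ u :: es.map G.tgt) : G.IsTemporalPath u (G.tgt e) (es ++ [e]) := by
  obtain ⟨h1, h2, h3, h4⟩ := h
  refine ⟨?_, ?_, ?_, ?_⟩
  · refine List.isChain_append.2 ⟨h1, by simp, ?_⟩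
    intro x hx y hy
    obtain rfl : e = y := by simpa using hy
    refine ⟨?_, ht x (List.mem_of_mem_getLast? hx)⟩
    rcases List.eq_nil_or_concat es with rfl | ⟨l, a, rfl⟩
    · simp at hx
    · simp [List.getLast?_cons] at hx h4
      rw [← hx, h4]
  · cases es with
    | nil => simpa using h4.symm
    | cons a l => simpa using h2
  · have : u :: (es ++ [e]).map G.tgt = (u :: es.map G.tgt) ++ [G.tgt e] := by simp
    rw [this]
    exact List.Nodup.append h3 (by simp) (by simpa [List.disjoint_singleton] using hn)
  · simp [List.getLast?_cons]

/-- A walk with increasing labels shortens to a path: if the head of the last edge has been visited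
before, the prefix up to that visit suffices. The bound on the labels carries the induction, since
the next edge must be later than everything before it. -/
theorem Usable.exists_path {s : Fin n} {e : G.Edge} (h : G.Usable s e) :
    ∃ es, G.IsTemporalPath s (G.tgt e) es ∧ ∀ e' ∈ es, G.time e' ≤ G.time e := by
  induction h with
  | @start e h =>
    refine ⟨[e], ⟨by simp, by simpa using h, ?_, by simp⟩, by simp⟩
    have := G.src_ne_tgt e
    simpa [h] using this
  | @step e e' _ hv ht ih =>
    obtain ⟨es, hp, hle⟩ := ih
    by_cases hm : G.tgt e ∈ s :: es.map G.tgt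
    · obtain ⟨es', hpre, hp'⟩ := hp.prefix G hm
      exact ⟨es', hp', fun x hx => (hle x (hpre.subset hx)).trans ht.le⟩
    · refine ⟨es ++ [e], IsTemporalPath.concat G (hv ▸ hp) (fun x hx => (hle x hx).trans_lt ht) hm,
        ?_⟩
      intro x hx
      rcases List.mem_append.1 hx with hx | hx
      · exact (hle x hx).trans ht.le
      · rw [List.mem_singleton.1 hx]

theorem usable_of_chain {s : Fin n} (es : List G.Edge) (e : G.Edge)
    (hc : (e :: es).IsChain (fun e e' => G.tgt e = G.src e' ∧ G.time e < G.time e'))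
    (he : G.Usable s e) : ∀ x ∈ e :: es, G.Usable s x := by
  induction es generalizing e with
  | nil => simpa using he
  | cons a l ih =>
    rw [List.isChain_cons_cons] at hc
    intro x hx
    rcases List.mem_cons.1 hx with rfl | hx
    · exact he
    · exact ih a hc.2 (.step he hc.1.1 hc.1.2) x hx

theorem mem_reach_iff (s v : Fin n) :
    v ∈ G.reach s ↔ v = s ∨ ∃ e, G.Usable s e ∧ G.tgt e = v := by
  constructor
  · rintro ⟨es, h1, h2, -, h4⟩
    cases es with
    | nil => left; simpa using h4.symm
    | cons a l =>
      right
      have hu := G.usable_of_chain l a h1 (.start (h2 a (by simp)))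
      have hv : v ∈ (a :: l).map G.tgt := by
        apply List.mem_of_getLast? (l := (a :: l).map G.tgt)
        simpa [List.getLast?_cons] using h4
      obtain ⟨e, he, rfl⟩ := List.mem_map.1 hv
      exact ⟨e, hu e he, rfl⟩
  · rintro (rfl | ⟨e, he, rfl⟩)
    · exact ⟨[], by simp, by simp, by simp, by simp⟩
    · obtain ⟨es, h, -⟩ := he.exists_path G
      exact ⟨es, h⟩

/-- A traveller on a base-path may stay on it, because its labels increase. -/
theorem Usable.mono {s : Fin n} {i : Fin k} {a b : Fin (G.len i)} (h : G.Usable s ⟨i, a⟩)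
    (hab : a ≤ b) : G.Usable s ⟨i, b⟩ := by
  obtain ⟨b, hb⟩ := b
  induction b with
  | zero =>
    obtain rfl : a = ⟨0, hb⟩ := Fin.ext (Nat.le_zero.1 hab)
    exact h
  | succ b ih =>
    rcases eq_or_lt_of_le hab with rfl | hlt
    · exact h
    · refine .step (ih (by omega) ?_) ?_ ?_
      · exact Nat.le_of_lt_succ hlt
      · simp [tgt, src, Fin.succ, Fin.castSucc, Fin.castAdd, Fin.castLE]
      · exact G.label_strictMono i (by simp [Fin.lt_def])

end KPathGraph

/-! ### Boarding plans

A boarding plan guesses, for every base-path, how it is boarded and by how much labels move near the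
boarding edge.  The boarding positions that are consistent with a plan are closed under minima, so
that there is a least consistent choice. -/

namespace KPathGraph

variable {n k : ℕ} (G : KPathGraph n k)

/-- The label of the edge number `z` of base-path `i`. -/
def lab (i : Fin k) (z : ℤ) : ℤ :=
  if h : 0 ≤ z ∧ z.toNat < G.len i then G.label i ⟨z.toNat, h.2⟩ else 0

/-- The number of the vertex at position `j` of base-path `i`. -/
def vtx (i : Fin k) (j : ℕ) : ℤ :=
  if h : j < G.len i + 1 then ((G.vert i ⟨j, h⟩ : ℕ) : ℤ) else 0

open Classical in
/-- One plus the position on base-path `i` of the vertex with number `v`, and `0` if there is no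
such position. -/
noncomputable def posn (i : Fin k) (v : ℤ) : ℤ :=
  if h : ∃ j : Fin (G.len i + 1), ((G.vert i j : ℕ) : ℤ) = v then ((h.choose : ℕ) : ℤ) + 1 else 0

theorem lab_natCast {i : Fin k} {j : ℕ} (h : j < G.len i) : G.lab i j = G.label i ⟨j, h⟩ := by
  simp [lab, h]

theorem vtx_of_lt {i : Fin k} {j : ℕ} (h : j < G.len i + 1) : G.vtx i j = (G.vert i ⟨j, h⟩ : ℕ) := by
  simp [vtx, h]

theorem posn_vert (i : Fin k) (j : Fin (G.len i + 1)) :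
    G.posn i ((G.vert i j : ℕ) : ℤ) = (j : ℕ) + 1 := by
  have h : ∃ j' : Fin (G.len i + 1), ((G.vert i j' : ℕ) : ℤ) = ((G.vert i j : ℕ) : ℤ) := ⟨j, rfl⟩
  have h2 : h.choose = j := G.vert_injective i (Fin.ext (by exact_mod_cast h.choose_spec))
  rw [posn, dif_pos h, h2]

theorem posn_cases (i : Fin k) (v : ℤ) :
    G.posn i v = 0 ∨ ∃ j : Fin (G.len i + 1), ((G.vert i j : ℕ) : ℤ) = v ∧
      G.posn i v = (j : ℕ) + 1 := by
  by_cases h : ∃ j : Fin (G.len i + 1), ((G.vert i j : ℕ) : ℤ) = v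
  · obtain ⟨j, rfl⟩ := h
    exact .inr ⟨j, rfl, G.posn_vert i j⟩
  · left
    rw [posn, dif_neg h]

/-- Integer labels that strictly increase make label minus index nondecreasing. Most comparisons of
labels below are comparisons of this level. -/
theorem lab_add_le {i : Fin k} {x y : ℤ} (hx : 0 ≤ x) (hxy : x ≤ y) (hy : y < G.len i) :
    G.lab i x + (y - x) ≤ G.lab i y := by
  lift x to ℕ using hx
  obtain ⟨d, rfl⟩ : ∃ d : ℕ, y = ((x + d : ℕ) : ℤ) := ⟨(y - x).toNat, by omega⟩
  clear hxy
  induction d with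
  | zero => simp
  | succ d ih =>
    have h1 : x + d < G.len i := by omega
    have h2 : x + (d + 1) < G.len i := by omega
    have h3 := ih (by omega)
    have h4 : G.lab i ((x + d : ℕ) : ℤ) < G.lab i ((x + (d + 1) : ℕ) : ℤ) := by
      rw [lab_natCast G h1, lab_natCast G h2]
      exact G.label_strictMono i (by simp [Fin.lt_def])
    push_cast at *
    omega

theorem lab_lt_iff {i : Fin k} {x y : ℤ} (hx : 0 ≤ x) (hx' : x < G.len i) (hy : 0 ≤ y)
    (hy' : y < G.len i) : G.lab i x < G.lab i y ↔ x < y := by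
  constructor
  · intro h
    by_contra! hc
    have := G.lab_add_le hy hc hx'
    omega
  · intro h
    have := G.lab_add_le hx h.le hy'
    omega

/-- What is guessed about every base-path `c`.  `ty c` is the way in which it is boarded:
`0`: not at all; `1`: at the source; `2`: from base-path `par c`, without advances;
`3`: from base-path `par c`, whose edge into the boarding vertex is advanced by `adv c`;
`4`: from the same base-path as `par c`, thanks to the advance made for `par c`.
The label of the boarding edge changes by `dl c - dr c`. -/
structure Plan (k : ℕ) where
  par : Fin k → Fin k
  ty : Fin k → ℕ
  dl : Fin k → ℕ
  -- How far advances made further along `c` are allowed to pull its boarding edge down.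
  dr : Fin k → ℕ
  -- The least advance that brings the entering edge strictly before the boarding label.
  need : Fin k → ℕ
  -- The difference in level between the entering edge of the leader and that of the member.
  gap : Fin k → ℕ
  adv : Fin k → ℕ

namespace Plan

variable {k : ℕ} (g : Plan k)

/-- The base-path from which `c` is boarded. -/
def host (c : Fin k) : Fin k := if 4 ≤ g.ty c then g.par (g.par c) else g.par c

/-- The change of the label of the boarding edge. -/
def shift (c : Fin k) : ℤ := g.dl c - g.dr c

end Plan

variable (s : Fin n) (g : Plan k) (p : Fin k → ℕ)

/-- The number of the edge of the host of `c` that enters the vertex in which `c` is boarded. -/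
noncomputable def alight (c : Fin k) : ℤ := G.posn (g.host c) (G.vtx c (p c)) - 2

/-- The boarding label of `c`. -/
def blab (c : Fin k) : ℤ := G.lab c (p c) + g.shift c

/-- The boarding positions are consistent with the plan at `c`, up to the link with a leader. -/
structure LocalOK (c : Fin k) : Prop where
  root : g.ty c = 1 → G.vtx c (p c) = (s : ℕ)
  host : 2 ≤ g.ty c → g.ty (g.host c) ≠ 0 ∧ (p (g.host c) : ℤ) ≤ G.alight g p c
  -- The two bounds cover the original label of the entering edge and the label that the delay of
  -- the host's boarding edge propagates to it.
  free : g.ty c = 2 → G.lab (g.host c) (G.alight g p c) < G.blab g p c ∧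
    G.lab (g.host c) (p (g.host c)) - p (g.host c) + g.dl (g.host c) + G.alight g p c < G.blab g p c
  -- The equation fixes the offset between the two labels. The first inequality keeps the advance
  -- from pulling the host's boarding edge below its planned label. The second says that the host's
  -- delay does not lift the entering edge.
  tight : 3 ≤ g.ty c → G.lab (g.host c) (G.alight g p c) = G.blab g p c + g.need c - 1 ∧
    G.lab (g.host c) (p (g.host c)) - p (g.host c) + g.shift (g.host c) + g.adv c ≤
      G.lab (g.host c) (G.alight g p c) - G.alight g p c ∧
    G.lab (g.host c) (p (g.host c)) - p (g.host c) + g.dl (g.host c) ≤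
      G.lab (g.host c) (G.alight g p c) - G.alight g p c
  leader : g.ty c = 3 → g.need c ≤ g.adv c
  member : 4 ≤ g.ty c → g.ty (g.par c) = 3

/-- The slack of the label of the edge through which `c` is reached. -/
noncomputable def slack (c : Fin k) : ℤ :=
  G.lab (g.host c) (G.alight g p c) - G.alight g p c

/-- The link of `c` with its leader is consistent with the plan. -/
structure LinkOK (c : Fin k) : Prop where
  le : G.alight g p c ≤ G.alight g p (g.par c)
  gap : G.slack g p (g.par c) - G.slack g p c = g.gap c
  need : g.need c + g.gap c ≤ g.adv (g.par c)

/-- Boarding positions are in range. -/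
def InRange : Prop := ∀ c, g.ty c ≠ 0 → p c < G.len c

/-- The boarding positions `p` are consistent with the plan `g`. -/
structure Consistent : Prop where
  lt : G.InRange g p
  localOK : ∀ c, g.ty c ≠ 0 → G.LocalOK s g p c
  linkOK : ∀ c, 4 ≤ g.ty c → G.LinkOK g p c

/-- The vertices that are served when every boarded base-path `c` is boarded at `p c`. -/
def served : Set (Fin n) :=
  {v | v = s ∨ ∃ c, g.ty c ≠ 0 ∧ ∃ j : Fin (G.len c + 1), p c ≤ j ∧ G.vert c j = v}

/-! ### Monotonicity of the consistency conditions -/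

variable {G s g p}

/-- This is why the least consistent positions are the best ones for a plan. -/
theorem served_anti {q : Fin k → ℕ} (h : p ≤ q) : G.served s g q ⊆ G.served s g p := by
  rintro v (rfl | ⟨c, hc, j, hj, rfl⟩)
  · exact .inl rfl
  · exact .inr ⟨c, hc, j, (h c).trans hj, rfl⟩

/-- `posn` is one plus a position, and the index of an edge is one below the position of its head;
hence the offset 2. A vertex off the host gives -2 and the first vertex of the host gives -1, so
nonnegativity alone certifies that an entering edge exists. -/
theorem alight_lt_len {c : Fin k} (h : 0 ≤ G.alight g p c) :
    G.alight g p c < G.len (g.host c) ∧ ∃ j : Fin (G.len (g.host c)),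
      G.alight g p c = (j : ℕ) ∧ ((G.vert (g.host c) j.succ : ℕ) : ℤ) = G.vtx c (p c) := by
  unfold alight at *
  rcases G.posn_cases (g.host c) (G.vtx c (p c)) with h0 | ⟨j, hj, h0⟩
  · omega
  · rw [h0] at h ⊢
    have hj' := j.2
    refine ⟨by omega, ⟨(j : ℕ) - 1, by omega⟩, ?_, ?_⟩
    · simp
      omega
    · rw [← hj]
      congr 3
      ext
      simp
      omega

/-- With the position of `c` fixed, only the host's position varies. It occurs through its index and
its level, both bounded from above, and both do not grow when the position decreases. -/
theorem LocalOK.of_le {q : Fin k → ℕ} {c : Fin k} (h : G.LocalOK s g q c) (hpq : p ≤ q)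
    (hc : p c = q c) (hq : G.InRange g q) : G.LocalOK s g p c := by
  have ha : G.alight g p c = G.alight g q c := by simp [alight, hc]
  have hb : G.blab g p c = G.blab g q c := by simp [blab, hc]
  have hle : (p (g.host c) : ℤ) ≤ q (g.host c) := by exact_mod_cast hpq _
  have hL : 2 ≤ g.ty c → G.lab (g.host c) (p (g.host c)) - p (g.host c) ≤
      G.lab (g.host c) (q (g.host c)) - q (g.host c) := by
    intro h2
    have := G.lab_add_le (i := g.host c) (by omega) hle (by exact_mod_cast hq _ (h.host h2).1)
    omega
  refine ⟨fun h1 => hc ▸ h.root h1, fun h1 => ?_, fun h1 => ?_, fun h1 => ?_, h.leader, h.member⟩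
  · have := h.host h1
    rw [ha]
    exact ⟨this.1, hle.trans this.2⟩
  · have h2 := h.free h1
    have h3 := hL (by omega)
    rw [ha, hb]
    exact ⟨h2.1, by omega⟩
  · have h2 := h.tight h1
    have h3 := hL (by omega)
    rw [ha, hb]
    exact ⟨h2.1, by omega, by omega⟩

/-- If `q` had the same position at `c`, its consistency would be inherited by the smaller `p`. -/
theorem LocalOK.bump {q : Fin k → ℕ} {c : Fin k} (h : ¬ G.LocalOK s g p c) (hpq : p ≤ q)
    (hc : g.ty c ≠ 0) (hq : G.Consistent s g q) : p c + 1 ≤ q c := by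
  by_contra! hlt
  exact h ((hq.localOK c hc).of_le hpq (le_antisymm (hpq c) (by omega)) hq.lt)

theorem LocalOK.alight_nonneg {c : Fin k} (h : G.LocalOK s g p c) (hc : 2 ≤ g.ty c) :
    0 ≤ G.alight g p c := by
  have := (h.host hc).2
  omega

/-- The exact offset in `tight` ties the label of the entering edge to the original label of the
boarding edge. A later boarding edge has a larger label, hence so has the entering edge, which
therefore lies further along the host and on no lower level. -/
theorem LocalOK.alight_mono {q : Fin k → ℕ} {c : Fin k} (hp : G.LocalOK s g p c)
    (hq : G.LocalOK s g q c) (hc : 3 ≤ g.ty c) (hlt : q c < G.len c) (hpq : p c ≤ q c) :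
    G.alight g p c ≤ G.alight g q c ∧ G.slack g p c ≤ G.slack g q c := by
  have h1 := hp.alight_nonneg (by omega)
  have h2 := hq.alight_nonneg (by omega)
  have h3 := (alight_lt_len h1).1
  have h4 := (alight_lt_len h2).1
  have h5 := (hp.tight hc).1
  have h6 := (hq.tight hc).1
  have h7 := G.lab_add_le (i := c) (x := p c) (y := q c) (by omega) (by omega) (by omega)
  have h8 : G.alight g p c ≤ G.alight g q c := by
    by_contra! h
    have := (G.lab_lt_iff h2 h4 h1 h3).2 h
    unfold blab at *
    omega
  have := G.lab_add_le h1 h8 h4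
  unfold slack
  omega

/-- Passing to `q` can only push the member's entering edge and its level up. With an unchanged
leader the edge would stay beyond the leader's, or the gap would stay too small. -/
theorem LinkOK.bump_leader {q : Fin k → ℕ} {c : Fin k} (hp : G.LocalOK s g p c)
    (hpl : G.LocalOK s g p (g.par c)) (hc : 4 ≤ g.ty c) (hpq : p ≤ q) (hq : G.Consistent s g q)
    (h : G.alight g p (g.par c) < G.alight g p c ∨
      G.slack g p (g.par c) - G.slack g p c < g.gap c) : p (g.par c) + 1 ≤ q (g.par c) := by
  by_contra! hlt
  have he : p (g.par c) = q (g.par c) := le_antisymm (hpq _) (by omega)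
  have hl := hp.member hc
  have h1 := hp.alight_mono (hq.localOK c (by omega)) (by omega) (hq.lt c (by omega)) (hpq c)
  have h2 := (hq.localOK _ (by omega : g.ty (g.par c) ≠ 0)).alight_mono hpl (by omega)
    (he ▸ hq.lt _ (by omega)) (by omega)
  have h3 := (hq.linkOK c hc).le
  have h4 := (hq.linkOK c hc).gap
  omega

/-- With an unchanged member, passing to `q` could only widen a gap that is already too large. The
inequality for `need` does not involve positions; if it fails there is no consistent `q` at all. -/
theorem LinkOK.bump_member {q : Fin k → ℕ} {c : Fin k} (hp : G.LocalOK s g p c)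
    (hpl : G.LocalOK s g p (g.par c)) (hc : 4 ≤ g.ty c) (hpq : p ≤ q) (hq : G.Consistent s g q)
    (h : g.gap c < G.slack g p (g.par c) - G.slack g p c ∨ g.adv (g.par c) < g.need c + g.gap c) :
    p c + 1 ≤ q c := by
  by_contra! hlt
  have he : p c = q c := le_antisymm (hpq _) (by omega)
  have hl := hp.member hc
  have h1 := (hq.localOK c (by omega)).alight_mono hp (by omega) (he ▸ hq.lt c (by omega))
    (by omega)
  have h2 := hpl.alight_mono (hq.localOK _ (by omega : g.ty (g.par c) ≠ 0)) (by omega)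
    (hq.lt _ (by omega)) (hpq _)
  have h3 := (hq.linkOK c hc).need
  have h4 := (hq.linkOK c hc).gap
  omega

end KPathGraph

/-! ### Labels after a plan is carried out -/

section Fold

variable {k : ℕ} {len : Fin k → ℕ}

theorem shiftLabels_of_ne (lab : (i : Fin k) → Fin (len i) → ℤ) (o : ShiftOp len) {i : Fin k}
    (h : i ≠ o.path) : shiftLabels lab o i = lab i := by
  funext j
  simp [shiftLabels, h]

theorem shiftLabels_congr {lab lab' : (i : Fin k) → Fin (len i) → ℤ} (o : ShiftOp len)
    (h : lab o.path = lab' o.path) : shiftLabels lab o o.path = shiftLabels lab' o o.path := by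
  funext j
  simp [shiftLabels, h]

theorem foldl_shiftLabels_of_ne (ops : List (ShiftOp len)) (lab : (i : Fin k) → Fin (len i) → ℤ)
    {i : Fin k} (h : ∀ o ∈ ops, i ≠ o.path) : ops.foldl shiftLabels lab i = lab i := by
  induction ops generalizing lab with
  | nil => rfl
  | cons o os ih =>
    rw [List.foldl_cons, ih _ fun o' ho' => h o' (List.mem_cons_of_mem _ ho'),
      shiftLabels_of_ne _ _ (h o List.mem_cons_self)]

theorem foldl_shiftLabels_of_pairwise_ne (ops : List (ShiftOp len))
    (lab : (i : Fin k) → Fin (len i) → ℤ) (h : ops.Pairwise fun o o' => o.path ≠ o'.path) :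
    ∀ o ∈ ops, ops.foldl shiftLabels lab o.path = shiftLabels lab o o.path := by
  induction ops generalizing lab with
  | nil => simp
  | cons o os ih =>
    rw [List.pairwise_cons] at h
    intro o' ho'
    rw [List.foldl_cons]
    rcases List.mem_cons.1 ho' with rfl | ho'
    · exact foldl_shiftLabels_of_ne os _ h.1
    · rw [ih _ h.2 o' ho']
      exact shiftLabels_congr o' (shiftLabels_of_ne _ _ (h.1 o' ho').symm)

/-- The label that an operation leaves at edge `m` by its propagation towards the start. -/
def ShiftOp.level (lab : (i : Fin k) → Fin (len i) → ℤ) (o : ShiftOp len) (m : ℕ) : ℤ :=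
  lab o.path o.pos + o.amount - ((o.pos : ℤ) - m)

/-- Later edges keep their labels, because the label that an advance would force on them lies below
the one they have already. -/
theorem shiftLabels_advance {lab : (i : Fin k) → Fin (len i) → ℤ} {o : ShiftOp len}
    (hm : StrictMono (lab o.path)) (ho : o.amount ≤ 0) {m : Fin (len o.path)} :
    shiftLabels lab o o.path m =
      if (m : ℕ) ≤ o.pos then min (lab o.path m) (o.level lab m) else lab o.path m := by
  have key : ∀ a b : Fin (len o.path), a ≤ b → lab o.path a + ((b : ℕ) - (a : ℕ) : ℤ) ≤
      lab o.path b := by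
    rintro a ⟨b, hb⟩
    induction b with
    | zero => intro h; obtain rfl : a = ⟨0, hb⟩ := Fin.ext (Nat.le_zero.1 h); simp
    | succ b ih =>
      intro h
      rcases eq_or_lt_of_le h with rfl | hlt
      · simp
      · have h1 := ih (by omega) (Nat.le_of_lt_succ hlt)
        have h2 : lab o.path ⟨b, by omega⟩ < lab o.path ⟨b + 1, hb⟩ := hm (by simp [Fin.lt_def])
        push_cast at *
        omega
  unfold shiftLabels ShiftOp.level
  simp only [if_true]
  rcases lt_trichotomy (m : ℕ) o.pos with h | h | h
  · rw [if_neg h.ne, if_neg h.not_gt, if_pos h.le]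
  · obtain rfl : m = o.pos := Fin.ext h
    rw [if_pos rfl, if_pos le_rfl]
    omega
  · have := key o.pos m (Fin.le_def.2 h.le)
    rw [if_neg h.ne', if_pos h, if_neg h.not_ge]
    omega

/-- The effect of advances in ascending order of positions. -/
theorem foldl_shiftLabels_advance (ops : List (ShiftOp len)) (lab : (i : Fin k) → Fin (len i) → ℤ)
    (hm : ∀ i, StrictMono (lab i)) (h : ops.Pairwise fun o o' => o.path = o'.path →
      (o.pos : ℕ) < o'.pos) (hneg : ∀ o ∈ ops, o.amount ≤ 0) :
    (∀ i m, ops.foldl shiftLabels lab i m ≤ lab i m) ∧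
    (∀ i (m : Fin (len i)), (∀ o ∈ ops, o.path = i → (o.pos : ℕ) < m) →
      ops.foldl shiftLabels lab i m = lab i m) ∧
    (∀ o ∈ ops, ∀ m : Fin (len o.path), (m : ℕ) ≤ o.pos →
      ops.foldl shiftLabels lab o.path m ≤ o.level lab m) ∧
    (∀ i (m : Fin (len i)) (z : ℤ), z ≤ lab i m →
      (∀ o ∈ ops, o.path = i → (m : ℕ) ≤ o.pos → z ≤ o.level lab m) →
      z ≤ ops.foldl shiftLabels lab i m) := by
  induction ops using List.reverseRecOn with
  | nil => simp
  | append_singleton ops o ih =>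
    rw [List.pairwise_append] at h
    obtain ⟨ih1, ih2, ih3, ih4⟩ := ih h.1 fun o ho => hneg o (by simp [ho])
    have ho := hneg o (by simp)
    have hf := foldl_shiftLabels_strictMono ops lab hm
    -- The earlier operations sit at smaller positions and do not touch later edges. So the label at
    -- `o.pos` is still the original one when `o` is applied.
    have hlev : ∀ m, o.level (ops.foldl shiftLabels lab) m = o.level lab m := by
      intro m
      unfold ShiftOp.level
      rw [ih2 o.path o.pos fun o' ho' he => h.2.2 o' ho' o (by simp) he]
    simp only [List.foldl_append, List.foldl_cons, List.foldl_nil]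
    have hdec : ∀ i m, shiftLabels (ops.foldl shiftLabels lab) o i m ≤
        ops.foldl shiftLabels lab i m := by
      intro i m
      by_cases hi : i = o.path
      · subst hi
        rw [shiftLabels_advance (hf _) ho]
        split_ifs <;> simp
      · rw [shiftLabels_of_ne _ _ hi]
    refine ⟨fun i m => (hdec i m).trans (ih1 i m), ?_, ?_, ?_⟩
    · intro i m hlt
      rw [← ih2 i m fun o' ho' => hlt o' (by simp [ho'])]
      by_cases hi : i = o.path
      · subst hi
        rw [shiftLabels_advance (hf _) ho, if_neg (by have := hlt o (by simp) rfl; omega)]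
      · rw [shiftLabels_of_ne _ _ hi]
    · intro o' ho' m hle
      rcases List.mem_append.1 ho' with ho' | ho'
      · exact (hdec _ _).trans (ih3 o' ho' m hle)
      · obtain rfl := List.mem_singleton.1 ho'
        rw [shiftLabels_advance (hf _) ho, if_pos hle, hlev]
        exact min_le_right _ _
    · intro i m z hz hall
      have h1 := ih4 i m z hz fun o' ho' => hall o' (by simp [ho'])
      by_cases hi : i = o.path
      · subst hi
        rw [shiftLabels_advance (hf _) ho, hlev]
        split_ifs with hle
        · exact le_min h1 (hall o (by simp) rfl hle)
        · exact h1
      · rwa [shiftLabels_of_ne _ _ hi]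

end Fold

/-! ### The operations of a plan and their cost -/

namespace KPathGraph

variable {n k : ℕ} (G : KPathGraph n k) (s : Fin n) (g : Plan k) (p : Fin k → ℕ)

/-- The delay of the boarding edge of `c`. -/
def delayAt (c : Fin k) : List (ShiftOp G.len) :=
  if h : p c < G.len c then
    if g.ty c ≠ 0 ∧ 0 < g.dl c then [⟨c, ⟨p c, h⟩, g.dl c⟩] else []
  else []

/-- The largest advance that the plan demands from edge `m` of base-path `i`. -/
noncomputable def demand (i : Fin k) (m : ℕ) : ℕ :=
  Finset.univ.sup fun c => if g.ty c = 3 ∧ g.par c = i ∧ G.alight g p c = m then g.adv c else 0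

/-- The advance of edge `m` of base-path `i`. -/
noncomputable def advanceAt (i : Fin k) (m : Fin (G.len i)) : List (ShiftOp G.len) :=
  if 0 < G.demand g p i m then [⟨i, m, -(G.demand g p i m : ℤ)⟩] else []

/-- The delays of a plan. -/
def planDelays : List (ShiftOp G.len) := (List.finRange k).flatMap (G.delayAt g p)

/-- The advances of a plan. -/
noncomputable def planAdvances : List (ShiftOp G.len) :=
  (List.finRange k).flatMap fun i => (List.finRange (G.len i)).flatMap (G.advanceAt g p i)

/-- The operations of a plan. -/
noncomputable def planOps : List (ShiftOp G.len) := G.planDelays g p ++ G.planAdvances g p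

variable {G s g p}

theorem mem_planDelays {o : ShiftOp G.len} : o ∈ G.planDelays g p ↔
    g.ty o.path ≠ 0 ∧ 0 < g.dl o.path ∧ p o.path = o.pos ∧ o.amount = g.dl o.path := by
  simp only [planDelays, List.mem_flatMap, List.mem_finRange, true_and, delayAt]
  constructor
  · rintro ⟨c, hc⟩
    split_ifs at hc with h1 h2
    · obtain rfl := List.mem_singleton.1 hc
      simpa using h2
    · simp at hc
    · simp at hc
  · obtain ⟨c, x, y⟩ := o
    rintro ⟨h1, h2, h3, h4⟩
    simp only at *
    refine ⟨c, ?_⟩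
    rw [dif_pos (h3 ▸ x.2), if_pos ⟨h1, h2⟩, List.mem_singleton]
    simp [h3, h4]

theorem mem_planAdvances {o : ShiftOp G.len} : o ∈ G.planAdvances g p ↔
    0 < G.demand g p o.path o.pos ∧ o.amount = -(G.demand g p o.path o.pos : ℤ) := by
  simp only [planAdvances, List.mem_flatMap, List.mem_finRange, true_and, advanceAt]
  constructor
  · rintro ⟨c, m, hc⟩
    split_ifs at hc with h1
    · obtain rfl := List.mem_singleton.1 hc
      simpa using h1
    · simp at hc
  · obtain ⟨c, x, y⟩ := o
    rintro ⟨h1, h2⟩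
    simp only at *
    refine ⟨c, x, ?_⟩
    rw [if_pos h1, List.mem_singleton]
    simp [h2]

theorem planDelays_pairwise : (G.planDelays g p).Pairwise fun o o' => o.path ≠ o'.path := by
  rw [planDelays, List.pairwise_flatMap]
  have hmem : ∀ c, ∀ o ∈ G.delayAt g p c, o.path = c := by
    intro c o ho
    unfold delayAt at ho
    split_ifs at ho <;> simp at ho
    rw [ho]
  constructor
  · intro c _
    unfold delayAt
    split_ifs <;> simp
  · refine (List.nodup_finRange k).imp ?_
    intro a b hab x hx y hy
    rw [hmem a x hx, hmem b y hy]
    exact hab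

theorem planAdvances_pairwise : (G.planAdvances g p).Pairwise fun o o' => o.path = o'.path →
      (o.pos : ℕ) < o'.pos := by
  have hmem : ∀ i m, ∀ o ∈ G.advanceAt g p i m, o.path = i ∧ (o.pos : ℕ) = m := by
    intro i m o ho
    unfold advanceAt at ho
    split_ifs at ho <;> simp at ho
    rw [ho]
    simp
  rw [planAdvances, List.pairwise_flatMap]
  constructor
  · intro i _
    rw [List.pairwise_flatMap]
    constructor
    · intro m _
      unfold advanceAt
      split_ifs <;> simp
    · refine (List.pairwise_lt_finRange _).imp ?_
      intro a b hab x hx y hy _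
      rw [(hmem i a x hx).2, (hmem i b y hy).2]
      exact hab
  · refine (List.nodup_finRange k).imp ?_
    intro a b hab x hx y hy he
    obtain ⟨m, -, hx⟩ := List.mem_flatMap.1 hx
    obtain ⟨m', -, hy⟩ := List.mem_flatMap.1 hy
    rw [(hmem a m x hx).1, (hmem b m' y hy).1] at he
    exact absurd he hab

/-- Several leaders may demand an advance of the same edge. A single operation with the largest
demand serves them all; the maximum is at most the sum, and each leader is charged at no more than
one edge. -/
theorem planOps_cost :
    ((G.planOps g p).map fun o => o.amount.natAbs).sum ≤ ∑ c, (g.dl c + g.adv c) := by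
  have h1 : ((G.planDelays g p).map fun o => o.amount.natAbs).sum ≤ ∑ c, g.dl c := by
    rw [planDelays, List.map_flatMap, List.flatMap_def, List.sum_flatten, List.map_map,
      ← Fin.sum_univ_def]
    refine Finset.sum_le_sum fun c _ => ?_
    simp only [Function.comp, delayAt]
    split_ifs <;> simp
  have h2 : ((G.planAdvances g p).map fun o => o.amount.natAbs).sum ≤ ∑ c, g.adv c := by
    rw [planAdvances, List.map_flatMap, List.flatMap_def, List.sum_flatten, List.map_map,
      ← Fin.sum_univ_def]
    have h3 : ∀ i, ((fun i => (((List.finRange (G.len i)).flatMap (G.advanceAt g p i)).map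
        fun o => o.amount.natAbs)) i).sum ≤ ∑ m : Fin (G.len i), G.demand g p i m := by
      intro i
      simp only
      rw [List.map_flatMap, List.flatMap_def, List.sum_flatten, List.map_map,
        ← Fin.sum_univ_def]
      refine Finset.sum_le_sum fun m _ => ?_
      simp only [Function.comp, advanceAt]
      split_ifs <;> simp
    calc _ ≤ ∑ i, ∑ m : Fin (G.len i), G.demand g p i m := Finset.sum_le_sum fun i _ => h3 i
      _ ≤ ∑ i, ∑ m : Fin (G.len i), ∑ c,
          if g.ty c = 3 ∧ g.par c = i ∧ G.alight g p c = (m : ℕ) then g.adv c else 0 := by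
        refine Finset.sum_le_sum fun i _ => Finset.sum_le_sum fun m _ => Finset.sup_le fun c _ => ?_
        exact Finset.single_le_sum (f := fun c => if g.ty c = 3 ∧ g.par c = i ∧
          G.alight g p c = (m : ℕ) then g.adv c else 0) (fun _ _ => Nat.zero_le _)
          (Finset.mem_univ c)
      _ = ∑ c, ∑ i, ∑ m : Fin (G.len i),
          if g.ty c = 3 ∧ g.par c = i ∧ G.alight g p c = (m : ℕ) then g.adv c else 0 := by
        rw [Finset.sum_comm]
        simp_rw [Finset.sum_comm (s := (Finset.univ : Finset (Fin (G.len _))))]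
      _ ≤ ∑ c, g.adv c := by
        refine Finset.sum_le_sum fun c _ => ?_
        rw [Finset.sum_eq_single (g.par c) ?_ (by simp)]
        · by_cases h : ∃ m : Fin (G.len (g.par c)), G.alight g p c = (m : ℕ)
          · obtain ⟨m, hm⟩ := h
            rw [Finset.sum_eq_single m ?_ (by simp)]
            · split_ifs <;> simp
            · intro m' _ hne
              rw [if_neg]
              rintro ⟨-, -, h⟩
              rw [hm] at h
              exact hne (Fin.ext (by exact_mod_cast h.symm))
          · push Not at h
            rw [Finset.sum_eq_zero]
            · simp
            · intro m _
              rw [if_neg]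
              exact fun hh => h m hh.2.2
        · intro i _ hne
          refine Finset.sum_eq_zero fun m _ => ?_
          rw [if_neg]
          exact fun hh => hne hh.2.1.symm
  rw [planOps, List.map_append, List.sum_append, Finset.sum_add_distrib]
  exact add_le_add h1 h2

end KPathGraph

/-! ### Labels after a plan, and why served vertices are reached -/

namespace KPathGraph

variable {n k : ℕ} {G : KPathGraph n k} {s : Fin n} {g : Plan k} {p : Fin k → ℕ}

/-- At most one delay acts on each base-path. Without one, `dl` is 0 or no boarding takes place; in
the former case the maximum is the old label, so the formula needs no exception. -/
theorem planDelays_label {i : Fin k} (hi : g.ty i ≠ 0) (hp : p i < G.len i)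
    (m : Fin (G.len i)) (hm : p i ≤ m) : (G.planDelays g p).foldl shiftLabels G.label i m =
      max (G.lab i m) (G.lab i (p i) + g.dl i + ((m : ℤ) - p i)) := by
  have hle := G.lab_add_le (i := i) (x := p i) (y := (m : ℕ)) (by omega) (by omega)
    (by have := m.2; omega)
  rw [lab_natCast G m.2] at *
  rcases Nat.eq_zero_or_pos (g.dl i) with h0 | h0
  · rw [foldl_shiftLabels_of_ne]
    · rw [h0, max_eq_left]
      push_cast at *
      omega
    · rintro o ho rfl
      have := (mem_planDelays.1 ho).2.1
      omega
  · have ho : (⟨i, ⟨p i, hp⟩, g.dl i⟩ : ShiftOp G.len) ∈ G.planDelays g p :=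
      mem_planDelays.2 ⟨hi, h0, rfl, rfl⟩
    have := congrFun (foldl_shiftLabels_of_pairwise_ne _ G.label planDelays_pairwise _ ho) m
    rw [this]
    rw [lab_natCast G hp] at *
    simp only [shiftLabels, if_true]
    rcases hm.eq_or_lt with h | h
    · rw [if_pos h.symm]
      obtain rfl : m = ⟨p i, hp⟩ := Fin.ext h.symm
      simp
    · rw [if_neg h.ne', if_pos h]

/-- After the delays the boarding edge is high enough. An advance further along pushes it down to a
level that depends on the largest demand; the leader that attains this maximum satisfies `tight`,
which bounds the level from below by the planned one. -/
theorem planOps_label_ge (hp : G.Consistent s g p) {i : Fin k} (hi : g.ty i ≠ 0) :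
    G.blab g p i ≤ (G.planOps g p).foldl shiftLabels G.label i ⟨p i, hp.lt i hi⟩ := by
  have hmono := foldl_shiftLabels_strictMono (G.planDelays g p) G.label G.label_strictMono
  obtain ⟨-, -, -, h4⟩ := foldl_shiftLabels_advance (G.planAdvances g p) _ hmono
    planAdvances_pairwise (fun o ho => by rw [(mem_planAdvances.1 ho).2]; omega)
  rw [planOps, List.foldl_append]
  have h1 := planDelays_label hi (hp.lt i hi) ⟨p i, hp.lt i hi⟩ le_rfl
  refine h4 i _ _ ?_ ?_
  · rw [h1]
    refine le_max_of_le_right ?_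
    simp [blab, Plan.shift]
  · rintro o ho rfl hle
    obtain ⟨h5, h6⟩ := mem_planAdvances.1 ho
    rw [demand, Finset.lt_sup_iff] at h5
    have hne : (Finset.univ : Finset (Fin k)).Nonempty := ⟨o.path, Finset.mem_univ _⟩
    obtain ⟨c, -, hc⟩ := Finset.exists_mem_eq_sup _ hne (fun c => if g.ty c = 3 ∧
      g.par c = o.path ∧ G.alight g p c = (o.pos : ℕ) then g.adv c else 0)
    obtain ⟨c', -, hc'⟩ := h5
    have hle' := Finset.le_sup (f := (fun c => if g.ty c = 3 ∧
      g.par c = o.path ∧ G.alight g p c = (o.pos : ℕ) then g.adv c else 0)) (Finset.mem_univ c')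
    rw [demand, hc] at h6
    rw [hc] at hle'
    split_ifs at h6 hc' hle' with h7 h8
    · have hok := (hp.localOK c (by omega)).tight (by omega)
      have hhost : g.host c = o.path := by rw [Plan.host, if_neg (by omega), h7.2.1]
      rw [hhost, h7.2.2] at hok
      unfold ShiftOp.level
      rw [planDelays_label hi (hp.lt _ hi) o.pos hle, h6]
      unfold blab
      have := le_max_left (G.lab o.path (o.pos : ℕ))
        (G.lab o.path (p o.path) + g.dl o.path + ((o.pos : ℕ) - (p o.path : ℤ)))
      simp only
      omega
    all_goals omega

theorem planOps_label_le (hp : G.Consistent s g p) {i : Fin k} (hi : g.ty i ≠ 0)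
    (m : Fin (G.len i)) (hm : p i ≤ m) : (G.planOps g p).foldl shiftLabels G.label i m ≤
      max (G.lab i m) (G.lab i (p i) + g.dl i + ((m : ℤ) - p i)) := by
  have hmono := foldl_shiftLabels_strictMono (G.planDelays g p) G.label G.label_strictMono
  obtain ⟨h1, -, -, -⟩ := foldl_shiftLabels_advance (G.planAdvances g p) _ hmono
    planAdvances_pairwise (fun o ho => by rw [(mem_planAdvances.1 ho).2]; omega)
  rw [planOps, List.foldl_append, ← planDelays_label hi (hp.lt i hi) m hm]
  exact h1 i m

/-- The advance of the leader's entering edge lowers that edge's level by at least `adv`, and the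
propagation brings every earlier edge of the host to that level or below. -/
theorem planOps_label_le_leader (hp : G.Consistent s g p) {l : Fin k} (hl : g.ty l = 3)
    (m : Fin (G.len (g.par l))) (hpm : p (g.par l) ≤ m) (hm : (m : ℤ) ≤ G.alight g p l) :
    (G.planOps g p).foldl shiftLabels G.label (g.par l) m ≤ G.slack g p l - g.adv l + m := by
  have hloc := hp.localOK l (by omega)
  have hhost : g.host l = g.par l := by rw [Plan.host, if_neg (by omega)]
  obtain ⟨h1, j, hj, -⟩ := alight_lt_len (hloc.alight_nonneg (by omega))
  obtain ⟨hb, -⟩ := hloc.host (by omega)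
  obtain ⟨ht1, ht2, ht3⟩ := hloc.tight (by omega)
  have hsl : G.slack g p l = G.lab (g.host l) (G.alight g p l) - G.alight g p l := rfl
  have hml := G.lab_add_le (i := g.host l) (x := (m : ℕ)) (by omega) hm h1
  generalize hil : g.host l = i at *
  subst hhost
  have hlj := planDelays_label hb (hp.lt _ hb) j (by omega)
  rw [hj] at h1 hm ht1 ht2 ht3 hsl hml
  -- With `adv` equal to 0 the edge may have no operation at all. Then monotone levels and the last
  -- inequality of `tight` give the bound.
  rcases Nat.eq_zero_or_pos (g.adv l) with h0 | h0
  · refine (planOps_label_le hp hb m hpm).trans (max_le ?_ ?_) <;> omega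
  · have hmono := foldl_shiftLabels_strictMono (G.planDelays g p) G.label G.label_strictMono
    obtain ⟨-, -, h3, -⟩ := foldl_shiftLabels_advance (G.planAdvances g p) _ hmono
      planAdvances_pairwise (fun o ho => by rw [(mem_planAdvances.1 ho).2]; omega)
    have hd : g.adv l ≤ G.demand g p (g.par l) j := by
      have := Finset.le_sup (f := fun c => if g.ty c = 3 ∧ g.par c = g.par l ∧
        G.alight g p c = (j : ℕ) then g.adv c else 0) (Finset.mem_univ l)
      rwa [if_pos ⟨hl, rfl, hj⟩] at this
    have := h3 ⟨g.par l, j, -(G.demand g p (g.par l) j : ℤ)⟩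
      (mem_planAdvances.2 ⟨by simp only; omega, rfl⟩) m (by simp only; omega)
    rw [planOps, List.foldl_append]
    refine this.trans ?_
    unfold ShiftOp.level
    simp only
    rw [hlj, max_eq_left (by omega)]
    omega

/-- After the operations of a plan, every vertex that is served is reached. -/
theorem served_subset_reach (hp : G.Consistent s g p) :
    G.served s g p ⊆ (G.shiftAll (G.planOps g p)).reach s := by
  set G' := G.shiftAll (G.planOps g p) with hG'
  let T : Fin k → ℤ := fun c => if h : g.ty c ≠ 0 then
    G'.time ⟨c, ⟨p c, hp.lt c h⟩⟩ else 0
  have hT : ∀ c (h : g.ty c ≠ 0), T c = G'.label c ⟨p c, hp.lt c h⟩ := fun c h => by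
    simp only [T]
    rw [dif_pos h]
    rfl
  -- The induction runs over the final labels of the boarding edges: a host is boarded strictly
  -- earlier than the base-path that is entered from it.
  have hwf : WellFounded fun c c' : Fin k => T c < T c' :=
    haveI : Std.Irrefl (fun c c' : Fin k => T c < T c') := ⟨fun _ => lt_irrefl _⟩
    haveI : IsTrans (Fin k) (fun c c' : Fin k => T c < T c') := ⟨fun _ _ _ => lt_trans⟩
    Finite.wellFounded_of_trans_of_irrefl _
  have key : ∀ c (h : g.ty c ≠ 0), G'.Usable s ⟨c, ⟨p c, hp.lt c h⟩⟩ := by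
    intro c
    induction c using hwf.induction with
    | _ c ih =>
    intro h
    have hloc := hp.localOK c h
    have hvtx := G.vtx_of_lt (i := c) (j := p c) (by have := hp.lt c h; omega)
    by_cases h2 : 2 ≤ g.ty c
    · obtain ⟨hb, hpa⟩ := hloc.host h2
      obtain ⟨h1, j, hj, hjv⟩ := alight_lt_len (hloc.alight_nonneg h2)
      have hjp : p (g.host c) ≤ j := by omega
      have hlt : G'.label (g.host c) j < G'.label c ⟨p c, hp.lt c h⟩ := by
        refine lt_of_lt_of_le ?_ (planOps_label_ge hp h)
        by_cases h3 : 3 ≤ g.ty c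
        · have ht := (hloc.tight h3).1
          by_cases h4 : 4 ≤ g.ty c
          · have hl := hloc.member h4
            have hlink := hp.linkOK c h4
            have hh : g.host c = g.par (g.par c) := by rw [Plan.host, if_pos h4]
            have hsl : G.slack g p c = G.lab (g.host c) (G.alight g p c) - G.alight g p c := rfl
            have hle := hlink.le
            have hgap := hlink.gap
            have hneed := hlink.need
            generalize g.host c = i at *
            subst hh
            have := planOps_label_le_leader hp hl j hjp (by omega)
            refine this.trans_lt ?_
            rw [hj] at ht hsl
            omega
          · have hl : g.ty c = 3 := by omega
            have hh : g.host c = g.par c := by rw [Plan.host, if_neg h4]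
            have hneed := hloc.leader hl
            have hsl : G.slack g p c = G.lab (g.host c) (G.alight g p c) - G.alight g p c := rfl
            generalize g.host c = i at *
            subst hh
            have := planOps_label_le_leader hp hl j hjp (by omega)
            refine this.trans_lt ?_
            rw [hj] at ht hsl
            omega
        · have hf := hloc.free (by omega)
          refine (planOps_label_le hp hb j hjp).trans_lt (max_lt ?_ ?_) <;> rw [hj] at hf <;> omega
      have hTlt : T (g.host c) < T c := by
        rw [hT _ hb, hT _ h]
        exact ((G'.label_strictMono _).monotone (Fin.le_def.2 hjp)).trans_lt hlt
      have hu := (ih _ hTlt hb).mono G' (b := j) (Fin.le_def.2 hjp)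
      refine .step hu ?_ hlt
      rw [hvtx] at hjv
      exact Fin.ext (by exact_mod_cast hjv)
    · refine .start ?_
      have := hloc.root (by omega)
      rw [hvtx] at this
      exact Fin.ext (by exact_mod_cast this)
  rintro v hv
  rw [mem_reach_iff]
  rcases hv with rfl | ⟨c, hc, j, hj, rfl⟩
  · exact .inl rfl
  -- The boarding vertex is the tail of the first usable edge, so it is reached by whatever makes
  -- this edge usable. Later vertices are heads of usable edges.
  rcases hj.eq_or_lt with he | hlt
  · have h1 := key c hc
    have hloc : G'.src ⟨c, ⟨p c, hp.lt c hc⟩⟩ = G.vert c j := by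
      simp only [src]
      exact congrArg (G.vert c) (Fin.ext he)
    rw [← hloc]
    cases h1 with
    | start h => exact .inl h
    | step hu ht _ => exact .inr ⟨_, hu, ht⟩
  · have hj1 : (j : ℕ) - 1 < G.len c := by
      have : (j : ℕ) < G.len c + 1 := j.2
      omega
    refine .inr ⟨⟨c, ⟨(j : ℕ) - 1, hj1⟩⟩, ?_, ?_⟩
    · exact (key c hc).mono G' (Fin.le_def.2 (by change p c ≤ (j : ℕ) - 1; omega))
    · simp only [tgt]
      exact congrArg (G.vert c) (Fin.ext (by simp; omega))

end KPathGraph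

/-! ### Lower bounds for the cost of shifting operations -/

section Cost

variable {k : ℕ} {len : Fin k → ℕ}

/-- The total delay by operations on base-path `i`. -/
def delayCost (ops : List (ShiftOp len)) (i : Fin k) : ℕ :=
  (ops.map fun o => if o.path = i then o.amount.toNat else 0).sum

/-- The total advance by operations on base-path `i`. -/
def advanceCost (ops : List (ShiftOp len)) (i : Fin k) : ℕ :=
  (ops.map fun o => if o.path = i then (-o.amount).toNat else 0).sum

theorem sum_delayCost (ops : List (ShiftOp len)) :
    ∑ i, delayCost ops i = (ops.map fun o => o.amount.toNat).sum := by
  induction ops with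
  | nil => simp [delayCost]
  | cons o os ih =>
    simp only [delayCost, List.map_cons, List.sum_cons, Finset.sum_add_distrib] at ih ⊢
    rw [ih]
    simp

theorem sum_advanceCost (ops : List (ShiftOp len)) :
    ∑ i, advanceCost ops i = (ops.map fun o => (-o.amount).toNat).sum := by
  induction ops with
  | nil => simp [advanceCost]
  | cons o os ih =>
    simp only [advanceCost, List.map_cons, List.sum_cons, Finset.sum_add_distrib] at ih ⊢
    rw [ih]
    simp

theorem StrictMono.fin_add_le {N : ℕ} {f : Fin N → ℤ} (hf : StrictMono f) {a b : Fin N}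
    (h : a ≤ b) : f a + ((b : ℕ) - (a : ℕ) : ℤ) ≤ f b := by
  obtain ⟨b, hb⟩ := b
  induction b with
  | zero => obtain rfl : a = ⟨0, hb⟩ := Fin.ext (Nat.le_zero.1 h); simp
  | succ b ih =>
    rcases eq_or_lt_of_le h with rfl | hlt
    · simp
    · have h1 := ih (by omega) (Nat.le_of_lt_succ hlt)
      have h2 : f ⟨b, by omega⟩ < f ⟨b + 1, hb⟩ := hf (by simp [Fin.lt_def])
      push_cast at *
      omega

/-- A delay by d lifts a later edge at most to the level of the shifted edge plus d, and that edge
already had at least the level of the shifted one. So no label rises by more than d. -/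
theorem foldl_shiftLabels_le_add (ops : List (ShiftOp len)) (lab : (i : Fin k) → Fin (len i) → ℤ)
    (hm : ∀ i, StrictMono (lab i)) :
    ∀ (i : Fin k) (m : Fin (len i)), ops.foldl shiftLabels lab i m ≤ lab i m + delayCost ops i := by
  induction ops generalizing lab with
  | nil => simp [delayCost]
  | cons o os ih =>
    intro i m
    have h1 := ih _ (shiftLabels_strictMono lab o hm)
    have hc : delayCost (o :: os) i =
        (if o.path = i then o.amount.toNat else 0) + delayCost os i := by simp [delayCost]
    rw [List.foldl_cons, hc]
    push_cast
    refine (h1 i m).trans ?_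
    by_cases hi : i = o.path
    · subst hi
      rw [if_pos rfl]
      have key : shiftLabels lab o o.path m ≤ lab o.path m + o.amount.toNat := by
        unfold shiftLabels
        rw [if_pos rfl]
        split_ifs with h2 h3
        · obtain rfl : m = o.pos := Fin.ext h2
          omega
        · have := (hm o.path).fin_add_le (Fin.le_def.2 h3.le)
          omega
        · omega
      omega
    · rw [shiftLabels_of_ne _ _ hi, if_neg (Ne.symm hi)]
      omega

/-- The levels through which edges of base-path `i` are moved down. -/
noncomputable def sweep (lab f : (i : Fin k) → Fin (len i) → ℤ) (i : Fin k) : Finset ℤ :=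
  Finset.univ.biUnion fun m : Fin (len i) => Finset.Ioc (f i m - (m : ℕ)) (lab i m - (m : ℕ))

/-- One advance newly sweeps only levels in the interval through which the chosen edge itself moves:
earlier edges started at no higher level and stop at the new level of that edge. Levels swept by
several edges count once, which is why the bound holds for the union. -/
theorem card_sweep_le (ops : List (ShiftOp len)) (lab : (i : Fin k) → Fin (len i) → ℤ)
    (hm : ∀ i, StrictMono (lab i)) (i : Fin k) :
    (sweep lab (ops.foldl shiftLabels lab) i).card ≤ advanceCost ops i := by
  induction ops using List.reverseRecOn with
  | nil =>
    have : sweep lab (List.foldl shiftLabels lab []) i = ∅ := by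
      ext x
      simp [sweep]
    rw [this]
    simp
  | append_singleton os o ih =>
    have hf := foldl_shiftLabels_strictMono os lab hm
    simp only [List.foldl_append, List.foldl_cons, List.foldl_nil]
    set f := os.foldl shiftLabels lab
    have hc : advanceCost (os ++ [o]) i =
        advanceCost os i + if o.path = i then (-o.amount).toNat else 0 := by
      simp [advanceCost]
    rw [hc]
    by_cases hi : i = o.path
    · subst hi
      rw [if_pos rfl]
      have hsub : sweep lab (shiftLabels f o) o.path ⊆ sweep lab f o.path ∪
          Finset.Ioc (f o.path o.pos - (o.pos : ℕ) + o.amount) (f o.path o.pos - (o.pos : ℕ)) := by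
        intro x hx
        simp only [sweep, Finset.mem_biUnion, Finset.mem_univ, true_and, Finset.mem_Ioc,
          Finset.mem_union] at hx ⊢
        obtain ⟨m, hx1, hx2⟩ := hx
        by_cases hlt : f o.path m - (m : ℕ) < x
        · exact .inl ⟨m, hlt, hx2⟩
        · right
          unfold shiftLabels at hx1
          rw [if_pos rfl] at hx1
          split_ifs at hx1 with h2 h3
          · obtain rfl : m = o.pos := Fin.ext h2
            omega
          · omega
          · have := (hf o.path).fin_add_le (a := m) (b := o.pos) (Fin.le_def.2 (by omega))
            omega
      refine (Finset.card_le_card hsub).trans ((Finset.card_union_le _ _).trans ?_)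
      rw [Int.card_Ioc]
      refine add_le_add ih (le_of_eq ?_)
      congr 1
      omega
    · rw [if_neg (Ne.symm hi)]
      have : sweep lab (shiftLabels f o) i = sweep lab f i := by
        unfold sweep
        rw [shiftLabels_of_ne _ _ hi]
      rw [this]
      exact ih

end Cost

/-- Intervals with monotone end points can be merged into groups, each with a leader, such that the
total length of the groups is at most the size of the union of the intervals. -/
theorem exists_leaders {α : Type*} [DecidableEq α] (K : Finset α) (pos F L : α → ℤ)
    (hFL : ∀ x ∈ K, F x < L x)
    (hmono : ∀ x ∈ K, ∀ y ∈ K, pos x ≤ pos y → F x ≤ F y ∧ L x ≤ L y) :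
    ∃ (lead : α → α) (X : α → ℕ),
      (∀ x ∈ K, lead x ∈ K ∧ lead (lead x) = lead x ∧ pos x ≤ pos (lead x) ∧
        L (lead x) - X (lead x) ≤ F x) ∧
      (∀ x ∈ K, lead x = x → ∃ y ∈ K, F y ≤ L x - X x) ∧
      ∑ x ∈ K with lead x = x, X x ≤ (K.biUnion fun x => Finset.Ioc (F x) (L x)).card := by
  induction K using Finset.induction_on_min_value pos with
  | empty => exact ⟨id, fun _ => 0, by simp⟩
  | insert a s ha hmin ih =>
    obtain ⟨lead, X, h1, h2, h3⟩ := ih (fun x hx => hFL x (Finset.mem_insert_of_mem hx))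
      (fun x hx y hy => hmono x (Finset.mem_insert_of_mem hx) y (Finset.mem_insert_of_mem hy))
    have hmin' : ∀ x ∈ s, F a ≤ F x ∧ L a ≤ L x := fun x hx =>
      hmono a (Finset.mem_insert_self a s) x (Finset.mem_insert_of_mem hx) (hmin x hx)
    have haFL := hFL a (Finset.mem_insert_self a s)
    have hne : ∀ x ∈ s, x ≠ a := fun x hx h => ha (h ▸ hx)
    rw [Finset.biUnion_insert]
    -- The new interval starts lowest. It joins the group with the smallest lower end if it touches
    -- it, and otherwise forms a group of its own.
    by_cases hex : ∃ y ∈ s, F y ≤ L a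
    · obtain ⟨y₁, hy₁, hy₁'⟩ := hex
      obtain ⟨y, hy, hymin⟩ := s.exists_min_image F ⟨y₁, hy₁⟩
      have hyL : F y ≤ L a := (hymin _ hy₁).trans hy₁'
      obtain ⟨l1, l2, l3, l4⟩ := h1 y hy
      -- Since `F y` is minimal, the two bounds for this group give `L (lead y) - X (lead y) = F y`.
      -- Adding `F y - F a` to the length lowers the bottom of the group exactly to `F a`.
      obtain ⟨z, hz, hz'⟩ := h2 _ l1 l2
      have hyz := hymin z hz
      have hya := (hmin' y hy).1
      refine ⟨Function.update lead a (lead y),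
        Function.update X (lead y) (X (lead y) + (F y - F a).toNat), ?_, ?_, ?_⟩
      · intro x hx
        rcases Finset.mem_insert.1 hx with rfl | hx
        · rw [Function.update_self, Function.update_of_ne (hne _ l1), Function.update_self]
          refine ⟨Finset.mem_insert_of_mem l1, l2, hmin _ l1, ?_⟩
          push_cast
          omega
        · obtain ⟨x1, x2, x3, x4⟩ := h1 x hx
          rw [Function.update_of_ne (hne x hx), Function.update_of_ne (hne _ x1)]
          refine ⟨Finset.mem_insert_of_mem x1, x2, x3, ?_⟩
          by_cases hl : lead x = lead y
          · rw [hl] at x4 ⊢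
            rw [Function.update_self]
            push_cast
            omega
          · rwa [Function.update_of_ne hl]
      · intro x hx hlx
        rcases Finset.mem_insert.1 hx with rfl | hx
        · rw [Function.update_self] at hlx
          exact absurd hlx (hne _ l1)
        · rw [Function.update_of_ne (hne x hx)] at hlx
          by_cases hl : x = lead y
          · subst hl
            refine ⟨a, Finset.mem_insert_self a s, ?_⟩
            rw [Function.update_self]
            push_cast
            omega
          · obtain ⟨w, hw, hw'⟩ := h2 x hx hlx
            exact ⟨w, Finset.mem_insert_of_mem hw, by rwa [Function.update_of_ne hl]⟩
      · have hfil : (insert a s).filter (fun x => Function.update lead a (lead y) x = x) =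
            s.filter fun x => lead x = x := by
          ext x
          simp only [Finset.mem_filter, Finset.mem_insert]
          constructor
          · rintro ⟨rfl | hx, hlx⟩
            · rw [Function.update_self] at hlx
              exact absurd hlx (hne _ l1)
            · exact ⟨hx, by rwa [Function.update_of_ne (hne x hx)] at hlx⟩
          · rintro ⟨hx, hlx⟩
            exact ⟨.inr hx, by rwa [Function.update_of_ne (hne x hx)]⟩
        rw [hfil]
        have hmem : lead y ∈ s.filter fun x => lead x = x := Finset.mem_filter.2 ⟨l1, l2⟩
        rw [Finset.sum_update_of_mem hmem, ← Finset.add_sum_erase _ _ hmem,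
          ← Finset.erase_eq] at *
        -- The added piece lies below all the old intervals and inside the new one, so the union
        -- grows by at least the added length.
        have hdisj : Disjoint (Finset.Ioc (F a) (F y))
            (s.biUnion fun x => Finset.Ioc (F x) (L x)) := by
          rw [Finset.disjoint_left]
          intro t ht ht'
          obtain ⟨x, hx, hxt⟩ := Finset.mem_biUnion.1 ht'
          rw [Finset.mem_Ioc] at ht hxt
          have := hymin x hx
          omega
        have hsub : Finset.Ioc (F a) (F y) ∪ (s.biUnion fun x => Finset.Ioc (F x) (L x)) ⊆
            Finset.Ioc (F a) (L a) ∪ s.biUnion fun x => Finset.Ioc (F x) (L x) :=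
          Finset.union_subset_union_left (Finset.Ioc_subset_Ioc_right hyL)
        have := Finset.card_le_card hsub
        rw [Finset.card_union_of_disjoint hdisj, Int.card_Ioc] at this
        omega
    · push Not at hex
      refine ⟨Function.update lead a a, Function.update X a (L a - F a).toNat, ?_, ?_, ?_⟩
      · intro x hx
        rcases Finset.mem_insert.1 hx with rfl | hx
        · simp only [Function.update_self]
          refine ⟨Finset.mem_insert_self _ _, trivial, le_rfl, by omega⟩
        · obtain ⟨x1, x2, x3, x4⟩ := h1 x hx
          rw [Function.update_of_ne (hne x hx), Function.update_of_ne (hne _ x1),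
            Function.update_of_ne (hne _ x1)]
          exact ⟨Finset.mem_insert_of_mem x1, x2, x3, x4⟩
      · intro x hx hlx
        rcases Finset.mem_insert.1 hx with rfl | hx
        · refine ⟨x, Finset.mem_insert_self _ _, ?_⟩
          rw [Function.update_self]
          omega
        · rw [Function.update_of_ne (hne x hx)] at hlx
          obtain ⟨w, hw, hw'⟩ := h2 x hx hlx
          exact ⟨w, Finset.mem_insert_of_mem hw, by rwa [Function.update_of_ne (hne x hx)]⟩
      · have hfil : (insert a s).filter (fun x => Function.update lead a a x = x) =
            insert a (s.filter fun x => lead x = x) := by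
          ext x
          simp only [Finset.mem_filter, Finset.mem_insert]
          constructor
          · rintro ⟨rfl | hx, hlx⟩
            · exact .inl rfl
            · exact .inr ⟨hx, by rwa [Function.update_of_ne (hne x hx)] at hlx⟩
          · rintro (rfl | ⟨hx, hlx⟩)
            · exact ⟨.inl rfl, Function.update_self ..⟩
            · exact ⟨.inr hx, by rwa [Function.update_of_ne (hne x hx)]⟩
        have hnot : a ∉ s.filter fun x => lead x = x := fun h => ha (Finset.mem_filter.1 h).1
        rw [hfil, Finset.sum_insert hnot, Function.update_self,
          Finset.sum_update_of_notMem hnot]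
        have hdisj : Disjoint (Finset.Ioc (F a) (L a))
            (s.biUnion fun x => Finset.Ioc (F x) (L x)) := by
          rw [Finset.disjoint_left]
          intro t ht ht'
          obtain ⟨x, hx, hxt⟩ := Finset.mem_biUnion.1 ht'
          rw [Finset.mem_Ioc] at ht hxt
          have := hex x hx
          omega
        rw [Finset.card_union_of_disjoint hdisj, Int.card_Ioc]
        omega

/-! ### Every sequence of operations is matched by a plan -/

namespace KPathGraph

variable {n k : ℕ}

/-- The first usable edge of every base-path, and how it is entered. -/
theorem exists_boarding (G : KPathGraph n k) (s : Fin n) :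
    ∃ (B : Fin k → Prop) (p : Fin k → ℕ) (h : Fin k → Fin k) (m : Fin k → ℕ),
      (∀ c, B c → p c < G.len c ∧ (G.vtx c (p c) = (s : ℕ) ∨
        (B (h c) ∧ p (h c) ≤ m c ∧ m c < G.len (h c) ∧
          G.posn (h c) (G.vtx c (p c)) = m c + 2 ∧
          G.lab (h c) (m c) < G.lab c (p c)))) ∧
      G.reach s ⊆ {v | v = s ∨ ∃ c, B c ∧ ∃ j : Fin (G.len c + 1), p c ≤ j ∧ G.vert c j = v} := by
  classical
  -- Boarding means the first usable edge; the step by which it became usable supplies the host and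
  -- the entering edge.
  let Q : Fin k → ℕ → Prop := fun c j => ∃ hj : j < G.len c, G.Usable s ⟨c, ⟨j, hj⟩⟩
  let p : Fin k → ℕ := fun c => if hc : ∃ j, Q c j then Nat.find hc else 0
  have hp : ∀ c, (∃ j, Q c j) → Q c (p c) ∧ ∀ j, Q c j → p c ≤ j := by
    intro c hc
    simp only [p, dif_pos hc]
    exact ⟨Nat.find_spec hc, fun j hj => Nat.find_min' hc hj⟩
  have key : ∀ c, ∃ (h : Fin k) (m : ℕ), (∃ j, Q c j) → (G.vtx c (p c) = (s : ℕ) ∨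
        ((∃ j, Q h j) ∧ p h ≤ m ∧ m < G.len h ∧
          G.posn h (G.vtx c (p c)) = m + 2 ∧ G.lab h m < G.lab c (p c))) := by
    intro c
    by_cases hc : ∃ j, Q c j
    · obtain ⟨⟨hlt, hu⟩, -⟩ := hp c hc
      have hv := G.vtx_of_lt (i := c) (j := p c) (by omega)
      cases hu with
      | start he =>
        refine ⟨c, 0, fun _ => .inl ?_⟩
        rw [hv]
        exact congrArg (fun v : Fin n => ((v : ℕ) : ℤ)) he
      | @step _ e' hu' hv' ht =>
        obtain ⟨i, m⟩ := e'
        refine ⟨i, m, fun _ => .inr ⟨⟨m, m.2, hu'⟩, (hp i ⟨m, m.2, hu'⟩).2 m ⟨m.2, hu'⟩, m.2, ?_, ?_⟩⟩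
        · have h1 : G.vtx c (p c) = (G.vert i m.succ : ℕ) := by
            rw [hv]
            exact congrArg (fun v : Fin n => ((v : ℕ) : ℤ)) hv'.symm
          rw [h1, G.posn_vert]
          simp
          ring
        · rw [G.lab_natCast m.2, G.lab_natCast hlt]
          exact ht
    · exact ⟨c, 0, fun h => absurd h hc⟩
  choose h m hm using key
  refine ⟨fun c => ∃ j, Q c j, p, h, m, fun c hc => ⟨(hp c hc).1.1, hm c hc⟩, ?_⟩
  intro v hv
  rcases (G.mem_reach_iff s v).1 hv with rfl | ⟨⟨c, j⟩, hu, rfl⟩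
  · exact .inl rfl
  · have := (hp c ⟨j, j.2, hu⟩).2 j ⟨j.2, hu⟩
    exact .inr ⟨c, ⟨j, j.2, hu⟩, j.succ, by simp; omega, rfl⟩

/-- The plan is read off from the graph after the operations: the boardings are the true ones, and
`dl` and `dr` are the positive and negative parts of the true change at the boarding edges. Only the
advances are reorganized, by merging swept levels into groups. -/
theorem exists_plan (G : KPathGraph n k) (s : Fin n) (ops : List (ShiftOp G.len)) :
    ∃ (g : Plan k) (p : Fin k → ℕ), G.Consistent s g p ∧ (∀ c, g.ty c ≤ 4) ∧
      (∀ c, g.dr c ≤ ∑ i, advanceCost ops i ∧ g.need c ≤ ∑ i, advanceCost ops i ∧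
        g.gap c ≤ ∑ i, advanceCost ops i) ∧
      ∑ c, g.dl c ≤ ∑ i, delayCost ops i ∧ ∑ c, g.adv c ≤ ∑ i, advanceCost ops i ∧
      (G.shiftAll ops).reach s ⊆ G.served s g p := by
  classical
  set G' := G.shiftAll ops with hG'
  obtain ⟨B, p, h, m, hB, hreach⟩ := exists_boarding G' s
  have hlen : G'.len = G.len := rfl
  replace hB : ∀ c, B c → p c < G.len c ∧ (G.vtx c (p c) = (s : ℕ) ∨
        (B (h c) ∧ p (h c) ≤ m c ∧ m c < G.len (h c) ∧
          G.posn (h c) (G.vtx c (p c)) = m c + 2 ∧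
          G'.lab (h c) (m c) < G'.lab c (p c))) := hB
  have hsw : ∀ i (x : ℕ), x < G.len i →
      Finset.Ioc (G'.lab i x - x) (G.lab i x - x) ⊆ sweep G.label G'.label i := by
    intro i x hx
    rw [G.lab_natCast hx, G'.lab_natCast hx]
    exact Finset.subset_biUnion_of_mem (fun m : Fin (G.len i) =>
      Finset.Ioc (G'.label i m - (m : ℕ)) (G.label i m - (m : ℕ))) (Finset.mem_univ (⟨x, hx⟩ : Fin (G.len i)))
  have hcard : ∀ i, (sweep G.label G'.label i).card ≤ advanceCost ops i :=
    card_sweep_le ops G.label G.label_strictMono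
  have hdel : ∀ i (x : ℕ), x < G.len i → G'.lab i x ≤ G.lab i x + delayCost ops i := by
    intro i x hx
    rw [G.lab_natCast hx, G'.lab_natCast hx]
    exact foldl_shiftLabels_le_add ops G.label G.label_strictMono i _
  have hsingle : ∀ i, advanceCost ops i ≤ ∑ i, advanceCost ops i := fun i =>
    Finset.single_le_sum (f := advanceCost ops) (fun _ _ => Nat.zero_le _) (Finset.mem_univ i)
  have hadv : ∀ i (x : ℕ), x < G.len i → (G.lab i x - G'.lab i x).toNat ≤ advanceCost ops i := by
    intro i x hx
    have := (Finset.card_le_card (hsw i x hx)).trans (hcard i)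
    rw [Int.card_Ioc] at this
    omega
  let root : Fin k → Prop := fun c => G.vtx c (p c) = (s : ℕ)
  -- These boardings were impossible with the original label of the entering edge. That edge was
  -- therefore advanced, from level `L` down to level `F`.
  let costly : Fin k → Prop := fun c => B c ∧ ¬ root c ∧ G'.lab c (p c) ≤ G.lab (h c) (m c)
  let F : Fin k → ℤ := fun c => G'.lab (h c) (m c) - m c
  let L : Fin k → ℤ := fun c => G.lab (h c) (m c) - m c
  have hcostly : ∀ c, costly c → B (h c) ∧ p (h c) ≤ m c ∧ m c < G.len (h c) ∧
      G.posn (h c) (G.vtx c (p c)) = m c + 2 ∧ G'.lab (h c) (m c) < G'.lab c (p c) := by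
    rintro c ⟨h1, h2, -⟩
    exact (hB c h1).2.resolve_left h2
  have hgroups := fun i => exists_leaders (Finset.univ.filter fun c => costly c ∧ h c = i)
    (fun c => (m c : ℤ)) F L
    (by
      intro c hc
      obtain ⟨hc, -⟩ := (Finset.mem_filter.1 hc).2
      have h1 := hcostly c hc
      have h2 := hc.2.2
      simp only [F, L]
      omega)
    (by
      intro c hc c' hc' hle
      obtain ⟨hc, rfl⟩ := (Finset.mem_filter.1 hc).2
      obtain ⟨hc', he⟩ := (Finset.mem_filter.1 hc').2
      obtain ⟨-, -, h3, -⟩ := hcostly c' hc'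
      simp only [F, L, he] at h3 ⊢
      have h5 := G.lab_add_le (i := h c) (x := m c) (y := m c') (by omega) hle (by omega)
      have h6 := G'.lab_add_le (i := h c) (x := m c) (y := m c') (by omega) hle
        (by rw [hlen]; omega)
      omega)
  choose lead₀ X₀ hg1 hg2 hg3 using hgroups
  let lead : Fin k → Fin k := fun c => lead₀ (h c) c
  let X : Fin k → ℕ := fun c => X₀ (h c) c
  have hlead : ∀ c, costly c → costly (lead c) ∧ h (lead c) = h c ∧ lead (lead c) = lead c ∧
      m c ≤ m (lead c) ∧ L (lead c) - X (lead c) ≤ F c := by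
    intro c hc
    obtain ⟨h1, h2, h3, h4⟩ := hg1 (h c) c (Finset.mem_filter.2 ⟨Finset.mem_univ c, hc, rfl⟩)
    obtain ⟨h5, h6⟩ := (Finset.mem_filter.1 h1).2
    refine ⟨h5, h6, ?_, by exact_mod_cast h3, ?_⟩
    · simp only [lead, h6, h2]
    · simp only [lead, X, h6]
      exact h4
  have hfirst : ∀ c, costly c → lead c = c → ∃ y, costly y ∧ h y = h c ∧ F y ≤ L c - X c := by
    intro c hc hl
    obtain ⟨y, hy, hy'⟩ := hg2 (h c) c (Finset.mem_filter.2 ⟨Finset.mem_univ c, hc, rfl⟩) hl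
    obtain ⟨h5, h6⟩ := (Finset.mem_filter.1 hy).2
    exact ⟨y, h5, h6, hy'⟩
  -- On each host the group lengths are bounded by the swept levels and hence by the advance spent
  -- there; summing over hosts gives the total.
  have hX : ∑ c, (if costly c ∧ lead c = c then X c else 0) ≤ ∑ i, advanceCost ops i := by
    rw [← Finset.sum_fiberwise (s := Finset.univ) (g := h)]
    refine Finset.sum_le_sum fun i _ => ?_
    refine le_trans (le_of_eq ?_) ((hg3 i).trans ((Finset.card_le_card ?_).trans (hcard i)))
    · rw [← Finset.sum_filter, Finset.filter_filter, Finset.filter_filter]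
      refine Finset.sum_congr ?_ ?_
      · ext c
        simp only [Finset.mem_filter, Finset.mem_univ, true_and]
        constructor
        · rintro ⟨rfl, h1, h2⟩
          exact ⟨⟨h1, rfl⟩, h2⟩
        · rintro ⟨⟨h1, rfl⟩, h2⟩
          exact ⟨rfl, h1, h2⟩
      · intro c hc
        obtain ⟨-, ⟨-, rfl⟩, -⟩ := Finset.mem_filter.1 hc
        rfl
    · refine Finset.biUnion_subset.2 fun c hc => ?_
      obtain ⟨hco, rfl⟩ := (Finset.mem_filter.1 hc).2
      exact hsw _ _ (hcostly c hco).2.2.1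
  let ty : Fin k → ℕ := fun c => if ¬ B c then 0 else if root c then 1 else
    if ¬ costly c then 2 else if lead c = c then 3 else 4
  have hty0 : ∀ c, ty c ≠ 0 → B c := by
    intro c hc
    by_contra hn
    exact hc (if_pos hn)
  have hty0' : ∀ c, B c → ty c ≠ 0 := by
    intro c hc
    simp only [ty, not_true_eq_false, if_false, hc]
    split_ifs <;> simp
  have hty2 : ∀ c, 2 ≤ ty c → B c ∧ ¬ root c := by
    intro c hc
    simp only [ty] at hc
    split_ifs at hc with h1 h2 <;> first | omega | exact ⟨h1, h2⟩
  have hty3 : ∀ c, 3 ≤ ty c → costly c := by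
    intro c hc
    simp only [ty] at hc
    split_ifs at hc with h1 h2 h3 <;> omega
  have hty2' : ∀ c, ty c = 2 → ¬ costly c := by
    intro c hc
    simp only [ty] at hc
    split_ifs at hc with h1 h2 h3 <;> omega
  have hty4 : ∀ c, 4 ≤ ty c → lead c ≠ c := by
    intro c hc
    simp only [ty] at hc
    split_ifs at hc with h1 h2 h3 h4 <;> omega
  have hty3' : ∀ c, ty c = 3 → lead c = c := by
    intro c hc
    simp only [ty] at hc
    split_ifs at hc with h1 h2 h3 h4 <;> omega
  have hlty : ∀ c, costly c → lead c = c → ty c = 3 := by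
    intro c hc hl
    simp only [ty]
    rw [if_neg (not_not.2 hc.1), if_neg hc.2.1, if_neg (not_not.2 hc), if_pos hl]
  let g : Plan k :=
    { par := fun c => if 4 ≤ ty c then lead c else h c
      ty := ty
      dl := fun c => if B c then (G'.lab c (p c) - G.lab c (p c)).toNat else 0
      dr := fun c => if B c then (G.lab c (p c) - G'.lab c (p c)).toNat else 0
      need := fun c => if costly c then (G.lab (h c) (m c) - G'.lab c (p c) + 1).toNat else 0
      gap := fun c => if costly c then (L (lead c) - L c).toNat else 0
      adv := fun c => if costly c ∧ lead c = c then X c else 0 }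
  have hpar4 : ∀ c, 4 ≤ ty c → g.par c = lead c := fun c hc => if_pos hc
  have hpar : ∀ c, ¬ 4 ≤ ty c → g.par c = h c := fun c hc => if_neg hc
  have hhost : ∀ c, g.host c = h c := by
    intro c
    by_cases hc : 4 ≤ ty c
    · have hco := hty3 c (by omega)
      obtain ⟨h1, h2, h3, -⟩ := hlead c hco
      have h4 := hlty _ h1 h3
      rw [Plan.host, if_pos hc, hpar4 c hc, hpar _ (by omega), h2]
    · rw [Plan.host, if_neg hc, hpar c hc]
  have hal : ∀ c, 2 ≤ ty c → G.alight g p c = m c := by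
    intro c hc
    obtain ⟨h1, h2⟩ := hty2 c hc
    have h3 := (hB c h1).2.resolve_left h2
    rw [alight, hhost, h3.2.2.2.1]
    ring
  have hblab : ∀ c, B c → G.blab g p c = G'.lab c (p c) := by
    intro c hc
    simp only [blab, Plan.shift, g, if_pos hc]
    omega
  have hsl : ∀ c, 2 ≤ ty c → G.slack g p c = L c := by
    intro c hc
    rw [slack, hhost, hal c hc]
  have hneed : ∀ c, costly c → g.need c = (G.lab (h c) (m c) - G'.lab c (p c) + 1).toNat :=
    fun c hc => if_pos hc
  have hgap : ∀ c, costly c → g.gap c = (L (lead c) - L c).toNat := fun c hc => if_pos hc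
  have hgadv : ∀ c, costly c → lead c = c → g.adv c = X c := fun c hc hl => if_pos ⟨hc, hl⟩
  have hLle : ∀ c, costly c → L c ≤ L (lead c) := by
    intro c hc
    obtain ⟨h1, h2, -, h4, -⟩ := hlead c hc
    have h5 := (hcostly _ h1).2.2.1
    simp only [L, h2] at h5 ⊢
    have h6 := G.lab_add_le (i := h c) (x := m c) (y := m (lead c)) (by omega)
      (by exact_mod_cast h4) (by exact_mod_cast h5)
    omega
  have hFp : ∀ c, costly c → G'.lab (h c) (p (h c)) - p (h c) ≤ F c := by
    intro c hc
    obtain ⟨h1, h2, h3, -⟩ := hcostly c hc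
    have h6 := G'.lab_add_le (i := h c) (x := p (h c)) (y := m c) (by omega)
      (by exact_mod_cast h2) (by exact_mod_cast h3)
    simp only [F]
    omega
  -- The sum is the distance from the leader's original level down to the last level at which the
  -- member's entering edge precedes its boarding label. The true final level `F c` is at or below
  -- that level, and the group reaches down to `F c`.
  have hneedgap : ∀ c, costly c → g.need c + g.gap c ≤ X (lead c) := by
    intro c hc
    have h1 := hneed c hc
    have h2 := hgap c hc
    have h3 := (hlead c hc).2.2.2.2
    have h4 := hLle c hc
    have h5 := (hcostly c hc).2.2.2.2
    have h6 := hc.2.2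
    simp only [F] at h3
    have h7 : L c = G.lab (h c) (m c) - m c := rfl
    omega
  have hXle : ∀ c, costly c → X (lead c) ≤ ∑ i, advanceCost ops i := by
    intro c hc
    have h1 := hlead c hc
    refine le_trans ?_ hX
    have := Finset.single_le_sum (f := fun c => if costly c ∧ lead c = c then X c else 0)
      (fun _ _ => Nat.zero_le _) (Finset.mem_univ (lead c))
    simpa only [if_pos (And.intro h1.1 h1.2.2.1)] using this
  refine ⟨g, p, ⟨fun c hc => (hB c (hty0 c hc)).1, ?_, ?_⟩, ?_, ?_, ?_, ?_, ?_⟩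
  · intro c hc
    have hBc := hty0 c hc
    have hchild : 2 ≤ ty c → B (h c) ∧ p (h c) ≤ m c ∧ m c < G.len (h c) ∧
        G'.lab (h c) (m c) < G'.lab c (p c) := by
      intro hc2
      have h3 := (hB c hBc).2.resolve_left (hty2 c hc2).2
      exact ⟨h3.1, h3.2.1, h3.2.2.1, h3.2.2.2.2⟩
    have hL : 2 ≤ ty c → G.lab (h c) (p (h c)) - p (h c) ≤ G.lab (h c) (m c) - m c ∧
        G'.lab (h c) (p (h c)) - p (h c) ≤ G'.lab (h c) (m c) - m c := by
      intro hc2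
      obtain ⟨-, h2, h3, -⟩ := hchild hc2
      have h5 := G.lab_add_le (i := h c) (x := p (h c)) (y := m c) (by omega)
        (by exact_mod_cast h2) (by exact_mod_cast h3)
      have h6 := G'.lab_add_le (i := h c) (x := p (h c)) (y := m c) (by omega)
        (by exact_mod_cast h2) (by exact_mod_cast h3)
      omega
    have hdlh : B (h c) → (g.dl (h c) : ℤ) = (G'.lab (h c) (p (h c)) - G.lab (h c) (p (h c))).toNat :=
      fun hb => by simp only [g, if_pos hb]
    refine ⟨fun h1 => ?_, fun h1 => ?_, fun h1 => ?_, fun h1 => ?_, fun h1 => ?_, fun h1 => ?_⟩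
    · by_contra hr
      have h2 : ty c = 1 := h1
      simp only [ty] at h2
      rw [if_neg (not_not.2 hBc), if_neg hr] at h2
      split_ifs at h2 <;> omega
    · rw [hhost, hal c h1]
      have h2 := hchild h1
      exact ⟨hty0' _ h2.1, by exact_mod_cast h2.2.1⟩
    · have hc2 : 2 ≤ ty c := h1.ge
      rw [hhost, hal c hc2, hblab c hBc]
      have h2 := hchild hc2
      have h3 := hL hc2
      have h4 := hdlh h2.1
      have h5 : G.lab (h c) (m c) < G'.lab c (p c) := by
        by_contra! hle
        exact hty2' c h1 ⟨hBc, (hty2 c hc2).2, hle⟩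
      omega
    · have hc2 : 2 ≤ ty c := le_trans (by norm_num) h1
      have hco := hty3 c h1
      have h2 := hchild hc2
      have h3 := hL hc2
      have h4 := hdlh h2.1
      have h5 := hco.2.2
      rw [hhost, hal c hc2, hblab c hBc, hneed c hco]
      have h6 : G.lab (h c) (p (h c)) + g.shift (h c) = G'.lab (h c) (p (h c)) := hblab _ h2.1
      refine ⟨by omega, ?_, by omega⟩
      -- A group extends no further down than the final level of one of its entering edges. In the
      -- true final graph the host's boarding edge is at or below this level, so the full advance
      -- `X` is compatible with it.
      by_cases hl : lead c = c
      · rw [hgadv c hco hl]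
        obtain ⟨y, hy, hy', hyF⟩ := hfirst c hco hl
        have h7 := hFp y hy
        rw [hy'] at h7
        have h8 : L c = G.lab (h c) (m c) - m c := rfl
        omega
      · have h7 : g.adv c = 0 := if_neg fun hh => hl hh.2
        rw [h7]
        omega
    · have hco := hty3 c (le_of_eq h1.symm)
      have hl := hty3' c h1
      have := hneedgap c hco
      rw [hgadv c hco hl]
      rw [hl] at this
      omega
    · have hco := hty3 c (le_trans (by norm_num) h1)
      have := hlead c hco
      rw [hpar4 c h1]
      exact hlty _ this.1 this.2.2.1
  · intro c hc
    have hc4 : 4 ≤ ty c := hc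
    have hco := hty3 c (by omega)
    have h1 := hlead c hco
    have h2 := hlty _ h1.1 h1.2.2.1
    refine ⟨?_, ?_, ?_⟩
    · rw [hpar4 c hc, hal c (by omega), hal _ (by omega)]
      exact_mod_cast h1.2.2.2.1
    · rw [hpar4 c hc, hsl c (by omega), hsl _ (by omega), hgap c hco]
      have := hLle c hco
      omega
    · rw [hpar4 c hc, hgadv _ h1.1 h1.2.2.1]
      exact hneedgap c hco
  · intro c
    simp only [g, ty]
    split_ifs <;> simp
  · intro c
    refine ⟨?_, ?_, ?_⟩
    · by_cases hc : B c
      · simp only [g, if_pos hc]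
        exact (hadv c _ (hB c hc).1).trans (hsingle c)
      · simp only [g, if_neg hc, Nat.zero_le]
    · by_cases hc : costly c
      · have := hneedgap c hc
        have := hXle c hc
        omega
      · simp only [g, if_neg hc, Nat.zero_le]
    · by_cases hc : costly c
      · have := hneedgap c hc
        have := hXle c hc
        omega
      · simp only [g, if_neg hc, Nat.zero_le]
  · refine Finset.sum_le_sum fun c _ => ?_
    by_cases hc : B c
    · simp only [g, if_pos hc]
      have := hdel c _ (hB c hc).1
      omega
    · simp only [g, if_neg hc, Nat.zero_le]
  · exact hX
  · intro v hv
    rcases hreach hv with rfl | ⟨c, hc, j, hj, hjv⟩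
    · exact .inl rfl
    · exact .inr ⟨c, hty0' c hc, j, hj, hjv⟩

end KPathGraph

/-- The largest delay of a boarding edge that is guessed. -/
def ShiftKind.maxDelay : ShiftKind → ℕ → ℕ
  | .advanceOnly, _ => 0
  | _, b => b

/-- The largest advance that is guessed. -/
def ShiftKind.maxAdvance : ShiftKind → ℕ → ℕ
  | .delayOnly, _ => 0
  | _, b => b

/-- The plans that are enumerated. -/
structure Plan.Admissible {k : ℕ} (g : KPathGraph.Plan k) (kind : ShiftKind) (b : ℕ) : Prop where
  ty : ∀ c, g.ty c ≤ 4
  dl : ∀ c, g.dl c ≤ kind.maxDelay b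
  dr : ∀ c, g.dr c ≤ b
  need : ∀ c, g.need c ≤ b
  gap : ∀ c, g.gap c ≤ b
  adv : ∀ c, g.adv c ≤ kind.maxAdvance b

/-! ### Plans and the optimal value -/

namespace MaxReachInstance

open KPathGraph

variable (I : MaxReachInstance) (kind : ShiftKind)

/-- In a one-sided variant the limit 0 for the forbidden direction makes `dl` or every demand
vanish, so no forbidden operation is produced. -/
theorem isFeasible_planOps {g : Plan I.k} {p : Fin I.k → ℕ} (hg : Plan.Admissible g kind I.budget)
    (hb : ∑ c, (g.dl c + g.adv c) ≤ I.budget) : I.IsFeasible kind (I.graph.planOps g p) := by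
  refine ⟨fun o ho => ?_, planOps_cost.trans hb⟩
  rcases List.mem_append.1 ho with ho | ho
  · obtain ⟨-, h1, -, h2⟩ := mem_planDelays.1 ho
    cases kind with
    | delayOnly =>
      change 0 < o.amount
      omega
    | advanceOnly =>
      have := hg.dl o.path
      change _ ≤ 0 at this
      omega
    | anyShift => trivial
  · obtain ⟨h1, h2⟩ := mem_planAdvances.1 ho
    cases kind with
    | delayOnly =>
      have : I.graph.demand g p o.path o.pos ≤ 0 := by
        refine Finset.sup_le fun c _ => ?_
        have : g.adv c ≤ 0 := hg.adv c
        split_ifs <;> omega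
      omega
    | advanceOnly =>
      change o.amount < 0
      omega
    | anyShift => trivial

theorem ncard_served_le_value {g : Plan I.k} {p : Fin I.k → ℕ}
    (hp : I.graph.Consistent I.source g p) :
    (I.graph.served I.source g p).ncard ≤ I.value (I.graph.planOps g p) :=
  Set.ncard_le_ncard (served_subset_reach hp)

/-- The cost of an operation is the positive plus the negative part of its amount, so total delay
and total advance share one budget. In a one-sided variant one of the two totals is 0. -/
theorem exists_plan_of_isFeasible {ops : List (ShiftOp I.graph.len)}
    (hops : I.IsFeasible kind ops) : ∃ (g : Plan I.k) (p : Fin I.k → ℕ),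
      I.graph.Consistent I.source g p ∧ Plan.Admissible g kind I.budget ∧
      ∑ c, (g.dl c + g.adv c) ≤ I.budget ∧
      I.value ops ≤ (I.graph.served I.source g p).ncard := by
  obtain ⟨g, p, h1, h2, h3, h4, h5, h6⟩ := exists_plan I.graph I.source ops
  have hsum : ∑ i, delayCost ops i + ∑ i, advanceCost ops i ≤ I.budget := by
    rw [sum_delayCost, sum_advanceCost, ← List.sum_map_add]
    refine le_trans (le_of_eq ?_) hops.2
    congr 2
    funext o
    omega
  have hd : ∑ i, delayCost ops i ≤ kind.maxDelay I.budget := by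
    cases kind with
    | advanceOnly =>
      change _ ≤ 0
      rw [sum_delayCost, Nat.le_zero, List.sum_eq_zero_iff]
      intro x hx
      obtain ⟨o, ho, rfl⟩ := List.mem_map.1 hx
      have : o.amount < 0 := hops.1 o ho
      omega
    | delayOnly => exact (Nat.le_add_right _ _).trans hsum
    | anyShift => exact (Nat.le_add_right _ _).trans hsum
  have ha : ∑ i, advanceCost ops i ≤ kind.maxAdvance I.budget := by
    cases kind with
    | delayOnly =>
      change _ ≤ 0
      rw [sum_advanceCost, Nat.le_zero, List.sum_eq_zero_iff]
      intro x hx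
      obtain ⟨o, ho, rfl⟩ := List.mem_map.1 hx
      have : 0 < o.amount := hops.1 o ho
      omega
    | advanceOnly => exact (Nat.le_add_left _ _).trans hsum
    | anyShift => exact (Nat.le_add_left _ _).trans hsum
  have hb : ∑ i, advanceCost ops i ≤ I.budget := (Nat.le_add_left _ _).trans hsum
  refine ⟨g, p, h1, ⟨h2, fun c => ?_, fun c => (h3 c).1.trans hb, fun c => (h3 c).2.1.trans hb,
    fun c => (h3 c).2.2.trans hb, fun c => ?_⟩, ?_, Set.ncard_le_ncard h6⟩
  · exact (Finset.single_le_sum (fun _ _ => Nat.zero_le _) (Finset.mem_univ c)).trans (h4.trans hd)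
  · exact (Finset.single_le_sum (fun _ _ => Nat.zero_le _) (Finset.mem_univ c)).trans (h5.trans ha)
  · rw [Finset.sum_add_distrib]
    exact (add_le_add h4 h5).trans hsum

end MaxReachInstance

/-! ### Reasoning about programs -/

namespace Ram

instance : Add Expr := ⟨Expr.add⟩
instance : Sub Expr := ⟨Expr.sub⟩

@[simp] theorem Expr.eval_const (σ : Store) (z : ℤ) : (Expr.const z).eval σ = z := rfl
@[simp] theorem Expr.eval_reg (σ : Store) (r : ℕ) : (Expr.reg r).eval σ = σ.reg r := rfl
@[simp] theorem Expr.eval_cell (σ : Store) (a : ℕ) (e : Expr) :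
    (Expr.cell a e).eval σ = σ.mem a (e.eval σ) := rfl
@[simp] theorem Expr.eval_add (σ : Store) (e₁ e₂ : Expr) :
    (e₁ + e₂).eval σ = e₁.eval σ + e₂.eval σ := rfl
@[simp] theorem Expr.eval_sub (σ : Store) (e₁ e₂ : Expr) :
    (e₁ - e₂).eval σ = e₁.eval σ - e₂.eval σ := rfl

@[simp] theorem Store.setReg_reg (σ : Store) (r : ℕ) (z : ℤ) (r' : ℕ) :
    (σ.setReg r z).reg r' = if r' = r then z else σ.reg r' := by
  simp [Store.setReg, Function.update_apply]
@[simp] theorem Store.setReg_mem (σ : Store) (r : ℕ) (z : ℤ) : (σ.setReg r z).mem = σ.mem := rfl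
@[simp] theorem Store.setMem_reg (σ : Store) (a : ℕ) (i z : ℤ) : (σ.setMem a i z).reg = σ.reg := rfl
@[simp] theorem Store.setMem_mem (σ : Store) (a : ℕ) (i z : ℤ) (a' : ℕ) :
    (σ.setMem a i z).mem a' = if a' = a then Function.update (σ.mem a) i z else σ.mem a' := by
  simp [Store.setMem, Function.update_apply]

namespace Prog

/-- Programs without loops. -/
def loopFree : Prog → Bool
  | skip => true
  | assign _ _ => true
  | write _ _ _ => true
  | seq p q => p.loopFree && q.loopFree
  | ifLe _ _ p q => p.loopFree && q.loopFree
  | whileLe _ _ _ => false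

/-- The effect of a program without loops. -/
def exec : Prog → Store → Store
  | skip, σ => σ
  | assign r e, σ => σ.setReg r (e.eval σ)
  | write a i e, σ => σ.setMem a (i.eval σ) (e.eval σ)
  | seq p q, σ => q.exec (p.exec σ)
  | ifLe e₁ e₂ p q, σ => if e₁.eval σ ≤ e₂.eval σ then p.exec σ else q.exec σ
  | whileLe _ _ _, σ => σ

theorem exec_seq (p q : Prog) (σ : Store) : (seq p q).exec σ = q.exec (p.exec σ) := rfl

theorem exec_ifLe (e₁ e₂ : Expr) (p q : Prog) (σ : Store) :
    (ifLe e₁ e₂ p q).exec σ = if e₁.eval σ ≤ e₂.eval σ then p.exec σ else q.exec σ := rfl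

/-- A bound for the number of steps of a program without loops. -/
def bound : Prog → ℕ
  | skip => 1
  | assign _ e => e.cost + 1
  | write _ i e => i.cost + e.cost + 1
  | seq p q => p.bound + q.bound
  | ifLe e₁ e₂ p q => e₁.cost + e₂.cost + 1 + (p.bound + q.bound)
  | whileLe _ _ _ => 0

/-- The registers that a program writes. -/
def regs : Prog → List ℕ
  | skip => []
  | assign r _ => [r]
  | write _ _ _ => []
  | seq p q => p.regs ++ q.regs
  | ifLe _ _ p q => p.regs ++ q.regs
  | whileLe _ _ p => p.regs

/-- The arrays that a program writes. -/
def mems : Prog → List ℕ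
  | skip => []
  | assign _ _ => []
  | write a _ _ => [a]
  | seq p q => p.mems ++ q.mems
  | ifLe _ _ p q => p.mems ++ q.mems
  | whileLe _ _ p => p.mems

end Prog

/-- Loop-free code can thus be treated by symbolic evaluation with `exec`; only loops need
invariants. -/
theorem runs_exec (p : Prog) (h : p.loopFree = true) (σ : Store) :
    ∃ t, t ≤ p.bound ∧ Runs p σ t (p.exec σ) := by
  induction p generalizing σ with
  | skip => exact ⟨_, le_rfl, .skip σ⟩
  | assign r e => exact ⟨_, le_rfl, .assign r e σ⟩
  | write a i e => exact ⟨_, le_rfl, .write a i e σ⟩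
  | seq p q ihp ihq =>
    rw [Prog.loopFree, Bool.and_eq_true] at h
    obtain ⟨t, ht, hr⟩ := ihp h.1 σ
    obtain ⟨u, hu, hs⟩ := ihq h.2 (p.exec σ)
    exact ⟨_, add_le_add ht hu, .seq hr hs⟩
  | ifLe e₁ e₂ p q ihp ihq =>
    rw [Prog.loopFree, Bool.and_eq_true] at h
    rw [Prog.exec, Prog.bound]
    split_ifs with hc
    · obtain ⟨t, ht, hr⟩ := ihp h.1 σ
      exact ⟨_, by omega, .ifTrue hc hr⟩
    · obtain ⟨t, ht, hr⟩ := ihq h.2 σ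
      exact ⟨_, by omega, .ifFalse hc hr⟩
  | whileLe e₁ e₂ p => simp [Prog.loopFree] at h

/-- `τ` agrees with `σ` in all that `p` does not write. -/
def Frame (p : Prog) (σ τ : Store) : Prop :=
  (∀ r, r ∉ p.regs → τ.reg r = σ.reg r) ∧ ∀ a, a ∉ p.mems → τ.mem a = σ.mem a

theorem Frame.refl (p : Prog) (σ : Store) : Frame p σ σ := ⟨fun _ _ => rfl, fun _ _ => rfl⟩

theorem Frame.trans {p : Prog} {σ τ υ : Store} (h : Frame p σ τ) (h' : Frame p τ υ) :
    Frame p σ υ :=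
  ⟨fun r hr => (h'.1 r hr).trans (h.1 r hr), fun a ha => (h'.2 a ha).trans (h.2 a ha)⟩

theorem Frame.mono {p q : Prog} {σ τ : Store} (h : Frame p σ τ) (hr : p.regs ⊆ q.regs)
    (hm : p.mems ⊆ q.mems) : Frame q σ τ :=
  ⟨fun r hn => h.1 r fun hh => hn (hr hh), fun a hn => h.2 a fun hh => hn (hm hh)⟩

theorem Runs.frame {p : Prog} {σ τ : Store} {t : ℕ} (h : Runs p σ t τ) : Frame p σ τ := by
  induction h with
  | skip σ => exact .refl _ _
  | assign r e σ =>
    refine ⟨fun r' hr => ?_, fun a _ => rfl⟩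
    simp only [Prog.regs, List.mem_singleton] at hr
    simp [hr]
  | write a i e σ =>
    refine ⟨fun r' _ => rfl, fun a' ha => ?_⟩
    simp only [Prog.mems, List.mem_singleton] at ha
    simp [ha]
  | seq _ _ ih₁ ih₂ =>
    exact (ih₁.mono (by simp [Prog.regs]) (by simp [Prog.mems])).trans
      (ih₂.mono (by simp [Prog.regs]) (by simp [Prog.mems]))
  | ifTrue _ _ ih => exact ih.mono (by simp [Prog.regs]) (by simp [Prog.mems])
  | ifFalse _ _ ih => exact ih.mono (by simp [Prog.regs]) (by simp [Prog.mems])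
  | whileTrue _ _ _ ih₁ ih₂ =>
    exact (ih₁.mono (by simp [Prog.regs]) (by simp [Prog.mems])).trans ih₂
  | whileFalse _ => exact .refl _ _

theorem frame_exec {p : Prog} (h : p.loopFree = true) (σ : Store) : Frame p σ (p.exec σ) := by
  obtain ⟨t, -, hr⟩ := runs_exec p h σ
  exact hr.frame

/-- Started in `σ`, the program `p` halts after at most `T` steps in a store that satisfies `Q`. -/
def Wp (p : Prog) (σ : Store) (T : ℕ) (Q : Store → Prop) : Prop :=
  ∃ t τ, Runs p σ t τ ∧ t ≤ T ∧ Q τ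

theorem Wp.mono {p : Prog} {σ : Store} {T T' : ℕ} {Q Q' : Store → Prop} (h : Wp p σ T Q)
    (hT : T ≤ T') (hQ : ∀ τ, Frame p σ τ → Q τ → Q' τ) : Wp p σ T' Q' := by
  obtain ⟨t, τ, hr, ht, hq⟩ := h
  exact ⟨t, τ, hr, ht.trans hT, hQ τ hr.frame hq⟩

theorem Wp.exec {p : Prog} {σ : Store} {T : ℕ} {Q : Store → Prop} (h : p.loopFree = true)
    (hT : p.bound ≤ T) (hQ : Frame p σ (p.exec σ) → Q (p.exec σ)) : Wp p σ T Q := by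
  obtain ⟨t, ht, hr⟩ := runs_exec p h σ
  exact ⟨t, _, hr, ht.trans hT, hQ hr.frame⟩

theorem Wp.seq {p q : Prog} {σ : Store} {T U : ℕ} {R Q : Store → Prop} (hp : Wp p σ T R)
    (hq : ∀ τ, Frame p σ τ → R τ → Wp q τ U Q) : Wp (.seq p q) σ (T + U) Q := by
  obtain ⟨t, τ, hr, ht, hR⟩ := hp
  obtain ⟨u, υ, hs, hu, hQ⟩ := hq τ hr.frame hR
  exact ⟨_, υ, .seq hr hs, add_le_add ht hu, hQ⟩

theorem Wp.ifLe {e₁ e₂ : Expr} {p q : Prog} {σ : Store} {T : ℕ} {Q : Store → Prop}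
    (hp : e₁.eval σ ≤ e₂.eval σ → Wp p σ T Q) (hq : ¬ e₁.eval σ ≤ e₂.eval σ → Wp q σ T Q) :
    Wp (.ifLe e₁ e₂ p q) σ (e₁.cost + e₂.cost + 1 + T) Q := by
  by_cases hc : e₁.eval σ ≤ e₂.eval σ
  · obtain ⟨t, τ, hr, ht, hQ⟩ := hp hc
    exact ⟨_, τ, .ifTrue hc hr, by omega, hQ⟩
  · obtain ⟨t, τ, hr, ht, hQ⟩ := hq hc
    exact ⟨_, τ, .ifFalse hc hr, by omega, hQ⟩

/-- A loop with a variant. -/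
theorem Wp.while_variant {e₁ e₂ : Expr} {p : Prog} {σ : Store} {B : ℕ} (Inv : Store → Prop)
    (V : Store → ℕ) (h0 : Inv σ)
    (hstep : ∀ τ, Frame p σ τ → Inv τ → e₁.eval τ ≤ e₂.eval τ →
      Wp p τ B fun υ => Inv υ ∧ V υ < V τ) :
    Wp (.whileLe e₁ e₂ p) σ ((V σ + 1) * (B + (e₁.cost + e₂.cost + 1)))
      fun τ => Inv τ ∧ ¬ e₁.eval τ ≤ e₂.eval τ := by
  have key : ∀ N τ, Frame p σ τ → Inv τ → V τ ≤ N →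
      Wp (.whileLe e₁ e₂ p) τ ((N + 1) * (B + (e₁.cost + e₂.cost + 1)))
        fun υ => Inv υ ∧ ¬ e₁.eval υ ≤ e₂.eval υ := by
    intro N
    induction N with
    | zero =>
      intro τ hF hI hV
      by_cases hc : e₁.eval τ ≤ e₂.eval τ
      · obtain ⟨t, υ, -, -, -, hlt⟩ := hstep τ hF hI hc
        omega
      · exact ⟨_, τ, .whileFalse hc, by omega, hI, hc⟩
    | succ N ih =>
      intro τ hF hI hV
      by_cases hc : e₁.eval τ ≤ e₂.eval τ
      · obtain ⟨t, υ, hr, ht, hI', hlt⟩ := hstep τ hF hI hc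
        obtain ⟨u, ω, hs, hu, hQ⟩ := ih υ (hF.trans hr.frame) hI' (by omega)
        refine ⟨_, ω, .whileTrue hc hr hs, ?_, hQ⟩
        rw [add_mul, one_mul]
        omega
      · refine ⟨_, τ, .whileFalse hc, ?_, hI, hc⟩
        nlinarith [Nat.zero_le (N * (B + (e₁.cost + e₂.cost + 1)))]
  exact key _ σ (.refl _ _) h0 le_rfl

/-- A loop with a known number of iterations. -/
theorem Wp.while_count {e₁ e₂ : Expr} {p : Prog} {σ : Store} {B : ℕ} (N : ℕ)
    (Inv : ℕ → Store → Prop) (h0 : Inv 0 σ)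
    (hstep : ∀ i τ, i < N → Frame p σ τ → Inv i τ → e₁.eval τ ≤ e₂.eval τ ∧ Wp p τ B (Inv (i + 1)))
    (hN : ∀ τ, Frame p σ τ → Inv N τ → ¬ e₁.eval τ ≤ e₂.eval τ) :
    Wp (.whileLe e₁ e₂ p) σ ((N + 1) * (B + (e₁.cost + e₂.cost + 1))) (Inv N) := by
  have key : ∀ d i τ, i + d = N → Frame p σ τ → Inv i τ →
      Wp (.whileLe e₁ e₂ p) τ ((d + 1) * (B + (e₁.cost + e₂.cost + 1))) (Inv N) := by
    intro d
    induction d with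
    | zero =>
      intro i τ hi hF hI
      obtain rfl : i = N := by omega
      exact ⟨_, τ, .whileFalse (hN τ hF hI), by omega, hI⟩
    | succ d ih =>
      intro i τ hi hF hI
      obtain ⟨hc, t, υ, hr, ht, hI'⟩ := hstep i τ (by omega) hF hI
      obtain ⟨u, ω, hs, hu, hQ⟩ := ih (i + 1) υ (by omega) (hF.trans hr.frame) hI'
      refine ⟨_, ω, .whileTrue hc hr hs, ?_, hQ⟩
      rw [add_mul, one_mul]
      omega
  exact key N 0 σ (by omega) (.refl _ _) h0

namespace Prog

/-- Assign `e` to `r` if the inequality holds for one of the given pairs. -/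
def guards (r : ℕ) (e : Expr) : List (Expr × Expr) → Prog
  | [] => skip
  | c :: cs => ifLe c.1 c.2 (assign r e) (guards r e cs)

/-- The pairs will be negated constraints: either one of them is violated and `r` is set, or all
constraints hold and nothing changes. -/
theorem exec_guards (r : ℕ) (e : Expr) (cs : List (Expr × Expr)) (σ : Store) :
    ((∃ c ∈ cs, c.1.eval σ ≤ c.2.eval σ) ∧ (guards r e cs).exec σ = σ.setReg r (e.eval σ)) ∨
      ((∀ c ∈ cs, c.2.eval σ < c.1.eval σ) ∧ (guards r e cs).exec σ = σ) := by
  induction cs with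
  | nil => exact .inr ⟨by simp, rfl⟩
  | cons c cs ih =>
    rw [guards, exec]
    by_cases h : c.1.eval σ ≤ c.2.eval σ
    · rw [if_pos h]
      exact .inl ⟨⟨c, List.mem_cons_self, h⟩, rfl⟩
    · rw [if_neg h]
      rcases ih with ⟨⟨c', hc', h'⟩, he⟩ | ⟨hall, he⟩
      · exact .inl ⟨⟨c', List.mem_cons_of_mem _ hc', h'⟩, he⟩
      · refine .inr ⟨?_, he⟩
        intro c' hc'
        rcases List.mem_cons.1 hc' with rfl | hc'
        · exact not_le.1 h
        · exact hall c' hc'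

end Prog

end Ram

/-! ### The store during the search

Registers `0` to `3` hold the number of vertices, the number `k` of base-paths, the budget and the
source, registers `4` to `9` the multiples `2 * k` to `7 * k`.  Array `0` is the input; arrays `2` to
`4` hold the lengths of the base-paths and pointers to their vertices and labels; arrays `5` and `6`
hold the table of positions, array `7` the limits of the digits of a plan, array `8` the current
plan, array `9` the boarding positions, array `10` the edges before the boarding vertices, and array
`11` marks of vertices. -/

namespace MaxReachInstance

open KPathGraph Ram Ram.Prog Ram.Expr

variable (I : MaxReachInstance)

/-- The part of the store that does not change during the search. -/
structure Env (kind : ShiftKind) (σ : Store) : Prop where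
  r0 : σ.reg 0 = I.n
  r1 : σ.reg 1 = I.k
  r2 : σ.reg 2 = I.budget
  r3 : σ.reg 3 = (I.source : ℕ)
  r4 : σ.reg 4 = 2 * I.k
  r5 : σ.reg 5 = 3 * I.k
  r6 : σ.reg 6 = 4 * I.k
  r7 : σ.reg 7 = 5 * I.k
  r8 : σ.reg 8 = 6 * I.k
  r9 : σ.reg 9 = 7 * I.k
  len : ∀ i : Fin I.k, σ.mem 2 (i : ℕ) = I.graph.len i
  vert : ∀ (i : Fin I.k) (j : ℕ), j < I.graph.len i + 1 →
    σ.mem 0 (σ.mem 3 (i : ℕ) + j) = I.graph.vtx i j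
  label : ∀ (i : Fin I.k) (z : ℤ), 0 ≤ z → z < I.graph.len i →
    σ.mem 0 (σ.mem 4 (i : ℕ) + z) = I.graph.lab i z
  posn : ∀ (i : Fin I.k) (v : Fin I.n),
    σ.mem 6 (σ.mem 5 (i : ℕ) + (v : ℕ)) = I.graph.posn i (v : ℕ)
  lim : ∀ c : Fin I.k, σ.mem 7 (c : ℕ) = I.k - 1 ∧ σ.mem 7 (c + I.k) = 4 ∧
    σ.mem 7 (c + 2 * I.k) = kind.maxDelay I.budget ∧ σ.mem 7 (c + 3 * I.k) = I.budget ∧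
    σ.mem 7 (c + 4 * I.k) = I.budget ∧ σ.mem 7 (c + 5 * I.k) = I.budget ∧
    σ.mem 7 (c + 6 * I.k) = kind.maxAdvance I.budget

/-- A program that writes neither the registers nor the arrays below the given numbers, except for
the output array. -/
def Safe (p : Prog) (r a : ℕ) : Bool := p.regs.all (r ≤ ·) && p.mems.all fun x => x = 1 || a ≤ x

theorem Safe.reg {p : Prog} {r a : ℕ} (h : Safe p r a = true) {σ τ : Store} (hF : Frame p σ τ)
    {x : ℕ} (hx : x < r) : τ.reg x = σ.reg x := by
  refine hF.1 x fun hm => ?_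
  rw [Safe, Bool.and_eq_true, List.all_eq_true] at h
  have := h.1 x hm
  simp at this
  omega

theorem Safe.mem {p : Prog} {r a : ℕ} (h : Safe p r a = true) {σ τ : Store} (hF : Frame p σ τ)
    {x : ℕ} (hx : x < a) (h1 : x ≠ 1) : τ.mem x = σ.mem x := by
  refine hF.2 x fun hm => ?_
  rw [Safe, Bool.and_eq_true, List.all_eq_true, List.all_eq_true] at h
  have := h.2 x hm
  simp at this
  omega

variable {I}

theorem Env.congr {kind : ShiftKind} {σ τ : Store} (h : I.Env kind σ)
    (hr : ∀ x < 10, τ.reg x = σ.reg x) (hm : ∀ x < 8, x ≠ 1 → τ.mem x = σ.mem x) :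
    I.Env kind τ := by
  obtain ⟨h0, h1, h2, h3, h4, h5, h6, h7, h8, h9, hl, hv, hla, hp, hlim⟩ := h
  constructor <;> simp only [hr _ (by norm_num : 0 < 10), hr _ (by norm_num : 1 < 10),
    hr _ (by norm_num : 2 < 10), hr _ (by norm_num : 3 < 10), hr _ (by norm_num : 4 < 10),
    hr _ (by norm_num : 5 < 10), hr _ (by norm_num : 6 < 10), hr _ (by norm_num : 7 < 10),
    hr _ (by norm_num : 8 < 10), hr _ (by norm_num : 9 < 10),
    hm _ (by norm_num : 0 < 8) (by norm_num), hm _ (by norm_num : 2 < 8) (by norm_num),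
    hm _ (by norm_num : 3 < 8) (by norm_num), hm _ (by norm_num : 4 < 8) (by norm_num),
    hm _ (by norm_num : 5 < 8) (by norm_num), hm _ (by norm_num : 6 < 8) (by norm_num),
    hm _ (by norm_num : 7 < 8) (by norm_num)] <;> assumption

theorem Env.frame {kind : ShiftKind} {σ τ : Store} {p : Prog} (h : I.Env kind σ)
    (hF : Frame p σ τ) (hs : Safe p 10 8 = true) : I.Env kind τ :=
  h.congr (fun _ hx => Safe.reg hs hF hx) fun _ hx h1 => Safe.mem hs hF hx h1

/-- The plan `g` is stored. -/
structure HasPlan (g : Plan I.k) (σ : Store) : Prop where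
  par : ∀ c : Fin I.k, σ.mem 8 (c : ℕ) = (g.par c : ℕ)
  ty : ∀ c : Fin I.k, σ.mem 8 (c + I.k) = g.ty c
  dl : ∀ c : Fin I.k, σ.mem 8 (c + 2 * I.k) = g.dl c
  dr : ∀ c : Fin I.k, σ.mem 8 (c + 3 * I.k) = g.dr c
  need : ∀ c : Fin I.k, σ.mem 8 (c + 4 * I.k) = g.need c
  gap : ∀ c : Fin I.k, σ.mem 8 (c + 5 * I.k) = g.gap c
  adv : ∀ c : Fin I.k, σ.mem 8 (c + 6 * I.k) = g.adv c

theorem HasPlan.congr {g : Plan I.k} {σ τ : Store} (h : HasPlan g σ) (hm : τ.mem 8 = σ.mem 8) :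
    HasPlan g τ := by
  obtain ⟨h1, h2, h3, h4, h5, h6, h7⟩ := h
  constructor <;> simpa only [hm]

theorem HasPlan.frame {g : Plan I.k} {σ τ : Store} {p : Prog} (h : HasPlan g σ)
    (hF : Frame p σ τ) (hs : Safe p 10 9 = true) : HasPlan g τ :=
  h.congr (Safe.mem hs hF (by norm_num) (by norm_num))

/-- The parent, in the current plan, of the base-path with number `e`. -/
def parE (e : Expr) : Expr := cell 8 e
/-- The type, in the current plan, of the base-path with number `e`. -/
def tyE (e : Expr) : Expr := cell 8 (e + reg 1)
/-- The delay, in the current plan, of the base-path with number `e`. -/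
def dlE (e : Expr) : Expr := cell 8 (e + reg 4)
/-- The reduction, in the current plan, of the base-path with number `e`. -/
def drE (e : Expr) : Expr := cell 8 (e + reg 5)
/-- The need, in the current plan, of the base-path with number `e`. -/
def needE (e : Expr) : Expr := cell 8 (e + reg 6)
/-- The gap, in the current plan, of the base-path with number `e`. -/
def gapE (e : Expr) : Expr := cell 8 (e + reg 7)
/-- The advance, in the current plan, of the base-path with number `e`. -/
def advE (e : Expr) : Expr := cell 8 (e + reg 8)

/-- The boarding position of the base-path with number `e`. -/
def posE (e : Expr) : Expr := cell 9 e
/-- The vertex at position `j` of the base-path with number `e`. -/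
def vertE (e j : Expr) : Expr := cell 0 (cell 3 e + j)
/-- The label of edge `j` of the base-path with number `e`. -/
def labE (e j : Expr) : Expr := cell 0 (cell 4 e + j)

end MaxReachInstance

/-! ### Programs that check consistency -/

namespace MaxReachInstance

open KPathGraph Ram Ram.Prog Ram.Expr

variable {I : MaxReachInstance}

/-- The boarding positions `p` are stored. -/
def HasPos (p : Fin I.k → ℕ) (σ : Store) : Prop := ∀ c : Fin I.k, σ.mem 9 (c : ℕ) = p c

theorem HasPos.frame {p : Fin I.k → ℕ} {σ τ : Store} {q : Prog} (h : HasPos p σ)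
    (hF : Frame q σ τ) (hs : Safe q 10 10 = true) : HasPos p τ := fun c => by
  rw [Safe.mem hs hF (by norm_num) (by norm_num), h c]

section Eval

variable {kind : ShiftKind} {σ : Store} {g : Plan I.k} {p : Fin I.k → ℕ} {e : Expr} {c : Fin I.k}

theorem eval_parE (hg : HasPlan g σ) (he : e.eval σ = (c : ℕ)) :
    (parE e).eval σ = (g.par c : ℕ) := by
  simp [parE, he, hg.par]

theorem eval_tyE (hE : I.Env kind σ) (hg : HasPlan g σ) (he : e.eval σ = (c : ℕ)) :
    (tyE e).eval σ = g.ty c := by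
  simp [tyE, he, hg.ty, hE.r1]

theorem eval_dlE (hE : I.Env kind σ) (hg : HasPlan g σ) (he : e.eval σ = (c : ℕ)) :
    (dlE e).eval σ = g.dl c := by
  simp [dlE, he, hg.dl, hE.r4]

theorem eval_drE (hE : I.Env kind σ) (hg : HasPlan g σ) (he : e.eval σ = (c : ℕ)) :
    (drE e).eval σ = g.dr c := by
  simp [drE, he, hg.dr, hE.r5]

theorem eval_needE (hE : I.Env kind σ) (hg : HasPlan g σ) (he : e.eval σ = (c : ℕ)) :
    (needE e).eval σ = g.need c := by
  simp [needE, he, hg.need, hE.r6]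

theorem eval_advE (hE : I.Env kind σ) (hg : HasPlan g σ) (he : e.eval σ = (c : ℕ)) :
    (advE e).eval σ = g.adv c := by
  simp [advE, he, hg.adv, hE.r8]

theorem eval_posE (hp : HasPos p σ) (he : e.eval σ = (c : ℕ)) : (posE e).eval σ = p c := by
  simp [posE, he, hp c]

theorem eval_vertE (hE : I.Env kind σ) (he : e.eval σ = (c : ℕ)) {f : Expr} {j : ℕ}
    (hf : f.eval σ = j) (hj : j < I.graph.len c + 1) : (vertE e f).eval σ = I.graph.vtx c j := by
  simp [vertE, he, hf, hE.vert c j hj]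

end Eval

/-- Computes, for the base-path in register `24`, its host, the edge before its boarding vertex, its
boarding label, the label of that edge, and the level of the boarding edge of the host. -/
def prepareCheck : Prog :=
  seq (assign 28 (parE (reg 24))) <|
  seq (ifLe (const 4) (tyE (reg 24)) (assign 28 (parE (reg 28))) skip) <|
  seq (assign 29 (cell 6 (cell 5 (reg 28) + vertE (reg 24) (posE (reg 24))) - const 2)) <|
  seq (write 10 (reg 24) (reg 29)) <|
  seq (assign 27 (labE (reg 24) (posE (reg 24)) + dlE (reg 24) - drE (reg 24))) <|
  seq (assign 30 (labE (reg 28) (reg 29)))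
    (assign 31 (labE (reg 28) (posE (reg 28)) - posE (reg 28)))

/-- Sets register `25` to the number in register `24` if the boarding position of that base-path is
not consistent with the plan. -/
def checkLocal : Prog :=
  ifLe (tyE (reg 24)) (const 0) skip <|
  ifLe (tyE (reg 24)) (const 1)
    (guards 25 (reg 24) [(vertE (reg 24) (posE (reg 24)) + const 1, reg 3),
      (reg 3 + const 1, vertE (reg 24) (posE (reg 24)))]) <|
  seq prepareCheck <|
  ifLe (tyE (reg 24)) (const 2)
    (guards 25 (reg 24) [(tyE (reg 28), const 0), (reg 29 + const 1, posE (reg 28)),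
      (reg 27, reg 30), (reg 27, reg 31 + dlE (reg 28) + reg 29)]) <|
  ifLe (tyE (reg 24)) (const 3)
    (guards 25 (reg 24) [(tyE (reg 28), const 0), (reg 29 + const 1, posE (reg 28)),
      (reg 30 + const 2, reg 27 + needE (reg 24)), (reg 27 + needE (reg 24), reg 30),
      (reg 30 - reg 29 + const 1, reg 31 + dlE (reg 28) - drE (reg 28) + advE (reg 24)),
      (reg 30 - reg 29 + const 1, reg 31 + dlE (reg 28)),
      (advE (reg 24) + const 1, needE (reg 24))])
    (guards 25 (reg 24) [(tyE (reg 28), const 0), (reg 29 + const 1, posE (reg 28)),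
      (reg 30 + const 2, reg 27 + needE (reg 24)), (reg 27 + needE (reg 24), reg 30),
      (reg 30 - reg 29 + const 1, reg 31 + dlE (reg 28) - drE (reg 28) + advE (reg 24)),
      (reg 30 - reg 29 + const 1, reg 31 + dlE (reg 28)),
      (tyE (parE (reg 24)), const 2), (const 4, tyE (parE (reg 24)))])

section

variable {kind : ShiftKind} {σ : Store} {g : Plan I.k} {p : Fin I.k → ℕ} {c : Fin I.k}

/-- The last two registers carry conditional claims, since their cells are read even when the index
is out of range and the value is meaningless. -/
theorem prepareCheck_spec (hE : I.Env kind σ) (hg : HasPlan g σ) (hp : HasPos p σ)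
    (hc : σ.reg 24 = (c : ℕ)) (hlt : p c < I.graph.len c) :
    Frame prepareCheck σ (prepareCheck.exec σ) ∧
    (prepareCheck.exec σ).reg 28 = (g.host c : ℕ) ∧
    (prepareCheck.exec σ).reg 29 = I.graph.alight g p c ∧
    (prepareCheck.exec σ).mem 10 =
      Function.update (σ.mem 10) (c : ℕ) (I.graph.alight g p c) ∧
    (prepareCheck.exec σ).reg 27 = I.graph.blab g p c ∧
    (0 ≤ I.graph.alight g p c → I.graph.alight g p c < I.graph.len (g.host c) →
      (prepareCheck.exec σ).reg 30 = I.graph.lab (g.host c) (I.graph.alight g p c)) ∧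
    (p (g.host c) < I.graph.len (g.host c) → (prepareCheck.exec σ).reg 31 =
      I.graph.lab (g.host c) (p (g.host c)) - p (g.host c)) := by
  have hF : Frame prepareCheck σ (prepareCheck.exec σ) := frame_exec rfl σ
  have hV := I.graph.vtx_of_lt (i := c) (j := p c) (by omega)
  have key : ∀ q : Fin I.k, σ.mem 6 (σ.mem 5 (q : ℕ) + I.graph.vtx c (p c)) - 2 =
      I.graph.posn q (I.graph.vtx c (p c)) - 2 := by
    intro q
    rw [hV, hE.posn]
  have hv := hE.vert c (p c) (by omega)
  have hl := hE.label c (p c) (by omega) (by omega)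
  have hb : I.graph.blab g p c = I.graph.lab c (p c) + g.dl c - g.dr c := by
    simp only [blab, Plan.shift]
    ring
  refine ⟨hF, ?_⟩
  by_cases h4 : 4 ≤ g.ty c
  · have h4' : (4 : ℤ) ≤ g.ty c := by exact_mod_cast h4
    have hh : g.host c = g.par (g.par c) := if_pos h4
    have hal : I.graph.alight g p c = I.graph.posn (g.par (g.par c)) (I.graph.vtx c (p c)) - 2 := by
      rw [alight, hh]
    rw [hh, hal, hb]
    simp [prepareCheck, exec, parE, tyE, dlE, drE, posE, vertE, labE, hc, hg.par, hg.ty, hg.dl,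
      hg.dr, hE.r1, hE.r4, hE.r5, h4', hp _, hv, hl, key]
    refine ⟨fun h1 h2 => hE.label _ _ (by omega) h2, fun h1 => hE.label _ _ (by omega) (by omega)⟩
  · have h4' : ¬ (4 : ℤ) ≤ g.ty c := by exact_mod_cast h4
    have hh : g.host c = g.par c := if_neg h4
    have hal : I.graph.alight g p c = I.graph.posn (g.par c) (I.graph.vtx c (p c)) - 2 := by
      rw [alight, hh]
    rw [hh, hal, hb]
    simp [prepareCheck, exec, parE, tyE, dlE, drE, posE, vertE, labE, hc, hg.par, hg.ty, hg.dl,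
      hg.dr, hE.r1, hE.r4, hE.r5, h4', hp _, hv, hl, key]
    refine ⟨fun h1 h2 => hE.label _ _ (by omega) h2, fun h1 => hE.label _ _ (by omega) (by omega)⟩

end

end MaxReachInstance

namespace MaxReachInstance

open KPathGraph Ram Ram.Prog Ram.Expr

variable {I : MaxReachInstance}

section

variable {kind : ShiftKind} {σ : Store} {g : Plan I.k} {p : Fin I.k → ℕ} {c : Fin I.k}

/-- Meaningless reads do no harm. If the conditions hold then all indices are in range and no guard
fires. If no guard fires then the first two guards show that the indices are in range, so the other
guards have compared the right values. -/
theorem checkLocal_spec (hE : I.Env kind σ) (hg : HasPlan g σ) (hp : HasPos p σ)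
    (hr : I.graph.InRange g p) (hc : σ.reg 24 = (c : ℕ)) (hd : σ.reg 25 = -1) :
    (((checkLocal.exec σ).reg 25 = -1 ∧ (g.ty c ≠ 0 → I.graph.LocalOK I.source g p c) ∧
      (2 ≤ g.ty c → (checkLocal.exec σ).mem 10 (c : ℕ) = I.graph.alight g p c)) ∨
      ((checkLocal.exec σ).reg 25 = (c : ℕ) ∧ g.ty c ≠ 0 ∧ ¬ I.graph.LocalOK I.source g p c)) ∧
    ∀ x, x ≠ ((c : ℕ) : ℤ) → (checkLocal.exec σ).mem 10 x = σ.mem 10 x := by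
  have ety := eval_tyE (e := reg 24) hE hg hc
  have epos := eval_posE (e := reg 24) hp hc
  rw [checkLocal, Prog.exec]
  by_cases h0 : g.ty c = 0
  · rw [if_pos (by rw [ety, h0]; simp)]
    simp [exec, hd, h0]
  have hlt := hr c h0
  rw [if_neg (by rw [ety, eval_const]; omega), Prog.exec]
  by_cases h1 : g.ty c = 1
  · rw [if_pos (by rw [ety, h1]; simp)]
    have ev := eval_vertE (e := reg 24) hE hc epos (by omega)
    rcases exec_guards 25 (reg 24) [(vertE (reg 24) (posE (reg 24)) + const 1, reg 3),
      (reg 3 + const 1, vertE (reg 24) (posE (reg 24)))] σ with ⟨hex, he⟩ | ⟨hall, he⟩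
    · rw [he]
      refine ⟨.inr ⟨by simp [hc], h0, fun hl => ?_⟩, by simp⟩
      have := hl.root h1
      simp [ev, hE.r3] at hex
      omega
    · rw [he]
      refine ⟨.inl ⟨hd, fun _ => ?_, by omega⟩, by simp⟩
      simp [ev, hE.r3] at hall
      refine ⟨fun _ => by omega, ?_, ?_, ?_, ?_, ?_⟩ <;> intro <;> omega
  rw [if_neg (by rw [ety, eval_const]; omega), Prog.exec]
  obtain ⟨hF, hq, ha, hm10, hlc, hlm, hpq⟩ := prepareCheck_spec hE hg hp hc hlt
  generalize prepareCheck.exec σ = τ at *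
  have hE' := hE.frame hF rfl
  have hg' := hg.frame hF rfl
  have hp' := hp.frame hF rfl
  have hc' : τ.reg 24 = (c : ℕ) := by rw [hF.1 24 (by decide), hc]
  have hd' : τ.reg 25 = -1 := by rw [hF.1 25 (by decide), hd]
  have ety := eval_tyE (e := reg 24) hE' hg' hc'
  have etyq := eval_tyE (e := reg 28) hE' hg' hq
  have eposq := eval_posE (e := reg 28) hp' hq
  have edlq := eval_dlE (e := reg 28) hE' hg' hq
  have edrq := eval_drE (e := reg 28) hE' hg' hq
  have eneed := eval_needE (e := reg 24) hE' hg' hc'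
  have eadv := eval_advE (e := reg 24) hE' hg' hc'
  have etyp := eval_tyE (e := parE (reg 24)) hE' hg' (eval_parE hg' hc')
  have hset : ∀ x, x ≠ ((c : ℕ) : ℤ) → τ.mem 10 x = σ.mem 10 x := by
    intro x hx
    rw [hm10, Function.update_of_ne hx]
  have hself : τ.mem 10 (c : ℕ) = I.graph.alight g p c := by rw [hm10, Function.update_self]
  have hsh : g.shift (g.host c) = g.dl (g.host c) - g.dr (g.host c) := rfl
  have hlmpq : g.ty (g.host c) ≠ 0 → (p (g.host c) : ℤ) ≤ I.graph.alight g p c →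
      τ.reg 30 = I.graph.lab (g.host c) (I.graph.alight g p c) ∧
      τ.reg 31 = I.graph.lab (g.host c) (p (g.host c)) - p (g.host c) := fun h1 h2 =>
    ⟨hlm (by omega) (alight_lt_len (by omega)).1, hpq (hr _ h1)⟩
  rw [Prog.exec]
  by_cases h2 : g.ty c = 2
  · rw [if_pos (by rw [ety, h2]; simp)]
    rcases exec_guards 25 (reg 24) [(tyE (reg 28), const 0), (reg 29 + const 1, posE (reg 28)),
      (reg 27, reg 30), (reg 27, reg 31 + dlE (reg 28) + reg 29)] τ with ⟨hex, he⟩ | ⟨hall, he⟩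
    · rw [he]
      refine ⟨.inr ⟨by simp [hc'], h0, fun hl => ?_⟩, by simpa using hset⟩
      have hh := hl.host h2.ge
      have hf := hl.free h2
      obtain ⟨e1, e2⟩ := hlmpq hh.1 hh.2
      simp only [List.mem_cons, List.not_mem_nil, or_false, exists_eq_or_imp, exists_eq_left,
        etyq, eposq, edlq, eval_reg, eval_add, eval_const, ha, hlc, e1, e2] at hex
      omega
    · rw [he]
      simp only [List.forall_mem_cons, List.not_mem_nil, false_imp_iff, implies_true, and_true,
        etyq, eposq, edlq, eval_reg, eval_add, eval_const, ha, hlc] at hall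
      obtain ⟨e1, e2⟩ := hlmpq (by omega) (by omega)
      rw [e1, e2] at hall
      refine ⟨.inl ⟨hd', fun _ => ⟨fun _ => by omega, fun _ => ⟨by omega, by omega⟩,
        fun _ => ⟨by omega, by omega⟩, fun _ => by omega, fun _ => by omega, fun _ => by omega⟩,
        fun _ => hself⟩, hset⟩
  rw [if_neg (by rw [ety, eval_const]; omega), Prog.exec]
  by_cases h3 : g.ty c = 3
  · rw [if_pos (by rw [ety, h3]; simp)]
    rcases exec_guards 25 (reg 24) [(tyE (reg 28), const 0), (reg 29 + const 1, posE (reg 28)),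
      (reg 30 + const 2, reg 27 + needE (reg 24)), (reg 27 + needE (reg 24), reg 30),
      (reg 30 - reg 29 + const 1, reg 31 + dlE (reg 28) - drE (reg 28) + advE (reg 24)),
      (reg 30 - reg 29 + const 1, reg 31 + dlE (reg 28)),
      (advE (reg 24) + const 1, needE (reg 24))] τ with ⟨hex, he⟩ | ⟨hall, he⟩
    · rw [he]
      refine ⟨.inr ⟨by simp [hc'], h0, fun hl => ?_⟩, by simpa using hset⟩
      have hh := hl.host (by omega)
      have hf := hl.tight (by omega)
      have hle := hl.leader h3
      obtain ⟨e1, e2⟩ := hlmpq hh.1 hh.2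
      simp only [List.mem_cons, List.not_mem_nil, or_false, exists_eq_or_imp, exists_eq_left,
        etyq, eposq, edlq, edrq, eneed, eadv, eval_reg, eval_add, eval_sub, eval_const, ha, hlc, e1,
        e2] at hex
      omega
    · rw [he]
      simp only [List.forall_mem_cons, List.not_mem_nil, false_imp_iff, implies_true, and_true,
        etyq, eposq, edlq, edrq, eneed, eadv, eval_reg, eval_add, eval_sub, eval_const, ha,
        hlc] at hall
      obtain ⟨e1, e2⟩ := hlmpq (by omega) (by omega)
      rw [e1, e2] at hall
      refine ⟨.inl ⟨hd', fun _ => ⟨fun _ => by omega, fun _ => ⟨by omega, by omega⟩,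
        fun _ => by omega, fun _ => ⟨by omega, by omega, by omega⟩, fun _ => by omega,
        fun _ => by omega⟩, fun _ => hself⟩, hset⟩
  · rw [if_neg (by rw [ety, eval_const]; omega)]
    rcases exec_guards 25 (reg 24) [(tyE (reg 28), const 0), (reg 29 + const 1, posE (reg 28)),
      (reg 30 + const 2, reg 27 + needE (reg 24)), (reg 27 + needE (reg 24), reg 30),
      (reg 30 - reg 29 + const 1, reg 31 + dlE (reg 28) - drE (reg 28) + advE (reg 24)),
      (reg 30 - reg 29 + const 1, reg 31 + dlE (reg 28)),
      (tyE (parE (reg 24)), const 2), (const 4, tyE (parE (reg 24)))] τ with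
      ⟨hex, he⟩ | ⟨hall, he⟩
    · rw [he]
      refine ⟨.inr ⟨by simp [hc'], h0, fun hl => ?_⟩, by simpa using hset⟩
      have hh := hl.host (by omega)
      have hf := hl.tight (by omega)
      have hle := hl.member (by omega)
      obtain ⟨e1, e2⟩ := hlmpq hh.1 hh.2
      simp only [List.mem_cons, List.not_mem_nil, or_false, exists_eq_or_imp, exists_eq_left,
        etyq, eposq, edlq, edrq, eneed, eadv, etyp, eval_reg, eval_add, eval_sub, eval_const, ha,
        hlc, e1, e2] at hex
      omega
    · rw [he]
      simp only [List.forall_mem_cons, List.not_mem_nil, false_imp_iff, implies_true, and_true,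
        etyq, eposq, edlq, edrq, eneed, eadv, etyp, eval_reg, eval_add, eval_sub, eval_const, ha,
        hlc] at hall
      obtain ⟨e1, e2⟩ := hlmpq (by omega) (by omega)
      rw [e1, e2] at hall
      refine ⟨.inl ⟨hd', fun _ => ⟨fun _ => by omega, fun _ => ⟨by omega, by omega⟩,
        fun _ => by omega, fun _ => ⟨by omega, by omega, by omega⟩, fun _ => by omega,
        fun _ => by omega⟩, fun _ => hself⟩, hset⟩

end

/-- For the base-path `c` whose number plus `k` is in register `24`: sets register `25` to the
number of a base-path with too small a boarding position if the link of `c` is not consistent with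
the plan. -/
def checkLink : Prog :=
  seq (assign 35 (reg 24 - reg 1)) <|
  ifLe (const 4) (tyE (reg 35))
    (seq (assign 32 (parE (reg 35))) <|
    seq (assign 28 (parE (reg 32))) <|
    seq (assign 33 (labE (reg 28) (cell 10 (reg 32)) - cell 10 (reg 32))) <|
    seq (assign 34 (labE (reg 28) (cell 10 (reg 35)) - cell 10 (reg 35))) <|
    ifLe (cell 10 (reg 32) + const 1) (cell 10 (reg 35)) (assign 25 (reg 32)) <|
    ifLe (reg 33 - reg 34 + const 1) (gapE (reg 35)) (assign 25 (reg 32)) <|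
    guards 25 (reg 35) [(gapE (reg 35) + const 1, reg 33 - reg 34),
      (advE (reg 32) + const 1, needE (reg 35) + gapE (reg 35))])
    skip

/-- The branch taken tells which position is too small. If the leader's entering edge comes too
early or the gap is too small, it is the leader's; otherwise it is the member's. The local
conditions must already hold everywhere, both for valid indices and for monotonicity. -/
theorem checkLink_spec {kind : ShiftKind} {σ : Store} {g : Plan I.k} {p : Fin I.k → ℕ}
    {c : Fin I.k} (hE : I.Env kind σ) (hg : HasPlan g σ)
    (hloc : ∀ c, g.ty c ≠ 0 → I.graph.LocalOK I.source g p c)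
    (hal : ∀ c : Fin I.k, 2 ≤ g.ty c → σ.mem 10 (c : ℕ) = I.graph.alight g p c)
    (hc : σ.reg 24 = (c : ℕ) + I.k) (hd : σ.reg 25 = -1) :
    ((checkLink.exec σ).reg 25 = -1 ∧ (4 ≤ g.ty c → I.graph.LinkOK g p c)) ∨
    (∃ d : Fin I.k, (checkLink.exec σ).reg 25 = (d : ℕ) ∧ g.ty d ≠ 0 ∧
      ∀ q, p ≤ q → I.graph.Consistent I.source g q → p d + 1 ≤ q d) := by
  by_cases h4 : 4 ≤ g.ty c
  swap
  · have h4' : ¬ (4 : ℤ) ≤ g.ty c := by exact_mod_cast h4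
    left
    simp [checkLink, exec, hc, hE.r1, tyE, hg.ty, h4', hd, h4]
  have h4' : (4 : ℤ) ≤ g.ty c := by exact_mod_cast h4
  have hl := hloc c (by omega)
  have hm := hl.member h4
  have hl' := hloc (g.par c) (by omega)
  have hh : g.host c = g.par (g.par c) := if_pos h4
  have hh' : g.host (g.par c) = g.par (g.par c) := if_neg (by omega)
  have ha1 := alight_lt_len (hl.alight_nonneg (by omega))
  have ha2 := alight_lt_len (hl'.alight_nonneg (by omega))
  have e1 := hE.label (g.par (g.par c)) (I.graph.alight g p c) (hl.alight_nonneg (by omega))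
    (by rw [← hh]; exact ha1.1)
  have e2 := hE.label (g.par (g.par c)) (I.graph.alight g p (g.par c))
    (hl'.alight_nonneg (by omega)) (by rw [← hh']; exact ha2.1)
  have hs1 : I.graph.slack g p c =
    I.graph.lab (g.par (g.par c)) (I.graph.alight g p c) - I.graph.alight g p c := by
    rw [slack, hh]
  have hs2 : I.graph.slack g p (g.par c) = I.graph.lab (g.par (g.par c))
      (I.graph.alight g p (g.par c)) - I.graph.alight g p (g.par c) := by
    rw [slack, hh']
  have key : (checkLink.exec σ).reg 25 =
      if I.graph.alight g p (g.par c) + 1 ≤ I.graph.alight g p c then ((g.par c : ℕ) : ℤ) else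
      if I.graph.slack g p (g.par c) - I.graph.slack g p c + 1 ≤ g.gap c then ((g.par c : ℕ) : ℤ)
      else if (g.gap c : ℤ) + 1 ≤ I.graph.slack g p (g.par c) - I.graph.slack g p c then
        ((c : ℕ) : ℤ) else if (g.adv (g.par c) : ℤ) + 1 ≤ g.need c + g.gap c then ((c : ℕ) : ℤ)
      else -1 := by
    rw [hs1, hs2]
    simp [checkLink, exec, guards, hc, hE.r1, hE.r6, hE.r7, hE.r8, tyE, parE, labE, gapE, needE,
      advE, hg.ty, hg.par, hg.gap, hg.need, hg.adv, h4', hal c (by omega),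
      hal (g.par c) (by omega), e1, e2]
    split_ifs <;> simp [hd]
  rw [key]
  split_ifs with h5 h6 h7 h8
  · exact .inr ⟨g.par c, rfl, by omega, fun q hq hcon =>
      LinkOK.bump_leader hl hl' h4 hq hcon (.inl (by omega))⟩
  · exact .inr ⟨g.par c, rfl, by omega, fun q hq hcon =>
      LinkOK.bump_leader hl hl' h4 hq hcon (.inr (by omega))⟩
  · exact .inr ⟨c, rfl, by omega, fun q hq hcon =>
      LinkOK.bump_member hl hl' h4 hq hcon (.inl (by omega))⟩
  · exact .inr ⟨c, rfl, by omega, fun q hq hcon =>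
      LinkOK.bump_member hl hl' h4 hq hcon (.inr (by omega))⟩
  · exact .inl ⟨rfl, fun _ => ⟨by omega, by omega, by omega⟩⟩

end MaxReachInstance

/-! ### The iteration towards the least consistent positions -/

namespace MaxReachInstance

open KPathGraph Ram Ram.Prog Ram.Expr

variable {I : MaxReachInstance}

/-- One consistency check, with a restart of the checks if a boarding position is increased. -/
def fixStep : Prog :=
  seq (assign 25 (const (-1))) <|
  seq (ifLe (reg 24 + const 1) (reg 1) checkLocal checkLink) <|
  ifLe (const 0) (reg 25)
    (seq (write 9 (reg 25) (cell 9 (reg 25) + const 1)) <|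
      ifLe (cell 2 (reg 25)) (cell 9 (reg 25))
        (seq (assign 22 (const 1)) (assign 24 (reg 4))) (assign 24 (const 0)))
    (assign 24 (reg 24 + const 1))

/-- What holds before the check number `t`. -/
structure FixInv (g : Plan I.k) (p : Fin I.k → ℕ) (t : ℕ) (σ : Store) : Prop where
  pos : HasPos p σ
  r24 : σ.reg 24 = t
  le : t ≤ 2 * I.k
  least : ∀ q, I.graph.Consistent I.source g q → p ≤ q
  state : (σ.reg 22 = 0 ∧ I.graph.InRange g p ∧
    (∀ c : Fin I.k, (c : ℕ) < t → (g.ty c ≠ 0 → I.graph.LocalOK I.source g p c) ∧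
      (2 ≤ g.ty c → σ.mem 10 (c : ℕ) = I.graph.alight g p c)) ∧
    ∀ c : Fin I.k, (c : ℕ) + I.k < t → 4 ≤ g.ty c → I.graph.LinkOK g p c) ∨
    (σ.reg 22 = 1 ∧ t = 2 * I.k ∧ ∀ q, ¬ I.graph.Consistent I.source g q)

/-- The number of possible increases of boarding positions, and of checks before the next one. -/
def fixVariant (I : MaxReachInstance) (σ : Store) : ℕ :=
  (2 * I.k + 1) * (∑ c : Fin I.k, (I.graph.len c - σ.mem 9 (c : ℕ)).toNat) +
    (2 * I.k - σ.reg 24).toNat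

theorem fixVariant_eq {p : Fin I.k → ℕ} {t : ℕ} {σ : Store} (hp : HasPos p σ)
    (ht : σ.reg 24 = t) : fixVariant I σ =
      (2 * I.k + 1) * (∑ c : Fin I.k, (I.graph.len c - p c)) + (2 * I.k - t) := by
  unfold fixVariant
  congr 1
  · congr 1
    refine Finset.sum_congr rfl fun c _ => ?_
    rw [hp c]
    omega
  · omega

/-- An increase lowers the first sum of the variant by 1. The factor `2 * I.k + 1` outweighs the at
most `2 * I.k` checks that the restart adds. The invariant survives, because the increase is forced
in every consistent choice. -/
theorem fixStep_spec {kind : ShiftKind} {σ : Store} {g : Plan I.k} {p : Fin I.k → ℕ} {t : ℕ}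
    (hE : I.Env kind σ) (hg : HasPlan g σ) (hI : FixInv g p t σ) (ht : t < 2 * I.k) :
    Wp fixStep σ fixStep.bound fun τ =>
      (∃ p' t', FixInv g p' t' τ) ∧ fixVariant I τ < fixVariant I σ := by
  obtain ⟨hp, hr24, hle, hleast, hst⟩ := hI
  obtain ⟨hbad, hr, hloc, hlink⟩ := hst.resolve_right (by rintro ⟨-, h, -⟩; omega)
  have hV := fixVariant_eq hp hr24
  refine Wp.exec rfl le_rfl fun hF0 => ?_
  rw [fixStep, exec_seq, exec_seq]
  set σ₁ := (assign 25 (const (-1))).exec σ with hσ₁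
  have hF1 : Frame (assign 25 (const (-1))) σ σ₁ := frame_exec rfl σ
  have hE1 := hE.frame hF1 rfl
  have hg1 := hg.frame hF1 rfl
  have hp1 := hp.frame hF1 rfl
  have h24 : σ₁.reg 24 = t := by rw [hF1.1 24 (by decide), hr24]
  have h25 : σ₁.reg 25 = -1 := by simp [hσ₁, exec]
  have h10 : σ₁.mem 10 = σ.mem 10 := rfl
  set σ₂ := (ifLe (reg 24 + const 1) (reg 1) checkLocal checkLink).exec σ₁ with hσ₂
  have hF2 : Frame (ifLe (reg 24 + const 1) (reg 1) checkLocal checkLink) σ₁ σ₂ :=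
    frame_exec rfl σ₁
  have hE2 := hE1.frame hF2 rfl
  have hp2 := hp1.frame hF2 rfl
  have h24' : σ₂.reg 24 = t := by rw [hF2.1 24 (by decide), h24]
  have h22' : σ₂.reg 22 = 0 := by rw [hF2.1 22 (by decide), hF1.1 22 (by decide), hbad]
  have main : (σ₂.reg 25 = -1 ∧
      (∀ c : Fin I.k, (c : ℕ) < t + 1 → (g.ty c ≠ 0 → I.graph.LocalOK I.source g p c) ∧
        (2 ≤ g.ty c → σ₂.mem 10 (c : ℕ) = I.graph.alight g p c)) ∧
      ∀ c : Fin I.k, (c : ℕ) + I.k < t + 1 → 4 ≤ g.ty c → I.graph.LinkOK g p c) ∨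
    (∃ d : Fin I.k, σ₂.reg 25 = (d : ℕ) ∧ g.ty d ≠ 0 ∧
      ∀ q, p ≤ q → I.graph.Consistent I.source g q → p d + 1 ≤ q d) := by
    rw [hσ₂, exec_ifLe]
    -- The first k checks are local ones. Check number t at least k concerns the link of base-path t
    -- - k, when all local conditions are known to hold.
    by_cases htk : t < I.k
    · rw [if_pos (by simp [h24, hE1.r1]; omega)]
      obtain ⟨hcase, hother⟩ := checkLocal_spec (c := ⟨t, htk⟩) hE1 hg1 hp1 hr h24 h25
      rcases hcase with ⟨e1, e2, e3⟩ | ⟨e1, e2, e3⟩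
      · refine .inl ⟨e1, fun c hc => ?_, fun c hc => by omega⟩
        by_cases hct : c = ⟨t, htk⟩
        · subst hct
          exact ⟨e2, e3⟩
        · have hct' : (c : ℕ) ≠ t := fun h => hct (Fin.ext h)
          have := hloc c (by omega)
          exact ⟨this.1, fun h => by rw [hother _ (by simpa using hct'), h10, this.2 h]⟩
      · exact .inr ⟨_, e1, e2, fun q hq hcon => LocalOK.bump e3 hq e2 hcon⟩
    · rw [if_neg (by simp [h24, hE1.r1]; omega)]
      have hkt : t - I.k < I.k := by omega
      have hm10 : (checkLink.exec σ₁).mem 10 = σ₁.mem 10 :=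
        (frame_exec rfl σ₁).2 10 (by decide)
      rcases checkLink_spec (c := ⟨t - I.k, hkt⟩) (p := p) hE1 hg1 (fun c => (hloc c (by omega)).1)
        (fun c => (hloc c (by omega)).2) (by rw [h24]; simp; omega) h25 with ⟨e1, e2⟩ | h
      · refine .inl ⟨e1, fun c hc => ?_, fun c hc => ?_⟩
        · rw [hm10]
          exact hloc c (by omega)
        · by_cases hct : (c : ℕ) + I.k < t
          · exact hlink c hct
          · obtain rfl : c = ⟨t - I.k, hkt⟩ := Fin.ext (by simp; omega)
            exact e2
      · exact .inr h
  clear_value σ₂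
  rw [exec_ifLe]
  rcases main with ⟨e1, e2, e3⟩ | ⟨d, e1, e2, e3⟩
  · rw [if_neg (by simp [e1])]
    have hpos : HasPos p ((assign 24 (reg 24 + const 1)).exec σ₂) := hp2
    have h24'' : ((assign 24 (reg 24 + const 1)).exec σ₂).reg 24 = ((t + 1 : ℕ) : ℤ) := by
      simp [exec, h24']
    refine ⟨⟨p, t + 1, hpos, h24'', by omega, hleast, .inl ⟨?_, hr, e2, e3⟩⟩, ?_⟩
    · simp [exec, h22']
    · rw [hV, fixVariant_eq hpos h24'']
      omega
  · rw [if_pos (by simp [e1]), exec_seq]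
    have hlt := hr d e2
    set σ₃ := (write 9 (reg 25) (cell 9 (reg 25) + const 1)).exec σ₂ with hσ₃
    have h9 : σ₃.mem 9 = Function.update (σ₂.mem 9) (d : ℕ) (p d + 1) := by
      simp [hσ₃, exec, e1, hp2 d]
    have hp3 : HasPos (Function.update p d (p d + 1)) σ₃ := by
      intro c
      rw [h9]
      by_cases hcd : c = d
      · subst hcd
        simp
      · rw [Function.update_of_ne (by simpa [Fin.ext_iff] using hcd), hp2 c,
          Function.update_of_ne hcd]
    have hsum : ∑ c, (I.graph.len c - Function.update p d (p d + 1) c) + 1 =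
        ∑ c, (I.graph.len c - p c) := by
      rw [← Finset.add_sum_erase Finset.univ _ (Finset.mem_univ d),
        ← Finset.add_sum_erase Finset.univ (fun c => I.graph.len c - p c) (Finset.mem_univ d)]
      have : ∑ c ∈ Finset.univ.erase d, (I.graph.len c - Function.update p d (p d + 1) c) =
          ∑ c ∈ Finset.univ.erase d, (I.graph.len c - p c) := by
        refine Finset.sum_congr rfl fun c hc => ?_
        rw [Function.update_of_ne (Finset.ne_of_mem_erase hc)]
      rw [this, Function.update_self]
      omega
    have hleast' : ∀ q, I.graph.Consistent I.source g q → Function.update p d (p d + 1) ≤ q := by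
      intro q hq c
      by_cases hcd : c = d
      · subst hcd
        rw [Function.update_self]
        exact e3 q (hleast q hq) hq
      · rw [Function.update_of_ne hcd]
        exact hleast q hq c
    have hvar : ∀ t', (2 * I.k + 1) * (∑ c, (I.graph.len c - Function.update p d (p d + 1) c)) +
        (2 * I.k - t') < fixVariant I σ := by
      intro t'
      rw [hV, ← hsum, mul_add]
      omega
    rw [exec_ifLe]
    have hcond : (cell 2 (reg 25)).eval σ₃ = I.graph.len d ∧
        (cell 9 (reg 25)).eval σ₃ = ((p d + 1 : ℕ) : ℤ) := by
      have h3 : σ₃.reg 25 = (d : ℕ) := by simp [hσ₃, exec, e1]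
      have h4 : σ₃.mem 2 = σ₂.mem 2 := by simp [hσ₃, exec]
      simp [h3, h4, h9, hE2.len]
    rw [hcond.1, hcond.2]
    split_ifs with hc
    · have h24'' : ((seq (assign 22 (const 1)) (assign 24 (reg 4))).exec σ₃).reg 24 =
          ((2 * I.k : ℕ) : ℤ) := by
        simp [exec, hσ₃, hE2.r4]
      refine ⟨⟨_, 2 * I.k, hp3, h24'', le_rfl, hleast', .inr ⟨?_, rfl, ?_⟩⟩, ?_⟩
      · simp [exec]
      -- Every consistent choice lies above the increased position, which has left the base-path; so
      -- there is none.
      · intro q hq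
        have h1 : p d + 1 ≤ q d := by simpa using hleast' q hq d
        have h2 := hq.lt d e2
        omega
      · have hp4 : HasPos (Function.update p d (p d + 1))
            ((seq (assign 22 (const 1)) (assign 24 (reg 4))).exec σ₃) := hp3
        rw [fixVariant_eq hp4 h24'']
        exact hvar _
    · have h24'' : ((assign 24 (const 0)).exec σ₃).reg 24 = ((0 : ℕ) : ℤ) := by simp [exec]
      refine ⟨⟨_, 0, hp3, h24'', by omega, hleast', .inl ⟨?_, ?_, ?_, ?_⟩⟩, ?_⟩
      · simp [exec, hσ₃, h22']
      · intro c hc'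
        by_cases hcd : c = d
        · subst hcd
          rw [Function.update_self]
          omega
        · rw [Function.update_of_ne hcd]
          exact hr c hc'
      · intro c hc'
        omega
      · intro c hc'
        omega
      · have hp4 : HasPos (Function.update p d (p d + 1))
            ((assign 24 (const 0)).exec σ₃) := hp3
        rw [fixVariant_eq hp4 h24'']
        exact hvar _

/-- Increases the boarding positions until they are consistent with the plan, or sets register `22`
to `1` if this is impossible. -/
def fixLoop : Prog := whileLe (reg 24 + const 1) (reg 4) fixStep

/-- A bound for the number of checks. -/
def fixBound (I : MaxReachInstance) : ℕ := (2 * I.k + 1) * (∑ c, I.graph.len c) + 2 * I.k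

theorem fixLoop_spec {kind : ShiftKind} {σ : Store} {g : Plan I.k} {p : Fin I.k → ℕ} {t : ℕ}
    (hE : I.Env kind σ) (hg : HasPlan g σ) (hI : FixInv g p t σ) :
    Wp fixLoop σ ((fixBound I + 1) * (fixStep.bound + 5)) fun τ =>
      (τ.reg 22 = 1 ∧ ∀ q, ¬ I.graph.Consistent I.source g q) ∨
      (τ.reg 22 = 0 ∧ ∃ p, HasPos p τ ∧ I.graph.Consistent I.source g p ∧
        (∀ q, I.graph.Consistent I.source g q → p ≤ q) ∧
        ∀ c : Fin I.k, 2 ≤ g.ty c → τ.mem 10 (c : ℕ) = I.graph.alight g p c) := by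
  have hB : fixVariant I σ ≤ fixBound I := by
    rw [fixVariant_eq hI.pos hI.r24]
    refine add_le_add (Nat.mul_le_mul_left _ (Finset.sum_le_sum fun c _ => ?_)) ?_ <;> omega
  refine (Wp.while_variant (B := fixStep.bound) (fun τ => ∃ p t, FixInv g p t τ) (fixVariant I)
    ⟨p, t, hI⟩ ?_).mono (Nat.mul_le_mul (by omega) (by simp [Expr.cost])) ?_
  · rintro τ hF ⟨p, t, hI⟩ hc
    have hE' := hE.frame hF rfl
    refine fixStep_spec hE' (hg.frame hF rfl) hI ?_
    simp [hI.r24, hE'.r4] at hc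
    omega
  · rintro τ hF ⟨⟨p, t, hI⟩, hc⟩
    have hE' := hE.frame hF rfl
    simp [hI.r24, hE'.r4] at hc
    have := hI.le
    rcases hI.state with ⟨h1, h2, h3, h4⟩ | ⟨h1, -, h3⟩
    · exact .inr ⟨h1, p, hI.pos, ⟨h2, fun c => (h3 c (by omega)).1, fun c => h4 c (by omega)⟩,
        hI.least, fun c => (h3 c (by omega)).2⟩
    · exact .inl ⟨h1, h3⟩

end MaxReachInstance

/-! ### Starting the search for positions -/

namespace MaxReachInstance

open KPathGraph Ram Ram.Prog Ram.Expr

variable {I : MaxReachInstance}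

theorem sum_range_dite {k : ℕ} (f : Fin k → ℕ) :
    ∑ x ∈ Finset.range k, (if h : x < k then f ⟨x, h⟩ else 0) = ∑ c, f c := by
  rw [Finset.sum_range]
  exact Finset.sum_congr rfl fun c _ => by simp

/-- One step of the initialization of the boarding positions. -/
def initStep : Prog :=
  seq (write 9 (reg 24) (const 0)) <|
  seq (ifLe (const 1) (tyE (reg 24)) (ifLe (cell 2 (reg 24)) (const 0) (assign 22 (const 1)) skip)
    skip) <|
  seq (assign 23 (reg 23 + dlE (reg 24) + advE (reg 24))) (assign 24 (reg 24 + const 1))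

/-- Sets all boarding positions to `0`.  Sets register `22` to `1` if the current plan cannot be
carried out for lack of an edge or of budget. -/
def initPos : Prog :=
  seq (seq (assign 22 (const 0)) <| seq (assign 23 (const 0)) (assign 24 (const 0))) <|
  seq (whileLe (reg 24 + const 1) (reg 1) initStep)
    (ifLe (reg 2 + const 1) (reg 23) (assign 22 (const 1)) skip)

/-- Searches the least boarding positions that are consistent with the current plan.  Sets register
`22` to `1` if there are none, or if the plan exceeds the budget. -/
def searchPos : Prog :=
  seq initPos (ifLe (reg 22) (const 0) (seq (assign 24 (const 0)) fixLoop) skip)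

variable {kind : ShiftKind} {σ : Store} {g : Plan I.k}

/-- The zero vector lies below every choice. It can be out of range only if a boarded base-path has
no edge, and then the plan is hopeless. -/
theorem initPos_spec (hE : I.Env kind σ) (hg : HasPlan g σ) :
    Wp initPos σ (6 + ((I.k + 1) * (initStep.bound + 5) + 8)) fun τ =>
      HasPos (fun _ : Fin I.k => 0) τ ∧
      ((τ.reg 22 = 0 ∧ I.graph.InRange g (fun _ => 0) ∧ ∑ c, (g.dl c + g.adv c) ≤ I.budget) ∨
      (τ.reg 22 = 1 ∧ ((∃ c, g.ty c ≠ 0 ∧ I.graph.len c = 0) ∨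
        I.budget < ∑ c, (g.dl c + g.adv c)))) := by
  let Inv : ℕ → Store → Prop := fun i τ => τ.reg 24 = i ∧
    (∀ c : Fin I.k, (c : ℕ) < i → τ.mem 9 (c : ℕ) = 0) ∧
    τ.reg 23 = ∑ x ∈ Finset.range i, (if h : x < I.k then g.dl ⟨x, h⟩ + g.adv ⟨x, h⟩ else 0 : ℕ) ∧
    ((τ.reg 22 = 0 ∧ ∀ c : Fin I.k, (c : ℕ) < i → g.ty c ≠ 0 → 0 < I.graph.len c) ∨
      (τ.reg 22 = 1 ∧ ∃ c, g.ty c ≠ 0 ∧ I.graph.len c = 0))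
  refine Wp.seq (Wp.exec (T := 6) rfl (by decide)
    (Q := fun τ => τ.reg 22 = 0 ∧ τ.reg 23 = 0 ∧ τ.reg 24 = 0) fun _ => by simp [exec]) ?_
  rintro σ₁ hF1 ⟨h22, h23, h24⟩
  have hE1 := hE.frame hF1 rfl
  have hg1 := hg.frame hF1 rfl
  refine Wp.seq (R := Inv I.k) ?_ ?_
  · refine (Wp.while_count (B := initStep.bound) I.k Inv ⟨by simp [h24], by simp, by simp [h23],
      .inl ⟨h22, by simp⟩⟩ ?_ ?_).mono (by simp [Expr.cost]) fun _ _ h => h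
    · rintro i τ hi hF ⟨h1, h2, h3, h4⟩
      have hE2 := hE1.frame hF rfl
      have hg2 := hg1.frame hF rfl
      refine ⟨by simp [h1, hE2.r1]; omega, Wp.exec rfl le_rfl fun _ => ?_⟩
      have hlen := hE2.len ⟨i, hi⟩
      have hty := hg2.ty ⟨i, hi⟩
      have hdl := hg2.dl ⟨i, hi⟩
      have hadv := hg2.adv ⟨i, hi⟩
      simp only at hlen hty hdl hadv
      have key : initStep.exec τ =
          ((if g.ty ⟨i, hi⟩ ≠ 0 ∧ I.graph.len ⟨i, hi⟩ = 0 then (τ.setMem 9 i 0).setReg 22 1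
            else τ.setMem 9 i 0).setReg 23 (τ.reg 23 + g.dl ⟨i, hi⟩ + g.adv ⟨i, hi⟩)).setReg 24
              (i + 1) := by
        by_cases ht : g.ty ⟨i, hi⟩ = 0
        · simp [initStep, exec, tyE, dlE, advE, h1, hE2.r1, hE2.r4, hE2.r8, hty, hdl, hadv, ht]
        · have ht' : (1 : ℤ) ≤ g.ty ⟨i, hi⟩ := by omega
          by_cases hl : I.graph.len ⟨i, hi⟩ = 0
          · simp [initStep, exec, tyE, dlE, advE, h1, hE2.r1, hE2.r4, hE2.r8, hty, hdl, hadv, ht,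
              ht', hlen, hl]
          · have hl' : ¬ (I.graph.len ⟨i, hi⟩ : ℤ) ≤ 0 := by omega
            simp [initStep, exec, tyE, dlE, advE, h1, hE2.r1, hE2.r4, hE2.r8, hty, hdl, hadv, ht,
              ht', hlen, hl]
      rw [key]
      refine ⟨by simp, ?_, ?_, ?_⟩
      · intro c hc
        have : ((if g.ty ⟨i, hi⟩ ≠ 0 ∧ I.graph.len ⟨i, hi⟩ = 0 then (τ.setMem 9 i 0).setReg 22 1
            else τ.setMem 9 i 0)).mem 9 = Function.update (τ.mem 9) i 0 := by
          split_ifs <;> simp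
        simp only [Store.setReg_mem, this]
        rcases Nat.lt_succ_iff_lt_or_eq.1 hc with hc | hc
        · rw [Function.update_of_ne (by omega), h2 c hc]
        · rw [hc, Function.update_self]
      · rw [Finset.sum_range_succ]
        simp [h3, hi]
        ring
      · split_ifs with hbad
        · exact .inr ⟨by simp, _, hbad⟩
        · rcases h4 with ⟨h4, h5⟩ | ⟨h4, h5⟩
          · refine .inl ⟨by simp [h4], fun c hc hn => ?_⟩
            rcases Nat.lt_succ_iff_lt_or_eq.1 hc with hc | hc
            · exact h5 c hc hn
            · obtain rfl : c = ⟨i, hi⟩ := Fin.ext hc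
              by_contra h0
              exact hbad ⟨hn, by omega⟩
          · exact .inr ⟨by simp [h4], h5⟩
    · rintro τ hF ⟨h1, -⟩
      simp [h1, (hE1.frame hF rfl).r1]
  · rintro σ₂ hF2 ⟨h1, h2, h3, h4⟩
    have hE2 := hE1.frame hF2 rfl
    rw [sum_range_dite (fun c => g.dl c + g.adv c)] at h3
    refine Wp.exec rfl (by decide) fun _ => ?_
    rw [exec_ifLe]
    have hcond : (reg 2 + const 1).eval σ₂ ≤ (reg 23).eval σ₂ ↔
        I.budget < ∑ c, (g.dl c + g.adv c) := by
      simp only [eval_add, eval_reg, eval_const, hE2.r2, h3]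
      omega
    simp only [hcond]
    split_ifs with hb
    · exact ⟨fun c => by simp [exec, h2 c c.2], .inr ⟨by simp [exec], .inr hb⟩⟩
    · refine ⟨fun c => by simp [exec, h2 c c.2], ?_⟩
      rcases h4 with ⟨h4, h5⟩ | ⟨h4, h5⟩
      · exact .inl ⟨h4, fun c hc => h5 c c.2 hc, not_lt.1 hb⟩
      · exact .inr ⟨h4, .inl h5⟩

/-- A bound for the time of `searchPos`. -/
def searchTime (I : MaxReachInstance) : ℕ :=
  6 + ((I.k + 1) * (initStep.bound + 5) + 8) +
    (3 + (2 + (fixBound I + 1) * (fixStep.bound + 5)))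

theorem searchPos_spec (hE : I.Env kind σ) (hg : HasPlan g σ) :
    Wp searchPos σ (searchTime I) fun τ =>
      (τ.reg 22 = 1 ∧ ((∀ q, ¬ I.graph.Consistent I.source g q) ∨
        I.budget < ∑ c, (g.dl c + g.adv c))) ∨
      (τ.reg 22 = 0 ∧ ∑ c, (g.dl c + g.adv c) ≤ I.budget ∧
        ∃ p, HasPos p τ ∧ I.graph.Consistent I.source g p ∧
        (∀ q, I.graph.Consistent I.source g q → p ≤ q) ∧
        ∀ c : Fin I.k, 2 ≤ g.ty c → τ.mem 10 (c : ℕ) = I.graph.alight g p c) := by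
  refine Wp.seq (initPos_spec hE hg) ?_
  rintro σ₁ hF1 ⟨hp, h⟩
  have hE1 := hE.frame hF1 rfl
  have hg1 := hg.frame hF1 rfl
  refine Wp.ifLe (fun hc => ?_) fun hc => ?_
  · obtain ⟨h1, h2, h3⟩ := h.resolve_right (by
      rintro ⟨h1, -⟩
      simp [h1] at hc)
    refine Wp.seq (Wp.exec (T := 2) rfl (by decide) (Q := fun τ => τ = σ₁.setReg 24 0)
      fun _ => by simp [exec]) ?_
    rintro σ₂ hF2 rfl
    refine (fixLoop_spec (p := fun _ => 0) (t := 0) (hE1.frame hF2 rfl) (hg1.frame hF2 rfl)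
      ⟨hp, by simp, by omega, fun q _ => fun c => Nat.zero_le _, .inl ⟨by simp [h1], h2, ?_, ?_⟩⟩).mono
      le_rfl ?_
    · exact fun c hc => absurd hc (by omega)
    · exact fun c hc => absurd hc (by omega)
    · rintro τ _ (⟨h4, h5⟩ | ⟨h4, h5⟩)
      · exact .inl ⟨h4, .inl h5⟩
      · exact .inr ⟨h4, h3, h5⟩
  · rcases h with ⟨h1, -⟩ | ⟨h1, h2⟩
    · simp [h1] at hc
    · refine Wp.exec rfl (show _ ≤ _ by simp [Prog.bound]; omega) fun _ => .inl ⟨h1, ?_⟩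
      rcases h2 with ⟨c, h3, h4⟩ | h2
      · left
        intro q hq
        have := hq.lt c h3
        omega
      · exact .inr h2

end MaxReachInstance

/-! ### Counting the served vertices -/

namespace MaxReachInstance

open KPathGraph Ram Ram.Prog Ram.Expr

variable {I : MaxReachInstance}

open Classical in
/-- Array `11` holds the indicator of the set `A` of vertices. -/
def Marks (A : Set (Fin I.n)) (σ : Store) : Prop :=
  ∀ v : Fin I.n, σ.mem 11 (v : ℕ) = if v ∈ A then 1 else 0

theorem Marks.congr {A B : Set (Fin I.n)} {σ τ : Store} (h : Marks A σ) (hm : τ.mem 11 = σ.mem 11)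
    (hAB : ∀ v, v ∈ A ↔ v ∈ B) : Marks B τ := by
  obtain rfl : A = B := Set.ext hAB
  intro v
  rw [hm, h v]

theorem Marks.insert {A B : Set (Fin I.n)} {σ τ : Store} (h : Marks A σ) (w : Fin I.n)
    (hm : τ.mem 11 = Function.update (σ.mem 11) (w : ℕ) 1) (hAB : ∀ v, v ∈ B ↔ v = w ∨ v ∈ A) :
    Marks B τ := by
  intro v
  rw [hm]
  by_cases hv : v = w
  · subst hv
    rw [Function.update_self, if_pos ((hAB v).2 (.inl rfl))]
  · rw [Function.update_of_ne (by simpa [Fin.ext_iff] using hv), h v]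
    by_cases hvA : v ∈ A
    · rw [if_pos hvA, if_pos ((hAB v).2 (.inr hvA))]
    · rw [if_neg hvA, if_neg fun h => ((hAB v).1 h).elim hv hvA]

/-- Clears all marks. -/
def clearMarks : Prog :=
  seq (assign 36 (const 0)) <| whileLe (reg 36 + const 1) (reg 0) <|
    seq (write 11 (reg 36) (const 0)) (assign 36 (reg 36 + const 1))

/-- Marks the vertices that are served by the base-path in register `24`. -/
def markPath : Prog :=
  ifLe (const 1) (tyE (reg 24))
    (seq (assign 37 (posE (reg 24))) <| whileLe (reg 37) (cell 2 (reg 24)) <|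
      seq (write 11 (vertE (reg 24) (reg 37)) (const 1)) (assign 37 (reg 37 + const 1)))
    skip

/-- Marks all vertices that are served by the base-paths. -/
def markPaths : Prog :=
  seq (assign 24 (const 0)) <| whileLe (reg 24 + const 1) (reg 1) <|
    seq markPath (assign 24 (reg 24 + const 1))

/-- Adds up the marks. -/
def sumMarks : Prog :=
  seq (seq (assign 38 (const 0)) (assign 36 (const 0))) <| whileLe (reg 36 + const 1) (reg 0) <|
    seq (assign 38 (reg 38 + cell 11 (reg 36))) (assign 36 (reg 36 + const 1))

/-- Puts the number of vertices that are served into register `38`. -/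
def countServed : Prog :=
  seq clearMarks <| seq (write 11 (reg 3) (const 1)) <| seq markPaths sumMarks

variable {kind : ShiftKind} {σ : Store} {g : Plan I.k} {p : Fin I.k → ℕ}

theorem clearMarks_spec (hE : I.Env kind σ) :
    Wp clearMarks σ (2 + (I.n + 1) * 20) fun τ => Marks (∅ : Set (Fin I.n)) τ := by
  refine Wp.seq (Wp.exec (T := 2) rfl (by decide) (Q := fun τ => τ.reg 36 = 0)
    fun _ => by simp [exec]) ?_
  rintro σ₁ hF1 h0
  have hE1 := hE.frame hF1 rfl
  refine (Wp.while_count (B := 15) I.n (fun i τ => τ.reg 36 = i ∧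
    ∀ v : Fin I.n, (v : ℕ) < i → τ.mem 11 (v : ℕ) = 0) ⟨by simp [h0], by simp⟩ ?_ ?_).mono
    (by simp [Expr.cost]) ?_
  · rintro i τ hi hF ⟨h1, h2⟩
    have hE2 := hE1.frame hF rfl
    refine ⟨by simp [h1, hE2.r0]; omega, Wp.exec rfl (by decide) fun _ => ?_⟩
    refine ⟨by simp [exec, h1], fun v hv => ?_⟩
    simp only [exec, Store.setReg_mem, Store.setMem_mem, if_true, eval_reg, eval_const, h1]
    rcases Nat.lt_succ_iff_lt_or_eq.1 hv with hv | hv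
    · rw [Function.update_of_ne (by omega), h2 v hv]
    · rw [hv, Function.update_self]
  · rintro τ hF ⟨h1, -⟩
    simp [h1, (hE1.frame hF rfl).r0]
  · rintro τ _ ⟨-, h2⟩ v
    simp [h2 v v.2]

theorem markPath_spec (hE : I.Env kind σ) (hg : HasPlan g σ) (hp : HasPos p σ)
    (hr : I.graph.InRange g p) {c : Fin I.k} (hc : σ.reg 24 = (c : ℕ)) {A : Set (Fin I.n)}
    (hA : Marks A σ) : Wp markPath σ (20 + (I.graph.len c + 2) * 30) fun τ =>
      Marks (A ∪ {v | g.ty c ≠ 0 ∧ ∃ j : Fin (I.graph.len c + 1), p c ≤ j ∧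
        I.graph.vert c j = v}) τ := by
  have ety := eval_tyE (e := reg 24) hE hg hc
  refine Wp.mono (Wp.ifLe (T := (I.graph.len c + 2) * 30 + 5) (fun hty => ?_) fun hty => ?_)
    (show _ ≤ _ by simp [Expr.cost, tyE]; omega) fun τ _ h => h
  · have hty0 : g.ty c ≠ 0 := by
      rw [ety, eval_const] at hty
      omega
    have hlt := hr c hty0
    refine Wp.mono (Wp.seq (T := 3) (Wp.exec rfl (by decide) (Q := fun τ => τ.reg 37 = p c ∧
      τ.mem 11 = σ.mem 11) fun _ => ⟨by simp [exec, posE, hc, hp c], rfl⟩)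
      (U := (I.graph.len c + 2) * 30) ?_) (by omega) fun τ _ h => h
    rintro σ₁ hF1 ⟨h1, h2⟩
    have hE1 := hE.frame hF1 rfl
    have hc1 : σ₁.reg 24 = (c : ℕ) := by rw [hF1.1 24 (by decide), hc]
    refine (Wp.while_count (B := 25) (I.graph.len c + 1 - p c) (fun i τ => τ.reg 37 = p c + i ∧
      Marks (A ∪ {v | ∃ j : Fin (I.graph.len c + 1), p c ≤ j ∧ (j : ℕ) < p c + i ∧
        I.graph.vert c j = v}) τ) ⟨by simp [h1], hA.congr h2 ?_⟩ ?_ ?_).mono ?_ ?_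
    · intro v
      simp only [Set.mem_union, Set.mem_ofPred_eq]
      refine ⟨fun h => .inl h, ?_⟩
      rintro (h | ⟨j, h3, h4, -⟩)
      · exact h
      · omega
    · rintro i τ hi hF ⟨h3, h4⟩
      have hE2 := hE1.frame hF rfl
      have hc2 : τ.reg 24 = (c : ℕ) := by rw [hF.1 24 (by decide), hc1]
      refine ⟨by simp [h3, hc2, hE2.len]; omega, Wp.exec rfl (by decide) fun _ => ?_⟩
      refine ⟨by simp [exec, h3]; ring, ?_⟩
      have hj : p c + i < I.graph.len c + 1 := by omega
      have hv := eval_vertE (e := reg 24) (f := reg 37) (j := p c + i) hE2 hc2 (by simp [h3]) hj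
      rw [I.graph.vtx_of_lt hj] at hv
      refine h4.insert (I.graph.vert c ⟨p c + i, hj⟩) (by simp [exec, hv]) ?_
      intro v
      simp only [Set.mem_union, Set.mem_ofPred_eq]
      constructor
      · rintro (h | ⟨j, h5, h6, rfl⟩)
        · exact .inr (.inl h)
        · rcases (show (j : ℕ) < p c + i ∨ (j : ℕ) = p c + i by omega) with h7 | h7
          · exact .inr (.inr ⟨j, h5, h7, rfl⟩)
          · exact .inl (congrArg _ (Fin.ext h7))
      · rintro (rfl | h | ⟨j, h5, h6, rfl⟩)
        · exact .inr ⟨_, by simp, by simp, rfl⟩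
        · exact .inl h
        · exact .inr ⟨j, h5, by omega, rfl⟩
    · rintro τ hF ⟨h3, -⟩
      have hc2 : τ.reg 24 = (c : ℕ) := by rw [hF.1 24 (by decide), hc1]
      simp [h3, hc2, (hE1.frame hF rfl).len]
      omega
    · refine Nat.mul_le_mul (by omega) (by simp [Expr.cost])
    · rintro τ _ ⟨-, h⟩
      refine h.congr rfl fun v => ?_
      simp only [Set.mem_union, Set.mem_ofPred_eq]
      refine or_congr Iff.rfl ⟨?_, ?_⟩
      · rintro ⟨j, h5, -, h6⟩
        exact ⟨hty0, j, h5, h6⟩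
      · rintro ⟨-, j, h5, h6⟩
        exact ⟨j, h5, by omega, h6⟩
  · refine Wp.exec rfl (show _ ≤ _ by simp [Prog.bound]) fun _ => hA.congr rfl fun v => ?_
    have : g.ty c = 0 := by
      rw [ety, eval_const] at hty
      omega
    simp [this]

/-- A bound for the time of `countServed`. -/
def countTime (n k S : ℕ) : ℕ :=
  2 + (n + 1) * 20 + (3 + (2 + (k + 1) * (20 + (S + 2) * 30 + 4 + 5) + (4 + (n + 1) * 20)))

theorem markPaths_spec (hE : I.Env kind σ) (hg : HasPlan g σ) (hp : HasPos p σ)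
    (hr : I.graph.InRange g p) {A : Set (Fin I.n)} (hA : Marks A σ) {S : ℕ}
    (hS : ∀ c, I.graph.len c ≤ S) :
    Wp markPaths σ (2 + (I.k + 1) * (20 + (S + 2) * 30 + 4 + 5)) fun τ =>
      Marks (A ∪ {v | ∃ c, g.ty c ≠ 0 ∧ ∃ j : Fin (I.graph.len c + 1), p c ≤ j ∧
        I.graph.vert c j = v}) τ := by
  refine Wp.seq (Wp.exec (T := 2) rfl (by decide) (Q := fun τ => τ.reg 24 = 0 ∧
    τ.mem 11 = σ.mem 11) fun _ => by simp [exec]) ?_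
  rintro σ₁ hF1 ⟨h1, h2⟩
  have hE1 := hE.frame hF1 rfl
  refine (Wp.while_count (B := 20 + (S + 2) * 30 + 4) I.k (fun i τ => τ.reg 24 = i ∧
    Marks (A ∪ {v | ∃ c : Fin I.k, (c : ℕ) < i ∧ g.ty c ≠ 0 ∧ ∃ j : Fin (I.graph.len c + 1),
      p c ≤ j ∧ I.graph.vert c j = v}) τ) ⟨by simp [h1], hA.congr h2 (by simp)⟩ ?_ ?_).mono
      (by simp [Expr.cost]) ?_
  · rintro i τ hi hF ⟨h3, h4⟩
    have hE2 := hE1.frame hF rfl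
    refine ⟨by simp [h3, hE2.r1]; omega, ?_⟩
    refine Wp.seq ((markPath_spec (c := ⟨i, hi⟩) hE2 ((hg.frame hF1 rfl).frame hF rfl)
      ((hp.frame hF1 rfl).frame hF rfl) hr h3 h4).mono (T' := 20 + (S + 2) * 30) ?_
      fun _ _ h => h) ?_
    · have := hS ⟨i, hi⟩
      gcongr
    · rintro τ₂ hF2 h5
      refine Wp.exec rfl (by decide) fun _ => ⟨?_, h5.congr rfl fun v => ?_⟩
      · simp [exec, hF2.1 24 (by decide), h3]
      · simp only [Set.mem_union, Set.mem_ofPred_eq]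
        constructor
        · rintro ((h | ⟨c, h6, h7⟩) | h)
          · exact .inl h
          · exact .inr ⟨c, by omega, h7⟩
          · exact .inr ⟨⟨i, hi⟩, by simp, h⟩
        · rintro (h | ⟨c, h6, h7⟩)
          · exact .inl (.inl h)
          · rcases Nat.lt_succ_iff_lt_or_eq.1 h6 with h6 | h6
            · exact .inl (.inr ⟨c, h6, h7⟩)
            · obtain rfl : c = ⟨i, hi⟩ := Fin.ext h6
              exact .inr h7
  · rintro τ hF ⟨h3, -⟩
    simp [h3, (hE1.frame hF rfl).r1]
  · rintro τ _ ⟨-, h⟩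
    exact h.congr rfl fun v => by simp

theorem sumMarks_spec (hE : I.Env kind σ) {A : Set (Fin I.n)} (hA : Marks A σ) :
    Wp sumMarks σ (4 + (I.n + 1) * 20) fun τ => τ.reg 38 = A.ncard := by
  classical
  refine Wp.seq (Wp.exec (T := 4) rfl (by decide) (Q := fun τ => τ.reg 36 = 0 ∧ τ.reg 38 = 0)
    fun _ => by simp [exec]) ?_
  rintro σ₁ hF1 ⟨h1, h2⟩
  have hE1 := hE.frame hF1 rfl
  refine (Wp.while_count (B := 15) I.n (fun i τ => τ.reg 36 = i ∧ τ.reg 38 =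
    ∑ x ∈ Finset.range i, (if h : x < I.n then (if (⟨x, h⟩ : Fin I.n) ∈ A then 1 else 0) else 0 : ℕ))
    ⟨by simp [h1], by simp [h2]⟩ ?_ ?_).mono (by simp [Expr.cost]) ?_
  · rintro i τ hi hF ⟨h3, h4⟩
    have hE2 := hE1.frame hF rfl
    have hm : τ.mem 11 (i : ℤ) = if (⟨i, hi⟩ : Fin I.n) ∈ A then 1 else 0 := by
      rw [hF.2 11 (by decide), hF1.2 11 (by decide)]
      convert hA ⟨i, hi⟩
    refine ⟨by simp [h3, hE2.r0]; omega, Wp.exec rfl (by decide) fun _ => ⟨by simp [exec, h3], ?_⟩⟩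
    rw [Finset.sum_range_succ]
    simp only [exec, Store.setReg_reg, eval_reg, eval_cell, eval_add, h3, hm, h4]
    simp [hi]
  · rintro τ hF ⟨h3, -⟩
    simp [h3, (hE1.frame hF rfl).r0]
  · rintro τ _ ⟨-, h⟩
    rw [h, sum_range_dite (fun v => if v ∈ A then 1 else 0), Finset.sum_boole,
      Set.ncard_eq_toFinset_card']
    congr 1
    norm_cast
    congr 1
    ext v
    simp

theorem countServed_spec (hE : I.Env kind σ) (hg : HasPlan g σ) (hp : HasPos p σ)
    (hr : I.graph.InRange g p) {S : ℕ} (hS : ∀ c, I.graph.len c ≤ S) :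
    Wp countServed σ (countTime I.n I.k S) fun τ =>
      τ.reg 38 = (I.graph.served I.source g p).ncard := by
  refine Wp.seq (clearMarks_spec hE) ?_
  rintro σ₁ hF1 h1
  have hE1 := hE.frame hF1 rfl
  refine Wp.seq (T := 3) (R := Marks {I.source}) (Wp.exec rfl (by decide) fun _ => ?_) ?_
  · exact h1.insert I.source (by simp [exec, hE1.r3]) (by simp)
  rintro σ₂ hF2 h2
  have hE2 := hE1.frame hF2 rfl
  refine Wp.seq (markPaths_spec hE2 ((hg.frame hF1 rfl).frame hF2 rfl)
    ((hp.frame hF1 rfl).frame hF2 rfl) hr h2 hS) ?_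
  rintro σ₃ hF3 h3
  exact sumMarks_spec (hE2.frame hF3 rfl) h3

end MaxReachInstance

/-! ### Writing the operations of a plan -/

namespace MaxReachInstance

open KPathGraph Ram Ram.Prog Ram.Expr

variable {I : MaxReachInstance}

/-- The output for a list of operations, without their number. -/
def opWord {k : ℕ} {len : Fin k → ℕ} (ops : List (ShiftOp len)) : List ℤ :=
  ops.flatMap fun o => [((o.path : ℕ) : ℤ), ((o.pos : ℕ) : ℤ), o.amount]

/-- The operations `ops` have been written to the output array. -/
structure Written {k : ℕ} {len : Fin k → ℕ} (ops : List (ShiftOp len)) (σ : Store) : Prop where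
  num : σ.reg 39 = ops.length
  ptr : σ.reg 40 = 1 + (opWord ops).length
  out : ∀ (m : ℕ) (x : ℤ), (opWord ops)[m]? = some x → σ.mem 1 (1 + m) = x

theorem Written.congr {k : ℕ} {len : Fin k → ℕ} {ops : List (ShiftOp len)} {σ τ : Store}
    (h : Written ops σ) (h39 : τ.reg 39 = σ.reg 39) (h40 : τ.reg 40 = σ.reg 40)
    (hm : τ.mem 1 = σ.mem 1) : Written ops τ :=
  ⟨h39.trans h.num, h40.trans h.ptr, fun m x hx => by rw [hm]; exact h.out m x hx⟩

/-- Writes an operation to the output array. -/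
def emit (e₁ e₂ e₃ : Expr) : Prog :=
  seq (write 1 (reg 40) e₁) <| seq (write 1 (reg 40 + const 1) e₂) <|
  seq (write 1 (reg 40 + const 2) e₃) <|
  seq (assign 40 (reg 40 + const 3)) (assign 39 (reg 39 + const 1))

/-- The second and third expressions are evaluated after earlier writes to the output array. Hence
their values are required in every store that differs from `σ` only there. -/
theorem emit_exec {k : ℕ} {len : Fin k → ℕ} {ops : List (ShiftOp len)} {σ : Store}
    (h : Written ops σ) {o : ShiftOp len} {e₁ e₂ e₃ : Expr}
    (h₁ : e₁.eval σ = (o.path : ℕ))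
    (h₂ : ∀ τ : Store, τ.reg = σ.reg → (∀ a, a ≠ 1 → τ.mem a = σ.mem a) →
      e₂.eval τ = (o.pos : ℕ))
    (h₃ : ∀ τ : Store, τ.reg = σ.reg → (∀ a, a ≠ 1 → τ.mem a = σ.mem a) →
      e₃.eval τ = o.amount) : Written (ops ++ [o]) ((emit e₁ e₂ e₃).exec σ) := by
  have hw : opWord (ops ++ [o]) = opWord ops ++ [((o.path : ℕ) : ℤ), ((o.pos : ℕ) : ℤ), o.amount] := by
    simp [opWord]
  obtain ⟨hn, hp, ho⟩ := h
  set N := (opWord ops).length with hN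
  have hex : ∃ τ : Store, (emit e₁ e₂ e₃).exec σ = τ ∧ τ.reg 39 = σ.reg 39 + 1 ∧
      τ.reg 40 = σ.reg 40 + 3 ∧ τ.mem 1 = Function.update (Function.update (Function.update
        (σ.mem 1) (1 + N) (o.path : ℕ)) (1 + N + 1) (o.pos : ℕ)) (1 + N + 2) o.amount := by
    refine ⟨_, rfl, ?_, ?_, ?_⟩
    · simp [emit, exec]
    · simp [emit, exec]
    · simp only [emit, exec, Store.setReg_mem, Store.setMem_mem, if_true, Store.setMem_reg,
        eval_reg, eval_add, eval_const, hp, h₁]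
      rw [h₂ _ (by simp) (fun a ha => by simp [ha]), h₃ _ (by simp) (fun a ha => by simp [ha])]
  obtain ⟨τ, he, h39, h40, hm⟩ := hex
  rw [he]
  refine ⟨by simp [h39, hn], ?_, ?_⟩
  · rw [h40, hp, hw]
    simp [hN]
    ring
  · intro m x hx
    rw [hw, List.getElem?_append] at hx
    rw [hm]
    split_ifs at hx with hlt
    · rw [Function.update_of_ne (by omega), Function.update_of_ne (by omega),
        Function.update_of_ne (by omega)]
      exact ho m x hx
    · rw [← hN] at hx hlt
      obtain ⟨d, rfl⟩ : ∃ d, m = N + d := ⟨m - N, by omega⟩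
      rw [Nat.add_sub_cancel_left] at hx
      rcases d with _ | _ | _ | d
      · rw [Function.update_of_ne (by omega), Function.update_of_ne (by omega)]
        simpa using hx
      · rw [Function.update_of_ne (by omega)]
        have : (1 + ((N + (0 + 1) : ℕ) : ℤ)) = 1 + N + 1 := by push_cast; ring
        rw [this, Function.update_self]
        simpa using hx
      · have : (1 + ((N + (0 + 1 + 1) : ℕ) : ℤ)) = 1 + N + 2 := by push_cast; ring
        rw [this, Function.update_self]
        simpa using hx
      · simp at hx

/-- Writes the delay for the base-path in register `24`. -/
def emitDelay : Prog :=
  ifLe (const 1) (tyE (reg 24))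
    (ifLe (const 1) (dlE (reg 24)) (emit (reg 24) (posE (reg 24)) (dlE (reg 24))) skip) skip

/-- Writes all delays. -/
def emitDelays : Prog :=
  seq (seq (assign 39 (const 0)) <| seq (assign 40 (const 1)) (assign 24 (const 0))) <|
  whileLe (reg 24 + const 1) (reg 1) <| seq emitDelay (assign 24 (reg 24 + const 1))

/-- Takes the base-path in register `35` into account for the maximum in register `41`. -/
def demandStep : Prog :=
  seq (ifLe (const 3) (tyE (reg 35)) (ifLe (tyE (reg 35)) (const 3)
    (ifLe (parE (reg 35)) (reg 24) (ifLe (reg 24) (parE (reg 35))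
    (ifLe (cell 10 (reg 35)) (reg 37) (ifLe (reg 37) (cell 10 (reg 35))
    (ifLe (advE (reg 35)) (reg 41) skip (assign 41 (advE (reg 35))))
    skip) skip) skip) skip) skip) skip) (assign 35 (reg 35 + const 1))

/-- Puts the demanded advance of edge `37` of base-path `24` into register `41`. -/
def findDemand : Prog :=
  seq (seq (assign 41 (const 0)) (assign 35 (const 0))) <|
  whileLe (reg 35 + const 1) (reg 1) demandStep

/-- Writes the advance of edge `37` of base-path `24`. -/
def emitAdvance : Prog :=
  seq findDemand <|
  seq (ifLe (const 1) (reg 41) (emit (reg 24) (reg 37) (const 0 - reg 41)) skip)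
    (assign 37 (reg 37 + const 1))

/-- Writes the advances on base-path `24`. -/
def emitPath : Prog :=
  seq (assign 37 (const 0)) <|
  seq (whileLe (reg 37 + const 1) (cell 2 (reg 24)) emitAdvance) (assign 24 (reg 24 + const 1))

/-- Writes all advances. -/
def emitAdvances : Prog :=
  seq (assign 24 (const 0)) <| whileLe (reg 24 + const 1) (reg 1) emitPath

/-- Writes the operations of the current plan. -/
def emitOps : Prog := seq emitDelays <| seq emitAdvances (write 1 (const 0) (reg 39))

variable {kind : ShiftKind} {σ : Store} {g : Plan I.k} {p : Fin I.k → ℕ}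

theorem flatMap_take_succ {α : Type*} {N : ℕ} (F : Fin N → List α) {i : ℕ} (hi : i < N) :
    ((List.finRange N).take (i + 1)).flatMap F =
      ((List.finRange N).take i).flatMap F ++ F ⟨i, hi⟩ := by
  rw [List.take_add_one]
  simp [hi, List.flatMap_append]

theorem emitDelays_spec (hE : I.Env kind σ) (hg : HasPlan g σ) (hp : HasPos p σ)
    (hr : I.graph.InRange g p) :
    Wp emitDelays σ (6 + (I.k + 1) * (emitDelay.bound + 4 + 5)) (Written (I.graph.planDelays g p)) := by
  refine Wp.seq (Wp.exec (T := 6) rfl (by decide)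
    (Q := fun τ => τ.reg 39 = 0 ∧ τ.reg 40 = 1 ∧ τ.reg 24 = 0) fun _ => by simp [exec]) ?_
  rintro σ₁ hF1 ⟨h1, h2, h3⟩
  have hE1 := hE.frame hF1 rfl
  have hg1 := hg.frame hF1 rfl
  have hp1 := hp.frame hF1 rfl
  refine (Wp.while_count (B := emitDelay.bound + 4) I.k (fun i τ => τ.reg 24 = i ∧
    Written (((List.finRange I.k).take i).flatMap (I.graph.delayAt g p)) τ)
    ⟨by simp [h3], ⟨by simp [h1], by simp [h2, opWord], by simp [opWord]⟩⟩ ?_ ?_).mono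
    (by simp [Expr.cost]) ?_
  · rintro i τ hi hF ⟨h4, h5⟩
    have hE2 := hE1.frame hF rfl
    have hg2 := hg1.frame hF rfl
    have hp2 := hp1.frame hF rfl
    refine ⟨by simp [h4, hE2.r1]; omega, Wp.seq (Wp.exec rfl le_rfl (Q := fun τ' => τ'.reg 24 = i ∧
      Written (((List.finRange I.k).take (i + 1)).flatMap (I.graph.delayAt g p)) τ')
      fun hF' => ⟨by rw [hF'.1 24 (by decide), h4], ?_⟩) ?_⟩
    · have hc : (reg 24).eval τ = (((⟨i, hi⟩ : Fin I.k) : ℕ) : ℤ) := h4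
      rw [flatMap_take_succ _ hi, emitDelay, exec_ifLe, exec_ifLe,
        eval_tyE hE2 hg2 hc, eval_dlE hE2 hg2 hc]
      by_cases ht : g.ty ⟨i, hi⟩ = 0
      · have hd0 : I.graph.delayAt g p ⟨i, hi⟩ = [] := by
          unfold delayAt
          split_ifs with h6 h7
          · exact absurd ht h7.1
          · rfl
          · rfl
        rw [hd0, List.append_nil, if_neg (by simp [ht])]
        exact h5
      · have ht1 : 1 ≤ g.ty ⟨i, hi⟩ := Nat.one_le_iff_ne_zero.2 ht
        rw [if_pos (by rw [eval_const]; exact_mod_cast ht1)]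
        by_cases hd : g.dl ⟨i, hi⟩ = 0
        · have hd0 : I.graph.delayAt g p ⟨i, hi⟩ = [] := by
            unfold delayAt
            split_ifs with h6 h7
            · exact absurd hd (Nat.pos_iff_ne_zero.1 h7.2)
            · rfl
            · rfl
          rw [hd0, List.append_nil, if_neg (by simp [hd])]
          exact h5
        · have hd1 : 1 ≤ g.dl ⟨i, hi⟩ := Nat.one_le_iff_ne_zero.2 hd
          have hd0 : I.graph.delayAt g p ⟨i, hi⟩ =
              [⟨⟨i, hi⟩, ⟨p ⟨i, hi⟩, hr _ ht⟩, g.dl ⟨i, hi⟩⟩] := by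
            unfold delayAt
            rw [dif_pos (hr _ ht), if_pos ⟨ht, hd1⟩]
          rw [hd0, if_pos (by rw [eval_const]; exact_mod_cast hd1)]
          refine emit_exec h5 hc (fun τ' h6 h7 => ?_) fun τ' h6 h7 => ?_
          · simp [posE, h6, h7, h4]
            exact hp2 ⟨i, hi⟩
          · have := hg2.dl ⟨i, hi⟩
            simp [dlE, h6, h7, h4, hE2.r4, this]
    · rintro τ' hF' ⟨h6, h7⟩
      exact Wp.exec rfl (by decide) fun _ => ⟨by simp [exec, h6], h7.congr rfl rfl rfl⟩
  · rintro τ hF ⟨h4, -⟩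
    simp [h4, (hE1.frame hF rfl).r1]
  · rintro τ _ ⟨-, h⟩
    rw [List.take_of_length_le (by simp)] at h
    exact h

theorem findDemand_spec (hE : I.Env kind σ) (hg : HasPlan g σ)
    (hal : ∀ c : Fin I.k, 2 ≤ g.ty c → σ.mem 10 (c : ℕ) = I.graph.alight g p c)
    {i : Fin I.k} (hi : σ.reg 24 = (i : ℕ)) {m : ℕ} (hm : σ.reg 37 = m) :
    Wp findDemand σ (4 + (I.k + 1) * (demandStep.bound + 5)) fun τ =>
      τ.reg 41 = I.graph.demand g p i m := by
  let f : Fin I.k → ℕ := fun c => if g.ty c = 3 ∧ g.par c = i ∧ I.graph.alight g p c = m then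
    g.adv c else 0
  refine Wp.seq (Wp.exec (T := 4) rfl (by decide) (Q := fun τ => τ.reg 41 = 0 ∧ τ.reg 35 = 0)
    fun _ => by simp [exec]) ?_
  rintro σ₁ hF1 ⟨h1, h2⟩
  have hE1 := hE.frame hF1 rfl
  have hg1 := hg.frame hF1 rfl
  refine (Wp.while_count (B := demandStep.bound) I.k (fun x τ => τ.reg 35 = x ∧ τ.reg 41 =
    ((Finset.range x).sup (fun x => if h : x < I.k then f ⟨x, h⟩ else 0) : ℕ))
    ⟨by simp [h2], by simp [h1]⟩ ?_ ?_).mono (by simp [Expr.cost]) ?_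
  · rintro x τ hx hF ⟨h3, h4⟩
    have hE2 := hE1.frame hF rfl
    have hg2 := hg1.frame hF rfl
    refine ⟨by simp [h3, hE2.r1]; omega, Wp.exec rfl le_rfl fun _ => ?_⟩
    have h24 : τ.reg 24 = (i : ℕ) := by rw [hF.1 24 (by decide), hF1.1 24 (by decide), hi]
    have h37 : τ.reg 37 = m := by rw [hF.1 37 (by decide), hF1.1 37 (by decide), hm]
    have h10 : τ.mem 10 = σ.mem 10 := by rw [hF.2 10 (by decide), hF1.2 10 (by decide)]
    have hty := hg2.ty ⟨x, hx⟩
    have hpar := hg2.par ⟨x, hx⟩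
    have hadv := hg2.adv ⟨x, hx⟩
    simp only at hty hpar hadv
    rw [Finset.range_add_one, Finset.sup_insert, dif_pos hx]
    generalize ((Finset.range x).sup (fun x => if h : x < I.k then f ⟨x, h⟩ else 0)) = s at *
    by_cases ht : g.ty ⟨x, hx⟩ = 3
    · have ha : τ.mem 10 (x : ℤ) = I.graph.alight g p ⟨x, hx⟩ := by
        rw [h10]
        exact hal ⟨x, hx⟩ (by omega)
      by_cases hpi : g.par ⟨x, hx⟩ = i
      · by_cases hmm : I.graph.alight g p ⟨x, hx⟩ = m
        · have hf : f ⟨x, hx⟩ = g.adv ⟨x, hx⟩ := if_pos ⟨ht, hpi, hmm⟩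
          rw [hf]
          by_cases hs : g.adv ⟨x, hx⟩ ≤ s
          · simp [demandStep, exec, tyE, parE, advE, h3, hE2.r1, hE2.r8, hty, ht, hpar, hpi, h24,
              ha, hmm, h37, hadv, h4, hs]
          · simp [demandStep, exec, tyE, parE, advE, h3, hE2.r1, hE2.r8, hty, ht, hpar, hpi, h24,
              ha, hmm, h37, hadv, h4, hs, le_of_not_ge hs]
        · have hf : f ⟨x, hx⟩ = 0 := if_neg fun h => hmm h.2.2
          rw [hf]
          simp [demandStep, exec, tyE, parE, advE, h3, hE2.r1, hE2.r8, hty, ht, hpar, hpi, h24,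
              ha, h37, hadv, h4]
          split_ifs with h5 h6 <;> simp [h4, h3]
          omega
      · have hf : f ⟨x, hx⟩ = 0 := if_neg fun h => hpi h.2.1
        have hpi' : (g.par ⟨x, hx⟩ : ℕ) ≠ i := fun h => hpi (Fin.ext h)
        rw [hf]
        simp [demandStep, exec, tyE, parE, h3, hE2.r1, hty, ht, hpar, h24]
        split_ifs with h5 h6 <;> first | (exfalso; omega) | simp [h4, h3]
    · have hf : f ⟨x, hx⟩ = 0 := if_neg fun h => ht h.1
      rw [hf]
      simp [demandStep, exec, tyE, h3, hE2.r1, hty]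
      split_ifs with h5 h6 <;> first | (exfalso; omega) | simp [h4, h3]
  · rintro τ hF ⟨h3, -⟩
    simp [h3, (hE1.frame hF rfl).r1]
  · rintro τ _ ⟨-, h⟩
    rw [h, demand]
    congr 1
    apply le_antisymm
    · refine Finset.sup_le fun x hx => ?_
      rw [dif_pos (Finset.mem_range.1 hx)]
      exact Finset.le_sup (f := f) (Finset.mem_univ _)
    · refine Finset.sup_le fun c _ => ?_
      have := Finset.le_sup (f := fun x => if h : x < I.k then f ⟨x, h⟩ else 0)
        (Finset.mem_range.2 c.2)
      simpa using this

/-- A bound for the time of `emitAdvance`. -/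
def emitTime (k : ℕ) : ℕ := 4 + (k + 1) * (demandStep.bound + 5) + 100

theorem emitAdvance_spec (hE : I.Env kind σ) (hg : HasPlan g σ)
    (hal : ∀ c : Fin I.k, 2 ≤ g.ty c → σ.mem 10 (c : ℕ) = I.graph.alight g p c)
    {i : Fin I.k} (hi : σ.reg 24 = (i : ℕ)) {m : ℕ} (hm : m < I.graph.len i) (hm' : σ.reg 37 = m)
    {ops : List (ShiftOp I.graph.len)} (hops : Written ops σ) :
    Wp emitAdvance σ (emitTime I.k) fun τ => τ.reg 37 = m + 1 ∧
      Written (ops ++ I.graph.advanceAt g p i ⟨m, hm⟩) τ := by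
  refine (Wp.seq (findDemand_spec hE hg hal hi hm') (U := 100) ?_).mono (by rw [emitTime])
    fun _ _ h => h
  rintro τ hF h1
  have hops' := hops.congr (hF.1 39 (by decide)) (hF.1 40 (by decide)) (hF.2 1 (by decide))
  have h24 : τ.reg 24 = (i : ℕ) := by rw [hF.1 24 (by decide), hi]
  have h37 : τ.reg 37 = m := by rw [hF.1 37 (by decide), hm']
  refine Wp.exec rfl (by decide) fun _ => ?_
  rw [exec_seq, exec_ifLe, eval_const, eval_reg, h1]
  unfold advanceAt
  split_ifs with h2 h3 h3
  · have h4 := emit_exec hops' (o := ⟨i, ⟨m, hm⟩, -(I.graph.demand g p i m : ℤ)⟩) (e₁ := reg 24)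
      (e₂ := reg 37) (e₃ := const 0 - reg 41) h24 (fun τ' h6 h7 => by simp [h6, h37])
      fun τ' h6 h7 => by simp [h6, h1]
    refine ⟨?_, h4.congr (by simp [exec]) (by simp [exec]) rfl⟩
    have : ((emit (reg 24) (reg 37) (const 0 - reg 41)).exec τ).reg 37 = τ.reg 37 :=
      (frame_exec rfl τ).1 37 (by decide)
    simp [exec, this, h37]
  · exact absurd h2 (by simp only at h3; omega)
  · exact absurd h3 (by simp only; omega)
  · exact ⟨by simp [exec, h37], by
      rw [List.append_nil]
      exact hops'.congr (by simp [exec]) (by simp [exec]) rfl⟩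

theorem emitPath_spec (hE : I.Env kind σ) (hg : HasPlan g σ)
    (hal : ∀ c : Fin I.k, 2 ≤ g.ty c → σ.mem 10 (c : ℕ) = I.graph.alight g p c)
    {i : Fin I.k} (hi : σ.reg 24 = (i : ℕ)) {ops : List (ShiftOp I.graph.len)}
    (hops : Written ops σ) {S : ℕ} (hS : ∀ c, I.graph.len c ≤ S) :
    Wp emitPath σ (2 + ((S + 1) * (emitTime I.k + 6) + 4)) fun τ => τ.reg 24 = i + 1 ∧
      Written (ops ++ (List.finRange (I.graph.len i)).flatMap (I.graph.advanceAt g p i)) τ := by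
  refine Wp.seq (Wp.exec (T := 2) rfl (by decide) (Q := fun τ => τ.reg 37 = 0 ∧ Written ops τ)
    fun _ => ⟨by simp [exec], hops.congr rfl rfl rfl⟩) ?_
  rintro σ₁ hF1 ⟨h1, h2⟩
  have hE1 := hE.frame hF1 rfl
  have hi1 : σ₁.reg 24 = (i : ℕ) := by rw [hF1.1 24 (by decide), hi]
  refine Wp.seq ((Wp.while_count (B := emitTime I.k) (I.graph.len i) (fun m τ => τ.reg 37 = m ∧
    Written (ops ++ ((List.finRange (I.graph.len i)).take m).flatMap (I.graph.advanceAt g p i)) τ)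
    ⟨by simp [h1], by simpa using h2⟩ ?_ ?_).mono
    (Nat.mul_le_mul (Nat.succ_le_succ (hS i)) (by simp [Expr.cost])) fun _ _ h => h) ?_
  · rintro m τ hm hF ⟨h3, h4⟩
    have hE2 := hE1.frame hF rfl
    have hi2 : τ.reg 24 = (i : ℕ) := by rw [hF.1 24 (by decide), hi1]
    refine ⟨by simp [h3, hi2, hE2.len]; omega, ?_⟩
    have hal2 : ∀ c : Fin I.k, 2 ≤ g.ty c → τ.mem 10 (c : ℕ) = I.graph.alight g p c := fun c hc => by
      rw [hF.2 10 (by decide), hF1.2 10 (by decide), hal c hc]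
    refine (emitAdvance_spec hE2 ((hg.frame hF1 rfl).frame hF rfl) hal2 hi2 hm h3 h4).mono
      le_rfl ?_
    rintro τ' _ ⟨h5, h6⟩
    refine ⟨by simp [h5], ?_⟩
    rwa [flatMap_take_succ _ hm, ← List.append_assoc]
  · rintro τ hF ⟨h3, -⟩
    have hi2 : τ.reg 24 = (i : ℕ) := by rw [hF.1 24 (by decide), hi1]
    simp [h3, hi2, (hE1.frame hF rfl).len]
  · rintro τ hF ⟨h3, h4⟩
    rw [List.take_of_length_le (by simp)] at h4
    exact Wp.exec rfl (by decide) fun _ =>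
      ⟨by simp [exec, hF.1 24 (by decide), hi1], h4.congr rfl rfl rfl⟩

/-- A bound for the time of `emitOps`. -/
def emitOpsTime (k S : ℕ) : ℕ :=
  6 + (k + 1) * (emitDelay.bound + 4 + 5) +
    (2 + (k + 1) * (2 + ((S + 1) * (emitTime k + 6) + 4) + 5) + 3)

/-- The pointer starts at cell 1 and leaves cell 0 free for the number of operations, which is known
only at the end. The order of writing is that of `planOps`, with the advances in ascending positions
as the analysis of labels requires. -/
theorem emitOps_spec (hE : I.Env kind σ) (hg : HasPlan g σ) (hp : HasPos p σ)
    (hr : I.graph.InRange g p)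
    (hal : ∀ c : Fin I.k, 2 ≤ g.ty c → σ.mem 10 (c : ℕ) = I.graph.alight g p c)
    {S : ℕ} (hS : ∀ c, I.graph.len c ≤ S) :
    Wp emitOps σ (emitOpsTime I.k S) fun τ => τ.HasOutput (encodeOps (I.graph.planOps g p)) := by
  refine Wp.seq (emitDelays_spec hE hg hp hr) ?_
  rintro σ₁ hF1 h1
  have hE1 := hE.frame hF1 rfl
  have hg1 := hg.frame hF1 rfl
  refine Wp.seq (T := 2 + (I.k + 1) * (2 + ((S + 1) * (emitTime I.k + 6) + 4) + 5))
    (R := Written (I.graph.planOps g p)) ?_ ?_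
  · refine Wp.seq (Wp.exec (T := 2) rfl (by decide) (Q := fun τ => τ.reg 24 = 0 ∧
      Written (I.graph.planDelays g p) τ) fun _ => ⟨by simp [exec], h1.congr rfl rfl rfl⟩) ?_
    rintro σ₂ hF2 ⟨h2, h3⟩
    have hE2 := hE1.frame hF2 rfl
    refine (Wp.while_count (B := 2 + ((S + 1) * (emitTime I.k + 6) + 4)) I.k (fun i τ =>
      τ.reg 24 = i ∧ Written (I.graph.planDelays g p ++ ((List.finRange I.k).take i).flatMap
        fun i => (List.finRange (I.graph.len i)).flatMap (I.graph.advanceAt g p i)) τ)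
      ⟨by simp [h2], by simpa using h3⟩ ?_ ?_).mono (by simp [Expr.cost]) ?_
    · rintro i τ hi hF ⟨h4, h5⟩
      have hE3 := hE2.frame hF rfl
      refine ⟨by simp [h4, hE3.r1]; omega, ?_⟩
      have hal2 : ∀ c : Fin I.k, 2 ≤ g.ty c → τ.mem 10 (c : ℕ) = I.graph.alight g p c :=
        fun c hc => by
        rw [hF.2 10 (by decide), hF2.2 10 (by decide), hF1.2 10 (by decide), hal c hc]
      refine (emitPath_spec (i := ⟨i, hi⟩) hE3 ((hg1.frame hF2 rfl).frame hF rfl) hal2 h4 h5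
        hS).mono le_rfl ?_
      rintro τ' _ ⟨h5, h6⟩
      refine ⟨by simp [h5], ?_⟩
      rwa [flatMap_take_succ _ hi, ← List.append_assoc]
    · rintro τ hF ⟨h4, -⟩
      simp [h4, (hE2.frame hF rfl).r1]
    · rintro τ _ ⟨-, h⟩
      rw [List.take_of_length_le (by simp)] at h
      exact h
  · rintro τ hF ⟨h4, h5, h6⟩
    refine Wp.exec rfl (by decide) fun _ => ?_
    rintro m hm
    simp only [exec, Store.setMem_mem, if_true, eval_const, eval_reg]
    rcases m with _ | m
    · simp [encodeOps, h4]
    · rw [Function.update_of_ne (by push_cast; omega)]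
      have := h6 m (encodeOps (I.graph.planOps g p))[m + 1] (by
        have h7 : encodeOps (I.graph.planOps g p) =
          ((I.graph.planOps g p).length : ℤ) :: opWord (I.graph.planOps g p) := rfl
        simp only [h7, List.getElem_cons_succ]
        exact List.getElem?_eq_getElem _)
      rw [← this]
      congr 1
      push_cast
      ring

end MaxReachInstance

/-! ### Reading the input -/

namespace MaxReachInstance

open KPathGraph Ram Ram.Prog Ram.Expr

variable (I : MaxReachInstance)

/-- The part of the input word for a base-path. -/
def block (i : Fin I.k) : List ℤ :=
  (I.graph.len i : ℤ) ::
    (List.ofFn (fun j => ((I.graph.vert i j : ℕ) : ℤ)) ++ List.ofFn (I.graph.label i))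

/-- The part of the input word before the base-path number `i`. -/
def prefixWord (i : ℕ) : List ℤ :=
  [(I.n : ℤ), (I.k : ℤ), (I.budget : ℤ), ((I.source : ℕ) : ℤ)] ++
    ((List.finRange I.k).take i).flatMap I.block

theorem block_length (i : Fin I.k) : (I.block i).length = 2 * I.graph.len i + 2 := by
  simp [block]
  omega

theorem prefixWord_succ {i : ℕ} (hi : i < I.k) :
    I.prefixWord (i + 1) = I.prefixWord i ++ I.block ⟨i, hi⟩ := by
  rw [prefixWord, flatMap_take_succ _ hi, ← List.append_assoc]
  rfl

theorem prefixWord_prefix (i : ℕ) : I.prefixWord i <+: I.encode := by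
  refine ⟨((List.finRange I.k).drop i).flatMap I.block, ?_⟩
  rw [prefixWord, List.append_assoc, ← List.flatMap_append, List.take_append_drop]
  rfl

theorem encode_getD (i : Fin I.k) {x : ℕ} {z : ℤ} (hz : (I.block i)[x]? = some z) :
    I.encode.getD ((I.prefixWord i).length + x) 0 = z := by
  obtain ⟨l, hl⟩ := I.prefixWord_prefix (i + 1)
  rw [← hl, I.prefixWord_succ i.2, List.append_assoc, List.getD_eq_getElem?_getD,
    List.getElem?_append_right (by omega), Nat.add_sub_cancel_left,
    List.getElem?_append_left (List.getElem?_eq_some_iff.1 hz).1]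
  simp [hz]

variable {I}

/-- The input word is in array `0`. -/
def HasInput (I : MaxReachInstance) (σ : Store) : Prop :=
  ∀ m : ℕ, σ.mem 0 m = I.encode.getD m 0

theorem HasInput.len {σ : Store} (h : HasInput I σ) (i : Fin I.k) :
    σ.mem 0 ((I.prefixWord i).length : ℤ) = I.graph.len i :=
  (h _).trans (I.encode_getD i (x := 0) rfl)

theorem HasInput.vert {σ : Store} (h : HasInput I σ) (i : Fin I.k) {j : ℕ}
    (hj : j < I.graph.len i + 1) :
    σ.mem 0 ((I.prefixWord i).length + 1 + j : ℤ) = I.graph.vtx i j := by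
  have h1 : (I.block i)[j + 1]? = some (I.graph.vtx i j) := by
    rw [block, List.getElem?_cons_succ, List.getElem?_append_left (by simpa using hj),
      I.graph.vtx_of_lt hj, List.getElem?_ofFn, dif_pos hj]
  have h2 := (h _).trans (I.encode_getD i h1)
  rw [← h2]
  congr 1
  push_cast
  ring

theorem HasInput.label {σ : Store} (h : HasInput I σ) (i : Fin I.k) {z : ℤ} (hz : 0 ≤ z)
    (hz' : z < I.graph.len i) :
    σ.mem 0 ((I.prefixWord i).length + 2 + I.graph.len i + z) = I.graph.lab i z := by
  lift z to ℕ using hz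
  have hj : z < I.graph.len i := by omega
  have h1 : (I.block i)[z + (I.graph.len i + 1) + 1]? = some (I.graph.lab i z) := by
    rw [block, List.getElem?_cons_succ, List.getElem?_append_right (by simp),
      I.graph.lab_natCast hj]
    simp [hj]
  have h2 := (h _).trans (I.encode_getD i h1)
  rw [← h2]
  congr 1
  push_cast
  ring

/-- The largest delay of a plan. -/
def maxDelayE : ShiftKind → Expr
  | .advanceOnly => const 0
  | _ => reg 2
/-- The largest advance of a plan. -/
def maxAdvanceE : ShiftKind → Expr
  | .delayOnly => const 0
  | _ => reg 2

/-- Reads the four numbers at the beginning of the input. -/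
def readHeader : Prog :=
  seq (assign 0 (cell 0 (const 0))) <| seq (assign 1 (cell 0 (const 1))) <|
  seq (assign 2 (cell 0 (const 2))) <| seq (assign 3 (cell 0 (const 3))) <|
  seq (assign 4 (reg 1 + reg 1)) <| seq (assign 5 (reg 4 + reg 1)) <|
  seq (assign 6 (reg 5 + reg 1)) <| seq (assign 7 (reg 6 + reg 1)) <|
  seq (assign 8 (reg 7 + reg 1)) <| seq (assign 9 (reg 8 + reg 1)) <|
  seq (assign 10 (const 0)) <| seq (assign 11 (const 4)) (assign 12 (const 0))

/-- Sets the limits of the digits for base-path `10`. -/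
def setLimits (kind : ShiftKind) : Prog :=
  seq (write 7 (reg 10) (reg 1 - const 1)) <| seq (write 7 (reg 10 + reg 1) (const 4)) <|
  seq (write 7 (reg 10 + reg 4) (maxDelayE kind)) <| seq (write 7 (reg 10 + reg 5) (reg 2)) <|
  seq (write 7 (reg 10 + reg 6) (reg 2)) <| seq (write 7 (reg 10 + reg 7) (reg 2))
    (write 7 (reg 10 + reg 8) (maxAdvanceE kind))

/-- Sets the pointers for base-path `10`. -/
def setPointers : Prog :=
  seq (write 2 (reg 10) (cell 0 (reg 11))) <| seq (write 3 (reg 10) (reg 11 + const 1)) <|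
  seq (write 4 (reg 10) (reg 11 + const 2 + cell 0 (reg 11))) <| seq (write 5 (reg 10) (reg 12))
    (assign 13 (const 0))

/-- Fills the table of positions for base-path `10`. -/
def setTable : Prog :=
  whileLe (reg 13) (cell 0 (reg 11)) <|
    seq (write 6 (reg 12 + cell 0 (reg 11 + const 1 + reg 13)) (reg 13 + const 1))
      (assign 13 (reg 13 + const 1))

/-- Moves on to the next base-path. -/
def nextPath : Prog :=
  seq (assign 12 (reg 12 + reg 0)) <|
  seq (assign 11 (reg 11 + const 2 + cell 0 (reg 11) + cell 0 (reg 11))) (assign 10 (reg 10 + const 1))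

/-- Reads the input. -/
def readInput (kind : ShiftKind) : Prog :=
  seq readHeader <| whileLe (reg 10 + const 1) (reg 1) <|
    seq (setLimits kind) <| seq setPointers <| seq setTable nextPath

/-- The registers that hold the header of the input. -/
structure Header (I : MaxReachInstance) (σ : Store) : Prop where
  r0 : σ.reg 0 = I.n
  r1 : σ.reg 1 = I.k
  r2 : σ.reg 2 = I.budget
  r3 : σ.reg 3 = (I.source : ℕ)
  r4 : σ.reg 4 = 2 * I.k
  r5 : σ.reg 5 = 3 * I.k
  r6 : σ.reg 6 = 4 * I.k
  r7 : σ.reg 7 = 5 * I.k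
  r8 : σ.reg 8 = 6 * I.k
  r9 : σ.reg 9 = 7 * I.k
  input : HasInput I σ

theorem Header.frame {σ τ : Store} {p : Prog} (h : Header I σ) (hF : Frame p σ τ)
    (hs : (p.regs.all (10 ≤ ·) && p.mems.all (1 ≤ ·)) = true) : Header I τ := by
  rw [Bool.and_eq_true, List.all_eq_true, List.all_eq_true] at hs
  have hr : ∀ x < 10, τ.reg x = σ.reg x := fun x hx => hF.1 x fun hm => by
    have := hs.1 x hm
    simp at this
    omega
  have hm : τ.mem 0 = σ.mem 0 := hF.2 0 fun hm => by
    have := hs.2 0 hm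
    simp at this
  obtain ⟨h0, h1, h2, h3, h4, h5, h6, h7, h8, h9, hin⟩ := h
  constructor
  all_goals first
    | (intro m; rw [hm]; exact hin m)
    | (rw [hr _ (by norm_num)]; assumption)

/-- The input up to base-path number `i` has been read. -/
structure ReadInv (I : MaxReachInstance) (kind : ShiftKind) (i : ℕ) (σ : Store) : Prop where
  r10 : σ.reg 10 = i
  r11 : σ.reg 11 = (I.prefixWord i).length
  r12 : σ.reg 12 = (i * I.n : ℕ)
  len : ∀ c : Fin I.k, (c : ℕ) < i → σ.mem 2 (c : ℕ) = I.graph.len c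
  vert : ∀ c : Fin I.k, (c : ℕ) < i → σ.mem 3 (c : ℕ) = (I.prefixWord c).length + 1
  label : ∀ c : Fin I.k, (c : ℕ) < i →
    σ.mem 4 (c : ℕ) = (I.prefixWord c).length + 2 + I.graph.len c
  row : ∀ c : Fin I.k, (c : ℕ) < i → σ.mem 5 (c : ℕ) = (c * I.n : ℕ)
  posn : ∀ c : Fin I.k, (c : ℕ) < i → ∀ v : Fin I.n,
    σ.mem 6 ((c * I.n + v : ℕ) : ℤ) = I.graph.posn c (v : ℕ)
  free : ∀ m : ℕ, i * I.n ≤ m → σ.mem 6 (m : ℤ) = 0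
  lim : ∀ c : Fin I.k, (c : ℕ) < i → σ.mem 7 (c : ℕ) = I.k - 1 ∧ σ.mem 7 (c + I.k) = 4 ∧
    σ.mem 7 (c + 2 * I.k) = kind.maxDelay I.budget ∧ σ.mem 7 (c + 3 * I.k) = I.budget ∧
    σ.mem 7 (c + 4 * I.k) = I.budget ∧ σ.mem 7 (c + 5 * I.k) = I.budget ∧
    σ.mem 7 (c + 6 * I.k) = kind.maxAdvance I.budget

variable {kind : ShiftKind} {σ : Store}

theorem readHeader_spec : Wp readHeader (Store.init I.encode) 60 fun τ =>
    Header I τ ∧ ReadInv I kind 0 τ := by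
  refine Wp.exec rfl (by decide) fun _ => ⟨?_, ?_⟩
  · have hr : ∀ m : ℕ, m < 4 → (Store.init I.encode).mem 0 m = I.encode.getD m 0 := fun m _ => by
      simp [Store.init]
    constructor
    case input => exact fun m => by simp [readHeader, exec, Store.init]
    all_goals
      simp [readHeader, exec, Store.init, encode] <;> ring
  · constructor <;> simp [readHeader, exec, Store.init, prefixWord]

theorem setLimits_spec {i : ℕ} (hi : i < I.k) (hH : Header I σ) (hI : ReadInv I kind i σ) :
    Wp (setLimits kind) σ 100 fun τ => ∀ c : Fin I.k, (c : ℕ) < i + 1 →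
      τ.mem 7 (c : ℕ) = I.k - 1 ∧ τ.mem 7 (c + I.k) = 4 ∧
      τ.mem 7 (c + 2 * I.k) = kind.maxDelay I.budget ∧ τ.mem 7 (c + 3 * I.k) = I.budget ∧
      τ.mem 7 (c + 4 * I.k) = I.budget ∧ τ.mem 7 (c + 5 * I.k) = I.budget ∧
      τ.mem 7 (c + 6 * I.k) = kind.maxAdvance I.budget := by
  refine Wp.exec rfl (by cases kind <;> decide) fun _ c hc => ?_
  have hd : ∀ τ : Store, τ.reg = σ.reg → (maxDelayE kind).eval τ = kind.maxDelay I.budget :=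
    fun τ h => by cases kind <;> simp [maxDelayE, ShiftKind.maxDelay, h, hH.r2]
  have ha : ∀ τ : Store, τ.reg = σ.reg → (maxAdvanceE kind).eval τ = kind.maxAdvance I.budget :=
    fun τ h => by cases kind <;> simp [maxAdvanceE, ShiftKind.maxAdvance, h, hH.r2]
  have hmem : ((setLimits kind).exec σ).mem 7 = Function.update (Function.update (Function.update
      (Function.update (Function.update (Function.update (Function.update (σ.mem 7)
      i (I.k - 1)) (i + I.k) 4) (i + 2 * I.k) (kind.maxDelay I.budget)) (i + 3 * I.k) I.budget)
      (i + 4 * I.k) I.budget) (i + 5 * I.k) I.budget) (i + 6 * I.k)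
      (kind.maxAdvance I.budget) := by
    simp only [setLimits, exec, Store.setMem_mem, Store.setMem_reg, if_true, eval_reg, eval_add,
      eval_sub, eval_const, hI.r10, hH.r1, hH.r2, hH.r4, hH.r5, hH.r6, hH.r7, hH.r8]
    rw [hd _ (by simp), ha _ (by simp)]
  rw [hmem]
  have hck := c.2
  rcases Nat.lt_succ_iff_lt_or_eq.1 hc with hc | hc
  · have hl := hI.lim c hc
    refine ⟨?_, ?_, ?_, ?_, ?_, ?_, ?_⟩
    all_goals
      iterate 7 rw [Function.update_of_ne (by omega)]
    exacts [hl.1, hl.2.1, hl.2.2.1, hl.2.2.2.1, hl.2.2.2.2.1, hl.2.2.2.2.2.1, hl.2.2.2.2.2.2]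
  · rw [hc]
    refine ⟨?_, ?_, ?_, ?_, ?_, ?_, ?_⟩
    all_goals
      repeat rw [Function.update_of_ne (by omega)]
      rw [Function.update_self]

/-- Untouched cells hold 0, which is just the value of `posn` for a vertex off the base-path. So it
is enough to visit the vertices of the path; after `j` of them the row is right for all vertices
with `posn` at most `j`. -/
theorem setTable_spec {i : Fin I.k} (hH : Header I σ)
    (h11 : σ.reg 11 = (I.prefixWord i).length) (h12 : σ.reg 12 = (i * I.n : ℕ))
    (h13 : σ.reg 13 = 0)
    (hpos : ∀ c : Fin I.k, (c : ℕ) < i → ∀ v : Fin I.n,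
      σ.mem 6 ((c * I.n + v : ℕ) : ℤ) = I.graph.posn c (v : ℕ))
    (hfree : ∀ m : ℕ, i * I.n ≤ m → σ.mem 6 (m : ℤ) = 0) :
    Wp setTable σ ((I.graph.len i + 2) * 30) fun τ =>
      (∀ c : Fin I.k, (c : ℕ) < i + 1 → ∀ v : Fin I.n,
        τ.mem 6 ((c * I.n + v : ℕ) : ℤ) = I.graph.posn c (v : ℕ)) ∧
      ∀ m : ℕ, (i + 1) * I.n ≤ m → τ.mem 6 (m : ℤ) = 0 := by
  refine (Wp.while_count (B := 26) (I.graph.len i + 1) (fun j τ => τ.reg 13 = j ∧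
    (∀ c : Fin I.k, (c : ℕ) < i → ∀ v : Fin I.n,
      τ.mem 6 ((c * I.n + v : ℕ) : ℤ) = I.graph.posn c (v : ℕ)) ∧
    (∀ v : Fin I.n, τ.mem 6 ((i * I.n + v : ℕ) : ℤ) =
      if I.graph.posn i (v : ℕ) ≤ j then I.graph.posn i (v : ℕ) else 0) ∧
    ∀ m : ℕ, (i + 1) * I.n ≤ m → τ.mem 6 (m : ℤ) = 0) ⟨by simp [h13], hpos, ?_, ?_⟩ ?_ ?_).mono
      (by simp [Expr.cost]) ?_
  · intro v
    rw [hfree _ (Nat.le_add_right _ _)]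
    rcases I.graph.posn_cases i (v : ℕ) with h | ⟨j, -, h⟩
    · simp [h]
    · rw [if_neg (by push_cast; omega)]
  · exact fun m hm => hfree m ((Nat.mul_le_mul_right _ (Nat.le_succ _)).trans hm)
  · rintro j τ hj hF ⟨h1, h2, h3, h4⟩
    have hH' : Header I τ := hH.frame hF rfl
    have h11' : τ.reg 11 = (I.prefixWord i).length := by rw [hF.1 11 (by decide), h11]
    have h12' : τ.reg 12 = (i * I.n : ℕ) := by rw [hF.1 12 (by decide), h12]
    refine ⟨by simp [h1, h11', hH'.input.len]; omega, Wp.exec rfl (by decide) fun _ => ?_⟩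
    have hin := hH'.input.vert i hj
    rw [I.graph.vtx_of_lt hj] at hin
    set w := I.graph.vert i ⟨j, hj⟩ with hw
    have hpw : I.graph.posn i (w : ℕ) = j + 1 := I.graph.posn_vert i ⟨j, hj⟩
    have hmem : ∀ m : ℕ, (Prog.exec (seq (write 6 (reg 12 + cell 0 (reg 11 + const 1 + reg 13))
        (reg 13 + const 1)) (assign 13 (reg 13 + const 1))) τ).mem 6 (m : ℤ) =
        if m = i * I.n + w then (j : ℤ) + 1 else τ.mem 6 (m : ℤ) := by
      intro m
      simp only [exec, Store.setReg_mem, Store.setMem_mem, if_true, eval_add, eval_reg, eval_cell,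
        eval_const, h11', h12', h1, hin, Function.update_apply]
      exact if_congr (by omega) rfl rfl
    refine ⟨by simp [exec, h1], ?_, ?_, ?_⟩
    · intro c hc v
      rw [hmem, if_neg, h2 c hc v]
      have := Nat.mul_le_mul_right I.n (Nat.succ_le_of_lt hc)
      have := v.2
      rw [Nat.succ_mul] at *
      omega
    · intro v
      rw [hmem]
      by_cases hv : v = w
      · subst hv
        rw [if_pos rfl, hpw, if_pos (by push_cast; omega)]
      · have hv' : (v : ℕ) ≠ w := fun h => hv (Fin.ext h)
        rw [if_neg (by omega), h3 v]
        refine if_congr ⟨fun h => by push_cast; omega, fun h => ?_⟩ rfl rfl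
        rcases I.graph.posn_cases i (v : ℕ) with h5 | ⟨j', h5, h6⟩
        · omega
        · rcases (show (j' : ℕ) = j ∨ (j' : ℕ) < j by push_cast at h; omega) with h7 | h7
          · refine absurd ?_ hv
            rw [hw, ← (Fin.ext h7 : j' = ⟨j, hj⟩)]
            exact Fin.ext (by exact_mod_cast h5.symm)
          · omega
    · intro m hm
      rw [hmem, if_neg, h4 m hm]
      have := w.2
      rw [Nat.succ_mul] at hm
      omega
  · rintro τ hF ⟨h1, -⟩
    have h11' : τ.reg 11 = (I.prefixWord i).length := by rw [hF.1 11 (by decide), h11]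
    simp [h1, h11', (hH.frame hF rfl).input.len]
  · rintro τ _ ⟨-, h2, h3, h4⟩
    refine ⟨fun c hc v => ?_, h4⟩
    rcases Nat.lt_succ_iff_lt_or_eq.1 hc with hc | hc
    · exact h2 c hc v
    · obtain rfl : c = i := Fin.ext hc
      rw [h3 v]
      rcases I.graph.posn_cases c (v : ℕ) with h5 | ⟨j', h5, h6⟩
      · simp [h5]
      · have := j'.2
        rw [if_pos (by push_cast; omega)]

/-- A bound for the time of `readInput`. -/
def readTime (k S : ℕ) : ℕ := 60 + (k + 1) * (200 + (S + 2) * 30)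

theorem readInput_spec {S : ℕ} (hS : ∀ c, I.graph.len c ≤ S) :
    Wp (readInput kind) (Store.init I.encode) (readTime I.k S) (I.Env kind) := by
  refine Wp.seq (readHeader_spec (kind := kind)) ?_
  rintro σ₁ - ⟨hH, hI⟩
  refine (Wp.while_count (B := 195 + (S + 2) * 30) I.k (fun i τ => Header I τ ∧ ReadInv I kind i τ)
    ⟨hH, hI⟩ ?_ ?_).mono (Nat.mul_le_mul le_rfl (by simp [Expr.cost]; omega)) ?_
  · rintro i τ hi - ⟨hH, hI⟩
    refine ⟨by simp [hI.r10, hH.r1]; omega, ?_⟩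
    refine (Wp.seq (setLimits_spec hi hH hI) (U := 95 + (S + 2) * 30) ?_).mono (by omega)
      fun _ _ h => h
    rintro τ₁ hF1 hlim
    have hs1 : ∀ x, x ≠ 7 → τ₁.mem x = τ.mem x := fun x hx =>
      hF1.2 x (by simpa [setLimits, mems] using hx)
    have hr1 : ∀ x, τ₁.reg x = τ.reg x := fun x => hF1.1 x (by simp [setLimits, regs])
    have hH1 : Header I τ₁ := hH.frame hF1 rfl
    have e10 : τ₁.reg 10 = i := by rw [hr1, hI.r10]
    have e11 : τ₁.reg 11 = (I.prefixWord i).length := by rw [hr1, hI.r11]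
    have e12 : τ₁.reg 12 = (i * I.n : ℕ) := by rw [hr1, hI.r12]
    have elen := hH1.input.len ⟨i, hi⟩
    simp only at elen
    refine (Wp.seq (T := 40) (U := 40 + (S + 2) * 30) (Wp.exec rfl (by decide)
      (Q := fun υ => υ.reg 13 = 0 ∧
        υ.mem 2 = Function.update (τ₁.mem 2) i (I.graph.len ⟨i, hi⟩) ∧
        υ.mem 3 = Function.update (τ₁.mem 3) i ((I.prefixWord i).length + 1) ∧
        υ.mem 4 = Function.update (τ₁.mem 4) i ((I.prefixWord i).length + 2 + I.graph.len ⟨i, hi⟩) ∧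
        υ.mem 5 = Function.update (τ₁.mem 5) i (i * I.n : ℕ)) fun _ => ?_) ?_).mono (by omega)
        fun _ _ h => h
    · simp [setPointers, exec, e10, e11, e12, elen]
    rintro τ₂ hF2 ⟨f13, f2, f3, f4, f5⟩
    have hH2 : Header I τ₂ := hH1.frame hF2 rfl
    have f6 : τ₂.mem 6 = τ.mem 6 := by rw [hF2.2 6 (by decide), hs1 6 (by decide)]
    have f7 : τ₂.mem 7 = τ₁.mem 7 := by rw [hF2.2 7 (by decide)]
    refine (Wp.seq (U := 40) ((setTable_spec (i := ⟨i, hi⟩) hH2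
      (by rw [hF2.1 11 (by decide), e11]) (by rw [hF2.1 12 (by decide), e12]) f13
      (by rw [f6]; exact hI.posn) (by rw [f6]; exact hI.free)).mono
      (T' := (S + 2) * 30) (by have := hS ⟨i, hi⟩; gcongr) fun _ _ h => h) ?_).mono (by omega)
      fun _ _ h => h
    rintro τ₃ hF3 ⟨g1, g2⟩
    have hH3 : Header I τ₃ := hH2.frame hF3 rfl
    refine Wp.exec rfl (by decide) fun hF4 => ⟨hH3.frame hF4 rfl, ?_⟩
    have k10 : τ₃.reg 10 = i := by rw [hF3.1 10 (by decide), hF2.1 10 (by decide), e10]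
    have k11 : τ₃.reg 11 = (I.prefixWord i).length := by
      rw [hF3.1 11 (by decide), hF2.1 11 (by decide), e11]
    have k12 : τ₃.reg 12 = (i * I.n : ℕ) := by
      rw [hF3.1 12 (by decide), hF2.1 12 (by decide), e12]
    have klen := hH3.input.len ⟨i, hi⟩
    simp only at klen
    have km : (nextPath.exec τ₃).mem = τ₃.mem := rfl
    have upd : ∀ (c : Fin I.k) (f : ℤ → ℤ) (a : Fin I.k → ℤ), (c : ℕ) < i + 1 →
        ((c : ℕ) < i → f (c : ℕ) = a c) →
        Function.update f (i : ℤ) (a ⟨i, hi⟩) (c : ℕ) = a c := by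
      intro c f a hc h
      rcases Nat.lt_succ_iff_lt_or_eq.1 hc with hc | hc
      · rw [Function.update_of_ne (by omega), h hc]
      · obtain rfl : c = ⟨i, hi⟩ := Fin.ext hc
        exact Function.update_self _ _ _
    refine ⟨?_, ?_, ?_, fun c hc => ?_, fun c hc => ?_, fun c hc => ?_, fun c hc => ?_, ?_, ?_, ?_⟩
    · simp [nextPath, exec, k10]
    · rw [I.prefixWord_succ hi, List.length_append, I.block_length]
      simp [nextPath, exec, k11, klen]
      ring
    · simp [nextPath, exec, k12, hH3.r0]
      ring
    · rw [km, hF3.2 2 (by decide), f2, hs1 2 (by decide)]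
      exact upd c _ (fun c => I.graph.len c) hc (hI.len c)
    · rw [km, hF3.2 3 (by decide), f3, hs1 3 (by decide)]
      exact upd c _ (fun c => (I.prefixWord c).length + 1) hc (hI.vert c)
    · rw [km, hF3.2 4 (by decide), f4, hs1 4 (by decide)]
      exact upd c _ (fun c => (I.prefixWord c).length + 2 + I.graph.len c) hc (hI.label c)
    · rw [km, hF3.2 5 (by decide), f5, hs1 5 (by decide)]
      exact upd c _ (fun c => (c * I.n : ℕ)) hc (hI.row c)
    · rw [km]
      exact g1
    · rw [km]
      exact g2
    · rw [km, hF3.2 7 (by decide), f7]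
      exact hlim
  · rintro τ - ⟨hH, hI⟩
    simp [hI.r10, hH.r1]
  · rintro τ - ⟨hH, hI⟩
    obtain ⟨h0, h1, h2, h3, h4, h5, h6, h7, h8, h9, hin⟩ := hH
    refine ⟨h0, h1, h2, h3, h4, h5, h6, h7, h8, h9, fun i => hI.len i i.2, fun i j hj => ?_,
      fun i z hz hz' => ?_, fun i v => ?_, fun c => hI.lim c c.2⟩
    · rw [hI.vert i i.2]
      exact hin.vert i hj
    · rw [hI.label i i.2]
      exact hin.label i hz hz'
    · rw [hI.row i i.2, ← hI.posn i i.2 v]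
      push_cast
      rfl

end MaxReachInstance

/-! ### Counting through all plans -/

/-- The number with the given digits, where digit `i` is at most `L i`. -/
def mixedRadix (L D : ℕ → ℕ) (N : ℕ) : ℕ :=
  ∑ i ∈ Finset.range N, D i * ∏ j ∈ Finset.range i, (L j + 1)

section mixedRadix

variable {L D D' : ℕ → ℕ} {N : ℕ}

theorem mixedRadix_succ : mixedRadix L D (N + 1) =
    mixedRadix L D N + D N * ∏ j ∈ Finset.range N, (L j + 1) := Finset.sum_range_succ _ _

theorem mixedRadix_lt (h : ∀ i < N, D i ≤ L i) :
    mixedRadix L D N < ∏ j ∈ Finset.range N, (L j + 1) := by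
  induction N with
  | zero => simp [mixedRadix]
  | succ N ih =>
    rw [mixedRadix_succ, Finset.prod_range_succ]
    have h1 := ih fun i hi => h i (by omega)
    have h2 := Nat.mul_le_mul_right (∏ j ∈ Finset.range N, (L j + 1)) (h N (by omega))
    rw [mul_comm _ (L N + 1), add_mul, one_mul]
    omega

theorem mixedRadix_injective (h : ∀ i < N, D i ≤ L i) (h' : ∀ i < N, D' i ≤ L i)
    (hD : mixedRadix L D N = mixedRadix L D' N) : ∀ i < N, D i = D' i := by
  induction N with
  | zero => simp
  | succ N ih =>
    have h1 := mixedRadix_lt (D := D) (N := N) fun i hi => h i (by omega)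
    have h2 := mixedRadix_lt (D := D') (N := N) fun i hi => h' i (by omega)
    rw [mixedRadix_succ, mixedRadix_succ] at hD
    set W := ∏ j ∈ Finset.range N, (L j + 1)
    have hW : 0 < W := by omega
    have h3 : D N = D' N := by
      have := congrArg (· / W) hD
      simpa [Nat.add_mul_div_right _ _ hW, Nat.div_eq_of_lt h1, Nat.div_eq_of_lt h2] using this
    rw [h3] at hD
    intro i hi
    rcases Nat.lt_succ_iff_lt_or_eq.1 hi with hi | rfl
    · exact ih (fun i hi => h i (by omega)) (fun i hi => h' i (by omega)) (by omega) i hi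
    · exact h3

theorem mixedRadix_of_eq_limit (h : ∀ i < N, D i = L i) :
    mixedRadix L D N + 1 = ∏ j ∈ Finset.range N, (L j + 1) := by
  induction N with
  | zero => simp [mixedRadix]
  | succ N ih =>
    rw [mixedRadix_succ, Finset.prod_range_succ, ← ih fun i hi => h i (by omega), h N (by omega)]
    ring

theorem mixedRadix_zero (h : ∀ i < N, D i = 0) : mixedRadix L D N = 0 :=
  Finset.sum_eq_zero fun i hi => by rw [h i (Finset.mem_range.1 hi), zero_mul]

/-- This is the carry: full digits below `m` are worth one less than the weight of digit `m`. -/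
theorem mixedRadix_increment {m : ℕ} (hm : m < N) (h : ∀ i < m, D i = L i) (h0 : ∀ i < m, D' i = 0)
    (h1 : D' m = D m + 1) (h2 : ∀ i, m < i → i < N → D' i = D i) :
    mixedRadix L D' N = mixedRadix L D N + 1 := by
  induction N with
  | zero => omega
  | succ N ih =>
    rw [mixedRadix_succ, mixedRadix_succ]
    rcases Nat.lt_succ_iff_lt_or_eq.1 hm with hm | rfl
    · rw [ih hm fun i hi hi' => h2 i hi (by omega), h2 N hm (by omega)]
      ring
    · rw [mixedRadix_zero h0, h1, ← mixedRadix_of_eq_limit h]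
      ring

end mixedRadix

/-! ### Plans as strings of digits -/

namespace MaxReachInstance

open KPathGraph Ram Ram.Prog Ram.Expr

/-- The limits of the digits of a plan. -/
def limits (I : MaxReachInstance) (kind : ShiftKind) (j : ℕ) : ℕ :=
  match j / I.k with
  | 0 => I.k - 1
  | 1 => 4
  | 2 => kind.maxDelay I.budget
  | 3 => I.budget
  | 4 => I.budget
  | 5 => I.budget
  | _ => kind.maxAdvance I.budget

/-- The plan with the given digits. -/
def planOfDigits {k : ℕ} (D : ℕ → ℕ) : Plan k where
  par c := ⟨D c % k, Nat.mod_lt _ c.pos⟩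
  ty c := D (c + 1 * k)
  dl c := D (c + 2 * k)
  dr c := D (c + 3 * k)
  need c := D (c + 4 * k)
  gap c := D (c + 5 * k)
  adv c := D (c + 6 * k)

/-- The digits of a plan. -/
def digits {k : ℕ} (g : Plan k) (j : ℕ) : ℕ :=
  if h : 0 < k then
    let c : Fin k := ⟨j % k, Nat.mod_lt _ h⟩
    match j / k with
    | 0 => g.par c
    | 1 => g.ty c
    | 2 => g.dl c
    | 3 => g.dr c
    | 4 => g.need c
    | 5 => g.gap c
    | _ => g.adv c
  else 0

theorem digit_div {k : ℕ} (c : Fin k) (m : ℕ) : ((c : ℕ) + m * k) / k = m := by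
  rw [Nat.add_mul_div_right _ _ c.pos, Nat.div_eq_of_lt c.2, zero_add]

theorem digit_mod {k : ℕ} (c : Fin k) (m : ℕ) : ((c : ℕ) + m * k) % k = c := by
  rw [Nat.add_mul_mod_self_right, Nat.mod_eq_of_lt c.2]

theorem exists_digit {k j : ℕ} (hj : j < 7 * k) : ∃ (c : Fin k) (m : ℕ), m < 7 ∧ j = c + m * k := by
  have hk : 0 < k := by omega
  refine ⟨⟨j % k, Nat.mod_lt _ hk⟩, j / k, Nat.div_lt_of_lt_mul (by rwa [mul_comm]), ?_⟩
  rw [mul_comm]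
  exact (Nat.mod_add_div j k).symm

theorem planOfDigits_digits {k : ℕ} (g : Plan k) : planOfDigits (digits g) = g := by
  have key : ∀ c : Fin k, (⟨(c : ℕ) % k, Nat.mod_lt _ c.pos⟩ : Fin k) = c :=
    fun c => Fin.ext (Nat.mod_eq_of_lt c.2)
  have h0 : ∀ c : Fin k, digits g c = g.par c := fun c => by
    have h := digit_div c 0
    rw [zero_mul, add_zero] at h
    simp [digits, c.pos, h, key]
  obtain ⟨par, ty, dl, dr, need, gap, adv⟩ := g
  simp only [planOfDigits, Plan.mk.injEq]
  refine ⟨?_, ?_, ?_, ?_, ?_, ?_, ?_⟩ <;> funext c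
  · refine Fin.ext ?_
    change digits _ (c : ℕ) % k = _
    rw [h0]
    exact Nat.mod_eq_of_lt (par c).2
  all_goals simp only [digits, c.pos, dif_pos, digit_div, digit_mod]

variable {I : MaxReachInstance} {kind : ShiftKind} {σ : Store}

theorem limits_digit (c : Fin I.k) (m : ℕ) : I.limits kind (c + m * I.k) = match m with
    | 0 => I.k - 1
    | 1 => 4
    | 2 => kind.maxDelay I.budget
    | 3 => I.budget
    | 4 => I.budget
    | 5 => I.budget
    | _ => kind.maxAdvance I.budget := by
  rw [limits, digit_div]

theorem Env.limits (hE : I.Env kind σ) {j : ℕ} (hj : j < 7 * I.k) :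
    σ.mem 7 (j : ℤ) = I.limits kind j := by
  obtain ⟨c, m, hm, rfl⟩ := exists_digit hj
  rw [limits_digit]
  have := hE.lim c
  have hc := c.pos
  interval_cases m <;> simp_all

theorem digits_le_limits {g : Plan I.k} (hg : Plan.Admissible g kind I.budget) {j : ℕ}
    (hj : j < 7 * I.k) : digits g j ≤ I.limits kind j := by
  obtain ⟨c, m, hm, rfl⟩ := exists_digit hj
  rw [limits_digit, digits, dif_pos c.pos]
  simp only [digit_div]
  interval_cases m
  · exact Nat.le_sub_one_of_lt (Fin.is_lt _)
  exacts [hg.ty _, hg.dl _, hg.dr _, hg.need _, hg.gap _, hg.adv _]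

theorem admissible_planOfDigits {D : ℕ → ℕ} (h : ∀ j < 7 * I.k, D j ≤ I.limits kind j) :
    Plan.Admissible (planOfDigits D : Plan I.k) kind I.budget := by
  have key : ∀ (c : Fin I.k) (m : ℕ), m < 7 → D (c + m * I.k) ≤ I.limits kind (c + m * I.k) :=
    fun c m hm => h _ (by have := Nat.mul_le_mul_right I.k (Nat.le_of_lt_succ hm); omega)
  simp only [limits_digit] at key
  exact ⟨fun c => key c 1 (by norm_num), fun c => key c 2 (by norm_num),
    fun c => key c 3 (by norm_num), fun c => key c 4 (by norm_num), fun c => key c 5 (by norm_num),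
    fun c => key c 6 (by norm_num)⟩

/-- The remainder modulo k in `planOfDigits` only serves to land in `Fin k`; within the limit k - 1
it changes nothing. -/
theorem hasPlan_planOfDigits {D : ℕ → ℕ} (h : ∀ j < 7 * I.k, D j ≤ I.limits kind j)
    (hD : ∀ j < 7 * I.k, σ.mem 8 (j : ℤ) = D j) : HasPlan (planOfDigits D : Plan I.k) σ := by
  have key : ∀ (c : Fin I.k) (m : ℕ), m < 7 → σ.mem 8 (c + m * I.k) = D (c + m * I.k) :=
    fun c m hm => by
      rw [← hD _ (by have := Nat.mul_le_mul_right I.k (Nat.le_of_lt_succ hm); omega)]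
      push_cast
      rfl
  refine ⟨fun c => ?_, fun c => ?_, fun c => key c 2 (by norm_num), fun c => key c 3 (by norm_num),
    fun c => key c 4 (by norm_num), fun c => key c 5 (by norm_num), fun c => key c 6 (by norm_num)⟩
  · have h1 := key c 0 (by norm_num)
    have h2 := h c (by omega)
    have h3 := limits_digit (kind := kind) c 0
    simp only [Nat.cast_zero, zero_mul, add_zero] at h1 h3
    rw [h1, planOfDigits]
    simp only
    rw [Nat.mod_eq_of_lt (by have := c.pos; omega)]
  · have h1 := key c 1 (by norm_num)
    rw [Nat.cast_one, one_mul] at h1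
    exact h1

/-- Moves on to the next plan.  Sets register `21` to `0` if there is none. -/
def nextPlan : Prog :=
  seq (seq (assign 21 (const 0)) (assign 14 (const 0))) <|
  whileLe (reg 14 + const 1) (reg 9) <| ifLe (cell 7 (reg 14)) (cell 8 (reg 14))
    (seq (write 8 (reg 14) (const 0)) (assign 14 (reg 14 + const 1)))
    (seq (write 8 (reg 14) (cell 8 (reg 14) + const 1)) <|
      seq (assign 21 (const 1)) (assign 14 (reg 9)))

/-- Full digits are reset until one can be increased. If all are full, the current plan has the last
number. -/
theorem nextPlan_spec (hE : I.Env kind σ) {D : ℕ → ℕ} (h : ∀ j < 7 * I.k, D j ≤ I.limits kind j)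
    (hD : ∀ j < 7 * I.k, σ.mem 8 (j : ℤ) = D j) :
    Wp nextPlan σ (4 + (7 * I.k + 1) * 40) fun τ =>
      (τ.reg 21 = 0 ∧ mixedRadix (I.limits kind) D (7 * I.k) + 1 =
        ∏ j ∈ Finset.range (7 * I.k), (I.limits kind j + 1)) ∨
      (τ.reg 21 = 1 ∧ ∃ D' : ℕ → ℕ, (∀ j < 7 * I.k, D' j ≤ I.limits kind j) ∧
        (∀ j < 7 * I.k, τ.mem 8 (j : ℤ) = D' j) ∧ mixedRadix (I.limits kind) D' (7 * I.k) =
          mixedRadix (I.limits kind) D (7 * I.k) + 1) := by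
  refine Wp.seq (Wp.exec (T := 4) rfl (by decide)
    (Q := fun τ => τ.reg 21 = 0 ∧ τ.reg 14 = 0 ∧ τ.mem 8 = σ.mem 8) fun _ => by simp [exec]) ?_
  rintro σ₁ hF1 ⟨h1, h2, h3⟩
  have hE1 := hE.frame hF1 rfl
  refine (Wp.while_variant (B := 35) (fun τ => ∃ m : ℕ, τ.reg 14 = m ∧ m ≤ 7 * I.k ∧
    ((τ.reg 21 = 0 ∧ (∀ i < m, D i = I.limits kind i ∧ τ.mem 8 (i : ℤ) = 0) ∧
      ∀ i, m ≤ i → i < 7 * I.k → τ.mem 8 (i : ℤ) = D i) ∨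
    (m = 7 * I.k ∧ τ.reg 21 = 1 ∧ ∃ D' : ℕ → ℕ, (∀ j < 7 * I.k, D' j ≤ I.limits kind j) ∧
        (∀ j < 7 * I.k, τ.mem 8 (j : ℤ) = D' j) ∧ mixedRadix (I.limits kind) D' (7 * I.k) =
          mixedRadix (I.limits kind) D (7 * I.k) + 1))) (fun τ => (7 * I.k - τ.reg 14).toNat)
    ⟨0, by simp [h2], by omega, .inl ⟨h1, by simp, fun i _ hi => by rw [h3, hD i hi]⟩⟩ ?_).mono
    (Nat.mul_le_mul (by simp [h2]) (by simp [Expr.cost])) ?_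
  · rintro τ hF ⟨m, h4, h5, h6⟩ hc
    have hE2 := hE1.frame hF rfl
    have hm : m < 7 * I.k := by
      simp only [eval_add, eval_reg, eval_const, h4, hE2.r9] at hc
      omega
    obtain ⟨h6, h7, h8⟩ := h6.resolve_right fun h => by omega
    refine Wp.exec rfl (by decide) fun _ => ?_
    have hlim := hE2.limits hm
    have hdig := h8 m le_rfl hm
    have hle := h m hm
    rw [exec_ifLe]
    simp only [eval_cell, eval_reg, h4, hlim, hdig]
    split_ifs with h9
    · refine ⟨⟨m + 1, by simp [exec, h4], hm, .inl ⟨by simp [exec, h6], fun i hi => ?_,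
        fun i hi hi' => ?_⟩⟩, by simp [exec, h4]; omega⟩
      · simp only [exec, Store.setReg_mem, Store.setMem_mem, if_true, eval_reg, eval_const, h4]
        rcases Nat.lt_succ_iff_lt_or_eq.1 hi with hi | rfl
        · rw [Function.update_of_ne (by omega)]
          exact h7 i hi
        · rw [Function.update_self]
          exact ⟨by omega, rfl⟩
      · simp only [exec, Store.setReg_mem, Store.setMem_mem, if_true, eval_reg, eval_const, h4]
        rw [Function.update_of_ne (by omega), h8 i (by omega) hi']
    · refine ⟨⟨7 * I.k, by simp [exec, hE2.r9], le_rfl, .inr ⟨rfl, by simp [exec],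
        fun i => if i < m then 0 else if i = m then D m + 1 else D i, fun j hj => ?_, fun j hj => ?_,
        mixedRadix_increment hm (fun i hi => (h7 i hi).1) (fun i hi => if_pos hi) (by simp)
          fun i hi hi' => ?_⟩⟩, by simp [exec, h4, hE2.r9]; omega⟩
      · have := h j hj
        simp only
        split_ifs with h10 h11
        · omega
        · subst h11
          omega
        · omega
      · simp only [exec, Store.setReg_mem, Store.setMem_mem, if_true, eval_reg, eval_const, eval_add,
          eval_cell, h4, hdig]
        split_ifs with h10 h11
        · rw [Function.update_of_ne (by omega), (h7 j h10).2, Nat.cast_zero]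
        · rw [h11, Function.update_self]
          push_cast
          rfl
        · rw [Function.update_of_ne (by omega), h8 j (by omega) hj]
      · rw [if_neg (by omega), if_neg (by omega)]
  · rintro τ hF ⟨⟨m, h4, h5, h6⟩, hc⟩
    have hE2 := hE1.frame hF rfl
    have hm : m = 7 * I.k := by
      simp only [eval_add, eval_reg, eval_const, h4, hE2.r9] at hc
      omega
    rcases h6 with ⟨h6, h7, -⟩ | ⟨-, h⟩
    · exact .inl ⟨h6, mixedRadix_of_eq_limit fun i hi => (h7 i (by omega)).1⟩
    · exact .inr h

end MaxReachInstance

/-! ### The search -/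

namespace MaxReachInstance

open KPathGraph Ram Ram.Prog Ram.Expr

variable {I : MaxReachInstance} {kind : ShiftKind} {σ : Store}

/-- Register `20` holds `best`, which is `-1` or at most the value of the output. -/
structure BestSoFar (I : MaxReachInstance) (kind : ShiftKind) (best : ℤ) (σ : Store) : Prop where
  reg : σ.reg 20 = best
  out : best = -1 ∨ ∃ ops, I.IsFeasible kind ops ∧ σ.HasOutput (encodeOps ops) ∧
    best ≤ I.value ops

theorem BestSoFar.congr {best : ℤ} {τ : Store} (h : BestSoFar I kind best σ)
    (hr : τ.reg 20 = σ.reg 20) (hm : τ.mem 1 = σ.mem 1) : BestSoFar I kind best τ := by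
  refine ⟨hr.trans h.reg, h.out.imp_right ?_⟩
  rintro ⟨ops, h1, h2, h3⟩
  exact ⟨ops, h1, fun m hm' => by rw [hm]; exact h2 m hm', h3⟩

/-- Tries the current plan, and writes its operations to the output if it is the best so far. -/
def tryPlan : Prog :=
  seq searchPos <| ifLe (reg 22) (const 0)
    (seq countServed <| ifLe (reg 20 + const 1) (reg 38) (seq (assign 20 (reg 38)) emitOps) skip)
    skip

/-- A bound for the time of `tryPlan`. -/
def tryTime (I : MaxReachInstance) : ℕ :=
  searchTime I + (3 + (countTime I.n I.k (∑ c, I.graph.len c) +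
    (5 + (2 + emitOpsTime I.k (∑ c, I.graph.len c)))))

/-- Counting at the least consistent positions bounds the served count of every consistent choice
for this plan. The output is replaced only by a strict improvement, and its true value may exceed
the count, so the record is a lower bound for it. -/
theorem tryPlan_spec {best : ℤ} {g : Plan I.k} (hE : I.Env kind σ) (hg : HasPlan g σ)
    (ha : Plan.Admissible g kind I.budget) (hb : BestSoFar I kind best σ) :
    Wp tryPlan σ (tryTime I) fun τ => ∃ best', best ≤ best' ∧ BestSoFar I kind best' τ ∧
      ∀ p, I.graph.Consistent I.source g p → ∑ c, (g.dl c + g.adv c) ≤ I.budget →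
        ((I.graph.served I.source g p).ncard : ℤ) ≤ best' := by
  have hS : ∀ c, I.graph.len c ≤ ∑ c, I.graph.len c := fun c =>
    Finset.single_le_sum (f := I.graph.len) (fun _ _ => Nat.zero_le _) (Finset.mem_univ c)
  refine Wp.seq (searchPos_spec hE hg) ?_
  rintro σ₁ hF1 h1
  have hE1 := hE.frame hF1 rfl
  have hg1 := hg.frame hF1 rfl
  have hb1 := hb.congr (hF1.1 20 (by decide)) (hF1.2 1 (by decide))
  refine Wp.ifLe (fun hc => ?_) fun hc => ?_
  · obtain ⟨-, hcost, p, hp, hcons, hleast, hal⟩ := h1.resolve_left (by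
      rintro ⟨h1, -⟩
      simp [h1] at hc)
    refine Wp.seq (countServed_spec hE1 hg1 hp hcons.lt hS) ?_
    rintro σ₂ hF2 h38
    have hE2 := hE1.frame hF2 rfl
    have hg2 := hg1.frame hF2 rfl
    have hp2 := hp.frame hF2 rfl
    have hb2 := hb1.congr (hF2.1 20 (by decide)) (hF2.2 1 (by decide))
    have hmax : ∀ q, I.graph.Consistent I.source g q →
        (I.graph.served I.source g q).ncard ≤ (I.graph.served I.source g p).ncard := fun q hq =>
      Set.ncard_le_ncard (served_anti (hleast q hq))
    refine Wp.ifLe (fun hlt => ?_) fun hlt => ?_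
    · simp only [eval_add, eval_reg, eval_const, hb2.reg, h38] at hlt
      refine Wp.seq (Wp.exec (T := 2) rfl (by decide)
        (Q := fun τ => τ.reg 20 = (I.graph.served I.source g p).ncard)
        fun _ => by simp [exec, h38]) ?_
      rintro σ₃ hF3 h20
      refine (emitOps_spec (hE2.frame hF3 rfl) (hg2.frame hF3 rfl) (hp2.frame hF3 rfl) hcons.lt
        (fun c hc => ?_) hS).mono le_rfl ?_
      · rw [hF3.2 10 (by decide), hF2.2 10 (by decide), hal c hc]
      · rintro τ hF4 hout
        exact ⟨(I.graph.served I.source g p).ncard, by omega,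
          ⟨by rw [hF4.1 20 (by decide), h20], .inr ⟨_, I.isFeasible_planOps kind ha hcost, hout,
            by exact_mod_cast I.ncard_served_le_value hcons⟩⟩,
          fun q hq _ => by exact_mod_cast hmax q hq⟩
    · simp only [eval_add, eval_reg, eval_const, hb2.reg, h38] at hlt
      refine Wp.exec rfl (by rw [bound]; omega) fun _ => ⟨best, le_rfl, hb2, fun q hq _ => ?_⟩
      have := hmax q hq
      omega
  · refine Wp.exec rfl (by rw [bound]; omega) fun _ => ⟨best, le_rfl, hb1, fun q hq hq' => ?_⟩
    rcases h1 with ⟨-, h1 | h1⟩ | ⟨h1, -⟩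
    · exact absurd hq (h1 q)
    · omega
    · simp [h1] at hc

/-- The program that solves `MaxReach`. -/
def solve (kind : ShiftKind) : Prog :=
  seq (readInput kind) <| seq (seq (assign 20 (const (-1))) (assign 21 (const 1))) <|
    whileLe (const 1) (reg 21) (seq tryPlan nextPlan)

/-- The number of plans. -/
def numPlans (I : MaxReachInstance) (kind : ShiftKind) : ℕ :=
  ∏ j ∈ Finset.range (7 * I.k), (I.limits kind j + 1)

/-- A bound for the time of `solve`. -/
def solveTime (I : MaxReachInstance) (kind : ShiftKind) : ℕ :=
  readTime I.k (∑ c, I.graph.len c) +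
    (4 + (numPlans I kind + 1) * (tryTime I + (4 + (7 * I.k + 1) * 40) + 3))

/-- All plans with a number below `t` have been tried. -/
structure SearchInv (I : MaxReachInstance) (kind : ShiftKind) (t : ℕ) (σ : Store) : Prop where
  current : (t < numPlans I kind ∧ σ.reg 21 = 1 ∧ ∃ D : ℕ → ℕ,
    (∀ j < 7 * I.k, D j ≤ I.limits kind j) ∧ (∀ j < 7 * I.k, σ.mem 8 (j : ℤ) = D j) ∧
    mixedRadix (I.limits kind) D (7 * I.k) = t) ∨ (t = numPlans I kind ∧ σ.reg 21 = 0)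
  best : ∃ best, BestSoFar I kind best σ ∧ ∀ D : ℕ → ℕ, (∀ j < 7 * I.k, D j ≤ I.limits kind j) →
    mixedRadix (I.limits kind) D (7 * I.k) < t → ∀ p : Fin I.k → ℕ,
      I.graph.Consistent I.source (planOfDigits D) p →
      ∑ c : Fin I.k, ((planOfDigits D : Plan I.k).dl c + (planOfDigits D : Plan I.k).adv c) ≤
        I.budget →
      ((I.graph.served I.source (planOfDigits D) p).ncard : ℤ) ≤ best

theorem planOfDigits_congr {k : ℕ} {D D' : ℕ → ℕ} (h : ∀ j < 7 * k, D j = D' j) :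
    (planOfDigits D : Plan k) = planOfDigits D' := by
  have key : ∀ (c : Fin k) (m : ℕ), m < 7 → D (c + m * k) = D' (c + m * k) := fun c m hm =>
    h _ (by have := Nat.mul_le_mul_right k (Nat.le_of_lt_succ hm); omega)
  simp only [planOfDigits, Plan.mk.injEq]
  refine ⟨?_, ?_, ?_, ?_, ?_, ?_, ?_⟩ <;> funext c
  · refine Fin.ext ?_
    change D (c : ℕ) % k = D' (c : ℕ) % k
    rw [h c (by omega)]
  all_goals exact key c _ (by norm_num)

/-- Optimality is a sandwich: any feasible sequence is matched by an enumerated plan, so its value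
is at most the final record, which in turn is at most the value of the output. -/
theorem solve_spec (I : MaxReachInstance) (kind : ShiftKind) :
    Wp (solve kind) (Store.init I.encode) (solveTime I kind) fun τ =>
      ∃ ops, τ.HasOutput (encodeOps ops) ∧ I.IsOptimal kind ops := by
  have hS : ∀ c, I.graph.len c ≤ ∑ c, I.graph.len c := fun c =>
    Finset.single_le_sum (f := I.graph.len) (fun _ _ => Nat.zero_le _) (Finset.mem_univ c)
  refine Wp.seq (readInput_spec hS) ?_
  rintro σ₁ hF1 hE1
  have h8 : ∀ m : ℤ, σ₁.mem 8 m = 0 := fun m => by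
    rw [hF1.2 8 (by cases kind <;> decide)]
    simp [Store.init]
  refine Wp.seq (Wp.exec (T := 4) rfl (by decide)
    (Q := fun τ => τ.reg 20 = -1 ∧ τ.reg 21 = 1 ∧ τ.mem 8 = σ₁.mem 8)
    fun _ => by simp [exec]) ?_
  rintro σ₂ hF2 ⟨h20, h21, h8'⟩
  have hE2 := hE1.frame hF2 rfl
  refine (Wp.while_count (B := tryTime I + (4 + (7 * I.k + 1) * 40)) (numPlans I kind)
    (SearchInv I kind) ⟨.inl ⟨Finset.prod_pos fun _ _ => Nat.succ_pos _, h21, fun _ => 0,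
      fun _ _ => Nat.zero_le _, fun j _ => by rw [h8', h8]; rfl,
      mixedRadix_zero fun _ _ => rfl⟩, -1, ⟨h20, .inl rfl⟩, fun _ _ h => absurd h (Nat.not_lt_zero _)⟩
      ?_ ?_).mono (Nat.mul_le_mul_left _ (by simp [Expr.cost])) ?_
  · rintro t τ ht hF ⟨hcur, best, hb, hall⟩
    obtain ⟨-, hgo, D, hD, hDm, hDt⟩ := hcur.resolve_right (by omega)
    have hE := hE2.frame hF rfl
    refine ⟨by simp [hgo], Wp.seq (tryPlan_spec hE (hasPlan_planOfDigits hD hDm)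
      (admissible_planOfDigits hD) hb) ?_⟩
    rintro τ₁ hF3 ⟨best', hbb, hb', hnew⟩
    have hE3 := hE.frame hF3 rfl
    refine (nextPlan_spec hE3 hD (by rw [hF3.2 8 (by decide)]; exact hDm)).mono le_rfl ?_
    rintro τ₂ hF4 hnext
    refine ⟨?_, best', hb'.congr (hF4.1 20 (by decide)) (hF4.2 1 (by decide)), ?_⟩
    · rcases hnext with ⟨hgo', hend⟩ | ⟨hgo', D', hD', hDm', hDt'⟩
      · exact .inr ⟨by rw [← hDt]; exact hend, hgo'⟩
      · have := mixedRadix_lt hD'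
        exact .inl ⟨by rw [← hDt, ← hDt']; exact this, hgo', D', hD', hDm', by rw [hDt', hDt]⟩
    · intro D' hD' hlt p hp hc
      rcases Nat.lt_succ_iff_lt_or_eq.1 hlt with hlt | heq
      · exact (hall D' hD' hlt p hp hc).trans hbb
      · rw [planOfDigits_congr (mixedRadix_injective hD' hD (heq.trans hDt.symm))] at hp hc ⊢
        exact hnew p hp hc
  · rintro τ - ⟨hcur, -⟩
    rcases hcur with ⟨h, -⟩ | ⟨-, h⟩
    · exact absurd h (lt_irrefl _)
    · simp [h]
  · rintro τ - ⟨-, best, hb, hall⟩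
    have key : ∀ ops, I.IsFeasible kind ops → (I.value ops : ℤ) ≤ best := by
      intro ops hops
      obtain ⟨g, p, hp, ha, hc, hv⟩ := I.exists_plan_of_isFeasible kind hops
      have hD : ∀ j < 7 * I.k, digits g j ≤ I.limits kind j := fun j hj => digits_le_limits ha hj
      have := hall (digits g) hD (mixedRadix_lt hD) p
      rw [planOfDigits_digits] at this
      have := this hp hc
      omega
    rcases hb.out with h | ⟨ops, hf, hout, hle⟩
    -- The empty sequence is feasible and has nonnegative value, so the record cannot still be -1
    -- and some output has been written.
    · have := key [] ⟨by simp, by simp⟩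
      omega
    · refine ⟨ops, hout, hf, fun ops' hops' => ?_⟩
      have := key ops' hops'
      omega

end MaxReachInstance

/-! ### The running time -/

/-- Functions that are bounded by a monomial at positive arguments. -/
def PolyBounded (f : ℕ → ℕ) : Prop := ∃ C c : ℕ, ∀ M, 1 ≤ M → f M ≤ C * M ^ c

namespace PolyBounded

variable {f g : ℕ → ℕ}

theorem const (a : ℕ) : PolyBounded fun _ => a := ⟨a, 0, fun M _ => by simp⟩

theorem id : PolyBounded fun M => M := ⟨1, 1, fun M _ => by simp⟩

theorem add (hf : PolyBounded f) (hg : PolyBounded g) : PolyBounded fun M => f M + g M := by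
  obtain ⟨C, c, h⟩ := hf
  obtain ⟨D, d, h'⟩ := hg
  refine ⟨C + D, c + d, fun M hM => ?_⟩
  rw [add_mul]
  refine add_le_add ((h M hM).trans ?_) ((h' M hM).trans ?_) <;> gcongr <;> omega

theorem mul (hf : PolyBounded f) (hg : PolyBounded g) : PolyBounded fun M => f M * g M := by
  obtain ⟨C, c, h⟩ := hf
  obtain ⟨D, d, h'⟩ := hg
  refine ⟨C * D, c + d, fun M hM => ?_⟩
  calc f M * g M ≤ (C * M ^ c) * (D * M ^ d) := Nat.mul_le_mul (h M hM) (h' M hM)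
    _ = C * D * M ^ (c + d) := by ring

end PolyBounded

namespace MaxReachInstance

open KPathGraph

theorem size_pos (I : MaxReachInstance) : 1 ≤ I.graph.size := by
  have := I.source.pos
  rw [KPathGraph.size]
  omega

theorem numPlans_pos (I : MaxReachInstance) (kind : ShiftKind) : 1 ≤ numPlans I kind :=
  Finset.prod_pos fun _ _ => Nat.succ_pos _

theorem exists_solveTime_le : ∃ C c : ℕ, ∀ (I : MaxReachInstance) (kind : ShiftKind),
    solveTime I kind ≤ numPlans I kind * (C * I.graph.size ^ c) := by
  -- All size parameters are replaced by `M`; the factor 2 comes from bounding the number of plans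
  -- plus one by twice that number.
  let F : ℕ → ℕ := fun M => readTime M M + (4 + 2 * (6 + ((M + 1) * (initStep.bound + 5) + 8) +
    (3 + (2 + ((2 * M + 1) * M + 2 * M + 1) * (fixStep.bound + 5))) +
    (3 + (countTime M M M + (5 + (2 + emitOpsTime M M)))) + (4 + (7 * M + 1) * 40) + 3))
  have hF : PolyBounded F := by
    simp only [F, readTime, countTime, emitOpsTime, emitTime]
    repeat' first
      | exact PolyBounded.id
      | exact PolyBounded.const _
      | apply PolyBounded.add
      | apply PolyBounded.mul
  obtain ⟨C, c, h⟩ := hF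
  refine ⟨C, c, fun I kind => le_trans ?_ (Nat.mul_le_mul_left _ (h _ I.size_pos))⟩
  have hn : I.n ≤ I.graph.size := by rw [KPathGraph.size]; omega
  have hk : I.k ≤ I.graph.size := by rw [KPathGraph.size]; omega
  have hS : ∑ c, I.graph.len c ≤ I.graph.size := by rw [KPathGraph.size]; omega
  have hW := numPlans_pos I kind
  rw [solveTime, tryTime, searchTime, fixBound]
  generalize numPlans I kind = W at *
  generalize (∑ c, I.graph.len c) = S at *
  generalize I.graph.size = M at *
  have h1 : readTime I.k S ≤ readTime M M := by
    unfold readTime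
    gcongr
  have h2 : countTime I.n I.k S ≤ countTime M M M := by
    unfold countTime
    gcongr
  have h3 : emitOpsTime I.k S ≤ emitOpsTime M M := by
    unfold emitOpsTime emitTime
    gcongr
  simp only [F]
  rw [mul_add W, mul_add W]
  refine add_le_add (h1.trans (Nat.le_mul_of_pos_left _ hW)) (add_le_add (by omega) ?_)
  rw [← mul_assoc]
  refine Nat.mul_le_mul (by omega) ?_
  gcongr

/-- The k digits for `par` give k^k, the types 5^k, and each of the five numeric blocks at most (2 *
max(b,1))^k; here 160 is 5 * 2^5. -/
theorem numPlans_le (I : MaxReachInstance) (kind : ShiftKind) :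
    numPlans I kind ≤ 160 ^ I.k * I.k ^ I.k * max I.budget 1 ^ (5 * I.k) := by
  set B := max I.budget 1
  have hb : I.budget + 1 ≤ 2 * B := by omega
  have hd : kind.maxDelay I.budget + 1 ≤ 2 * B := by
    cases kind <;> simp only [ShiftKind.maxDelay] <;> omega
  have ha : kind.maxAdvance I.budget + 1 ≤ 2 * B := by
    cases kind <;> simp only [ShiftKind.maxAdvance] <;> omega
  have key : ∀ m v : ℕ, (∀ c : Fin I.k, I.limits kind (c + m * I.k) + 1 ≤ v) →
      ∏ j ∈ Finset.range ((m + 1) * I.k), (I.limits kind j + 1) ≤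
        (∏ j ∈ Finset.range (m * I.k), (I.limits kind j + 1)) * v ^ I.k := by
    intro m v h
    rw [Nat.succ_mul, Finset.prod_range_add]
    refine Nat.mul_le_mul_left _ ?_
    refine (Finset.prod_le_pow_card _ _ v fun j hj => ?_).trans (by simp)
    rw [add_comm (m * I.k)]
    exact h ⟨j, Finset.mem_range.1 hj⟩
  simp only [limits_digit] at key
  have h0 := key 0 I.k fun c => by have := c.pos; simp only; omega
  have h1 := key 1 5 fun c => le_rfl
  have h2 := key 2 _ fun c => hd
  have h3 := key 3 _ fun c => hb
  have h4 := key 4 _ fun c => hb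
  have h5 := key 5 _ fun c => hb
  have h6 := key 6 _ fun c => ha
  calc numPlans I kind
      ≤ 1 * I.k ^ I.k * 5 ^ I.k * (2 * B) ^ I.k * (2 * B) ^ I.k * (2 * B) ^ I.k * (2 * B) ^ I.k *
        (2 * B) ^ I.k := by
        refine h6.trans (Nat.mul_le_mul_right _ (h5.trans (Nat.mul_le_mul_right _ (h4.trans
          (Nat.mul_le_mul_right _ (h3.trans (Nat.mul_le_mul_right _ (h2.trans
          (Nat.mul_le_mul_right _ (h1.trans (Nat.mul_le_mul_right _ (h0.trans
          (Nat.mul_le_mul_right _ (by simp))))))))))))))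
    _ = 160 ^ I.k * I.k ^ I.k * B ^ (5 * I.k) := by
        rw [show (160 : ℕ) = 5 * 2 ^ 5 by norm_num, mul_pow 5 (2 ^ 5), ← pow_mul 2 5]
        ring

/-- Turns the factor 160^k into a constant times k^k: for k at least `a` the second factor suffices,
otherwise the first. -/
theorem pow_le_mul_self_pow (a k : ℕ) (ha : 1 ≤ a) : a ^ k ≤ a ^ a * k ^ k := by
  rcases le_total a k with h | h
  · exact (Nat.pow_le_pow_left h k).trans (Nat.le_mul_of_pos_left _ (Nat.pow_pos ha))
  · refine (Nat.pow_le_pow_right ha h).trans (Nat.le_mul_of_pos_right _ ?_)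
    exact Nat.pow_self_pos

theorem exists_time_le : ∃ C c : ℕ, ∀ (I : MaxReachInstance) (kind : ShiftKind),
    solveTime I kind ≤
      C * max I.budget 1 ^ (6 * I.k) * I.k ^ (2 * I.k) * I.graph.size ^ c := by
  obtain ⟨C, c, h⟩ := exists_solveTime_le
  obtain ⟨A, hA⟩ : ∃ A, ∀ k, 160 ^ k ≤ A * k ^ k :=
    ⟨_, fun k => pow_le_mul_self_pow 160 k (by norm_num)⟩
  refine ⟨A * C, c, fun I kind => ?_⟩
  set B := max I.budget 1
  have hB : 1 ≤ B := by omega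
  calc solveTime I kind ≤ numPlans I kind * (C * I.graph.size ^ c) := h I kind
    _ ≤ (A * I.k ^ I.k * I.k ^ I.k * B ^ (6 * I.k)) * (C * I.graph.size ^ c) := by
        refine Nat.mul_le_mul_right _ ((numPlans_le I kind).trans ?_)
        have := hA I.k
        gcongr
        norm_num
    _ = _ := by rw [two_mul I.k, pow_add]; ring

end MaxReachInstance

theorem SolvableInTime.mono {kind : ShiftKind} {T T' : MaxReachInstance → ℕ}
    (h : SolvableInTime kind T) (hT : ∀ I, T I ≤ T' I) : SolvableInTime kind T' := by
  obtain ⟨p, hp⟩ := h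
  refine ⟨p, fun I => ?_⟩
  obtain ⟨t, τ, ops, h1, h2, h3⟩ := hp I
  exact ⟨t, τ, ops, h1, h2.trans (hT I), h3⟩

theorem solvableInTime_solveTime (kind : ShiftKind) :
    SolvableInTime kind fun I => I.solveTime kind := by
  refine ⟨MaxReachInstance.solve kind, fun I => ?_⟩
  obtain ⟨t, τ, h1, h2, ops, h3⟩ := I.solve_spec kind
  exact ⟨t, τ, ops, h1, h2, h3⟩

theorem primrec_pow : Primrec₂ fun a b : ℕ => a ^ b :=
  Primrec₂.unpaired'.1 Nat.Primrec.pow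

theorem mainTheorem1 (kind : ShiftKind) :
    IsFixedParameterTractable kind (fun I => I.budget + I.k) ∧
      ∃ C c : ℕ, SolvableInTime kind fun I =>
        C * max I.budget 1 ^ (6 * I.k) * I.k ^ (2 * I.k) * I.graph.size ^ c := by
  obtain ⟨C, c, h⟩ := MaxReachInstance.exists_time_le
  have hs := solvableInTime_solveTime kind
  -- With x = b + k both bases max(b,1) and k are at most x + 1, and the exponents 6k and 2k add up
  -- to at most 8x.
  refine ⟨⟨fun x => C * (x + 1) ^ (8 * x), ?_, c, hs.mono fun I => (h I kind).trans ?_⟩,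
    C, c, hs.mono fun I => h I kind⟩
  · exact (Primrec.nat_mul.comp (Primrec.const C) (primrec_pow.comp Primrec.succ
      (Primrec.nat_mul.comp (Primrec.const 8) Primrec.id))).to_comp
  · refine Nat.mul_le_mul_right _ ?_
    set x := I.budget + I.k with hx
    change _ ≤ C * (x + 1) ^ (8 * x)
    rw [show 8 * x = 6 * x + 2 * x by ring, pow_add, mul_assoc]
    refine Nat.mul_le_mul_left _ (Nat.mul_le_mul ?_ ?_)
    · exact (Nat.pow_le_pow_left (by omega) _).trans (Nat.pow_le_pow_right (by omega) (by omega))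
    · exact (Nat.pow_le_pow_left (by omega) _).trans (Nat.pow_le_pow_right (by omega) (by omega))
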